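/- **Notation.** A $U^2$ atom is a right continuous step function $\sum_{j=0}^{n-1}\phi_j\chi_{[t_j,t_{j+1})}$ on $\mathbb R$ with $t_0<\dots<t_{n-1}<t_n=\infty$ and $\sum|\phi_j|^2\le 1$; $\|F\|_{U^2}$ is the infimum of $\sum_j|\lambda_j|$ over all representations $F=\sum_j\lambda_ja_j$ by $U^2$ atoms $a_j$; and $DU^2$ is the space of distributional derivatives $F'$ of functions $F\in U^2$, with $\|F'\|_{DU^2}=\|F\|_{U^2}$. Fix $\chi\in C_0^\infty(\mathbb R)$ with $\sum_{k\in\mathbb Z}\chi(x-k)=1$ for all $x$. For $\sigma>0$ and a distribution $w$ on $\mathbb R$ let $$\|w\|_{l^2_\sigma DU^2}=\Big(\sum_{k\in\mathbb Z}\|\chi(\sigma\,\cdot-k)\,w\|_{DU^2}^2\Big)^{1/2}\in[0,\infty].$$ For distributions $u,v$ on $\mathbb R$, $\operatorname{Im}z>0$ and $j\ge1$ let $$T_{2j}(z)=\int_{x_1<y_1<x_2<\dots<x_j<y_j}\ \prod_{l=1}^je^{2iz(y_l-x_l)}u(y_l)\overline{v(x_l)}\,dx_1dy_1\cdots dx_jdy_j,$$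 understood as an iterated (improper) Stieltjes integral: one integrates successively in $x_1,y_1,\dots,x_j,y_j$ against $d\overline{V}(x_l)$ and $dU(y_l)$, where $U,V$ are right continuous, locally integrable primitives of $u,v$; here $\int_{(a,b]}g\,dU$ is the limit, along refinement of partitions of $[a,b]$, of $\sum_k g(t_k)(U(t_k)-U(t_{k-1}))$, and $\int_{\mathbb R} g\,dU=\lim_{a\to-\infty,\,b\to\infty}\int_{(a,b]}g\,dU$. Let $\tilde T_{2j}(z)$ be the coefficient of $\zeta^j$ in the formal power series $\ln\big(1+\sum_{j\ge1}T_{2j}(z)\zeta^j\big)$, so that formally $T^{-1}=1+\sum_{j\ge1}T_{2j}$ and $-\ln T=\sum_{j\ge1}\tilde T_{2j}$. **Proposition.** (1) There is a constant $c>0$, depending only on $\chi$, such that for all $z$ with $\operatorname{Im}z>0$ and all distributions $u,v$ for which $\|e^{2i\operatorname{Re}z\,x}u\|_{l^2_{\operatorname{Im}z}DU^2}$ and $\|e^{2i\operatorname{Re}z\,x}v\|_{l^2_{\operatorname{Im}z}DU^2}$ are finite, all the iterated integrals above exist and, for every $j\ge1$, $$|T_{2j}(z)|+|\tilde T_{2j}(z)|\le\Big(c\,\|e^{2i\operatorname{Re}z\,x}u\|_{l^2_{\operatorname{Im}z}DU^2}\Big)^j\Big(c\,\|e^{2i\operatorname{Re}z\,x}v\|_{l^2_{\operatorname{Im}z}DU^2}\Big)^j.$$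 (2) There is $\delta>0$, depending only on $\chi$, such that for all distributions $u,v$ with $\|u\|_{l^2_1DU^2}\le\delta$ and $\|v\|_{l^2_1DU^2}\le\delta$ the iterated integrals exist and the series $1+\sum_{j\ge1}T_{2j}(z)$ for $T^{-1}$ and $\sum_{j\ge1}\tilde T_{2j}(z)$ for $-\ln T$ converge uniformly on $\{z:\operatorname{Im}z\ge1+|\operatorname{Re}z|\}$, in particular on the half-line $[i,i\infty)$; and the exponential of the second sum is the first sum. -/

import Mathlib

open Set Filter Topology MeasureTheory
open scoped ContDiff Distributions ENNReal

noncomputable section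

namespace AKNS

/-! ### Distributions on the real line and their products with smooth functions -/

/-- The space of (complex valued) test functions on the real line. -/
abbrev Test : Type := 𝓓((⊤ : TopologicalSpace.Opens ℝ), ℂ)

/-- The space of (complex valued) distributions on the real line. -/
abbrev Distr : Type := Test →L[ℂ] ℂ

/-- Multiplication of test functions by a smooth function `h`. -/
def mulTest (h : ℝ → ℂ) (hh : ContDiff ℝ ∞ h) : Test →L[ℂ] Test :=
  TestFunction.limitCLM ℂ
    (fun f : Test => (⟨fun x => f x * h x, f.contDiff.mul hh, f.hasCompactSupport.mul_right,
      fun _ _ => trivial⟩ : Test))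
    (fun _ hK => (TestFunction.ofSupportedInCLM ℂ hK).comp
      (ContDiffMapSupportedIn.bilinLeftCLM (ContinuousLinearMap.mul ℂ ℂ) hh))
    (fun _ _ _ => rfl)

theorem mulTest_apply (h : ℝ → ℂ) (hh : ContDiff ℝ ∞ h) (f : Test) (x : ℝ) :
    mulTest h hh f x = f x * h x := rfl

/-- The product `h w` of a smooth function `h` and a distribution `w`. -/
def mulDistr (h : ℝ → ℂ) (hh : ContDiff ℝ ∞ h) (w : Distr) : Distr := w.comp (mulTest h hh)

theorem contDiff_wave (ξ : ℝ) :
    ContDiff ℝ ∞ (fun x : ℝ => Complex.exp (Complex.I * ((ξ * x : ℝ) : ℂ))) :=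
  (contDiff_const.mul (Complex.ofRealCLM.contDiff.comp (contDiff_const.mul contDiff_id))).cexp

/-- The distribution `e^{i ξ x} w`. -/
def modulate (ξ : ℝ) (w : Distr) : Distr := mulDistr _ (contDiff_wave ξ) w

/-- The function `F` has distributional derivative `w`: `⟨w, φ⟩ = - ∫ F φ'`. -/
def HasDistrDeriv (F : ℝ → ℂ) (w : Distr) : Prop :=
  ∀ φ : Test, w φ = - ∫ x, F x * deriv φ x

/-! ### The spaces `U²`, `DU²` and `l²_σ DU²` -/

/-- A `U²` atom: a right continuous step function
`∑ φ_j χ_{[t_j, t_{j+1})}`, where `t_0 < ⋯ < t_{n-1} < t_n = ∞` and `∑ |φ_j|² ≤ 1`. -/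
def IsU2Atom (a : ℝ → ℂ) : Prop :=
  ∃ (n : ℕ) (t : ℕ → ℝ) (φ : ℕ → ℂ), StrictMono t ∧ ∑ j ∈ Finset.range n, ‖φ j‖ ^ 2 ≤ 1 ∧
    a = fun x => ∑ j ∈ Finset.range n,
      if t j ≤ x ∧ (j + 1 < n → x < t (j + 1)) then φ j else 0

/-- The `U²` norm, the infimum of `∑ |λ_j|` over all atomic decompositions `F = ∑ λ_j a_j`
(it is `∞` when there is no decomposition with `(λ_j) ∈ l¹`, i.e. when `F ∉ U²`). -/
def u2Norm (F : ℝ → ℂ) : ℝ≥0∞ :=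
  ⨅ (l : ℕ → ℂ) (a : ℕ → ℝ → ℂ) (_ : ∀ j, IsU2Atom (a j))
    (_ : ∀ x, HasSum (fun j => l j * a j x) (F x)), ∑' j, ‖l j‖ₑ

/-- The `DU²` norm: `‖F'‖_{DU²} = ‖F‖_{U²}` for `F ∈ U²`, and `∞` for a distribution which is not
the derivative of a function in `U²`. (A function in `U²` is right continuous with limit `0` at
`-∞`, so that it is determined by its distributional derivative.) -/
def du2Norm (w : Distr) : ℝ≥0∞ :=
  ⨅ (F : ℝ → ℂ) (_ : HasDistrDeriv F w), u2Norm F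

/-- The profile `χ` of a smooth partition of unity `(χ(· - k))_{k ∈ ℤ}` of the real line. -/
structure Cutoff where
  toFun : ℝ → ℝ
  smooth : ContDiff ℝ ∞ toFun
  compact : HasCompactSupport toFun
  sum_one : ∀ x, ∑ᶠ k : ℤ, toFun (x - k) = 1

/-- The cutoff `χ_{[k/σ, (k+1)/σ]}` at scale `1/σ`. -/
def Cutoff.at (χ : Cutoff) (σ : ℝ) (k : ℤ) (x : ℝ) : ℂ := (χ.toFun (σ * x - k) : ℂ)

theorem Cutoff.contDiff_at (χ : Cutoff) (σ : ℝ) (k : ℤ) : ContDiff ℝ ∞ (χ.at σ k) :=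
  Complex.ofRealCLM.contDiff.comp
    (χ.smooth.comp ((contDiff_const.mul contDiff_id).sub contDiff_const))

/-- The `l²_σ DU²` norm, `(∑_k ‖χ_{[k/σ, (k+1)/σ]} w‖²_{DU²})^{1/2}`. -/
def l2du2Norm (χ : Cutoff) (σ : ℝ) (w : Distr) : ℝ≥0∞ :=
  (∑' k : ℤ, du2Norm (mulDistr (χ.at σ k) (χ.contDiff_at σ k) w) ^ 2) ^ (1 / 2 : ℝ)

/-! ### Stieltjes integrals

The product of a function of bounded 2-variation and a distribution `w = U'` with `U` locally in
`U²` is understood in the sense of Stieltjes: `∫ g w = ∫ g dU`, which is the limit over refining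
partitions of the sums `∑ g(t_j) (U(t_j) - U(t_{j-1}))`. -/

/-- The sum of `g(t_j) (U(t_j) - U(t_{j-1}))` over consecutive points of the finite set `P`. -/
def stieltjesSum (g U : ℝ → ℂ) (P : Finset ℝ) : ℂ :=
  ∑ x ∈ P, if h : (P.filter (· < x)).Nonempty
    then g x * (U x - U ((P.filter (· < x)).max' h)) else 0

/-- `∫_{(a,b]} g dU = I`: the Stieltjes sums converge to `I` along the refinement of partitions.
Here `U` is frozen outside of `[a, b]`, so that the partition points outside of `[a, b]` play no
role. -/
def HasStieltjes (g U : ℝ → ℂ) (a b : ℝ) (I : ℂ) : Prop :=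
  Tendsto (stieltjesSum g (fun x => U (max a (min x b)))) atTop (𝓝 I)

/-- The integral `∫_{(a,b]} g dU` (with a junk value if it does not exist). -/
def stieltjes (g U : ℝ → ℂ) (a b : ℝ) : ℂ :=
  limUnder atTop (stieltjesSum g (fun x => U (max a (min x b))))

/-- The improper integral `∫_ℝ g dU` exists. -/
def StieltjesIntegrable (g U : ℝ → ℂ) : Prop :=
  (∀ a b, a ≤ b → ∃ I, HasStieltjes g U a b I) ∧
    ∃ I, Tendsto (fun p : ℝ × ℝ => stieltjes g U p.1 p.2) (atBot ×ˢ atTop) (𝓝 I)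

/-- The integral `∫_ℝ g dU = lim_{a → -∞, b → ∞} ∫_{(a,b]} g dU`
(with a junk value if it does not exist). -/
def stieltjesLine (g U : ℝ → ℂ) : ℂ :=
  limUnder (atBot ×ˢ atTop) (fun p : ℝ × ℝ => stieltjes g U p.1 p.2)

/-- `U` is a right continuous, locally integrable primitive of the distribution `w`. Such a
primitive is unique up to an additive constant, which does not affect Stieltjes integrals. -/
def IsPrimitive (U : ℝ → ℂ) (w : Distr) : Prop :=
  (∀ x, ContinuousWithinAt U (Ici x) x) ∧ LocallyIntegrable U ∧ HasDistrDeriv U w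

open Classical in
/-- A right continuous primitive of `w` (and `0` if there is none). -/
def primitive (w : Distr) : ℝ → ℂ :=
  if h : ∃ U, IsPrimitive U w then Classical.choose h else 0

/-! ### The iterated integrals -/

/-- The integrand, as a function of `x`, of
`∫_{x < y} e^{2iz(y-x)} φ(x) \overline{v(x)} dx`. -/
def innerIntegrand (z : ℂ) (φ : ℝ → ℂ) (y : ℝ) : ℝ → ℂ := fun x =>
  if x < y then Complex.exp (2 * Complex.I * z * ((y : ℂ) - (x : ℂ))) * φ x else 0

/-- `∫_{x < y} e^{2iz(y-x)} φ(x) \overline{v(x)} dx`, where `V` is a primitive of `v`. -/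
def innerIntegral (z : ℂ) (V φ : ℝ → ℂ) (y : ℝ) : ℂ :=
  stieltjesLine (innerIntegrand z φ y) (fun x => (starRingEnd ℂ) (V x))

/-- The integrand, as a function of `y`, of `∫_{y < t} w(y) u(y) dy`. -/
def outerIntegrand (w : ℝ → ℂ) (t : ℝ) : ℝ → ℂ := fun y => if y < t then w y else 0

/-- The functions `φ_0 = 1` and
`φ_{j+1}(t) = ∫_{x < y < t} e^{2iz(y-x)} u(y) \overline{v(x)} φ_j(x) dx dy`, i.e.
`φ_j(t) = ∫_{x_1 < y_1 < ⋯ < x_j < y_j < t} ∏ e^{2iz(y_l-x_l)} u(y_l) \overline{v(x_l)} dx dy`,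
where `U`, `V` are primitives of `u`, `v`. -/
def iter (z : ℂ) (U V : ℝ → ℂ) : ℕ → ℝ → ℂ
  | 0 => fun _ => 1
  | j + 1 => fun t => stieltjesLine (outerIntegrand (innerIntegral z V (iter z U V j)) t) U

/-- The iterated integral
`T_{2j}(z) = ∫_{x_1 < y_1 < ⋯ < x_j < y_j} ∏ e^{2iz(y_l-x_l)} u(y_l) \overline{v(x_l)} dx dy`,
with `T_0 = 1`. -/
def T (z : ℂ) (u v : Distr) : ℕ → ℂ
  | 0 => 1
  | j + 1 =>
    stieltjesLine (innerIntegral z (primitive v) (iter z (primitive u) (primitive v) j)) (primitive u)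

/-- `u` and `v` have right continuous primitives, and all the Stieltjes integrals in the definition
of the iterated integrals `T_{2j}(z)` exist. -/
def IteratedIntegralsExist (z : ℂ) (u v : Distr) : Prop :=
  (∃ U, IsPrimitive U u) ∧ (∃ V, IsPrimitive V v) ∧
    ∀ j,
      (∀ y, StieltjesIntegrable
        (innerIntegrand z (iter z (primitive u) (primitive v) j) y)
        (fun x => (starRingEnd ℂ) (primitive v x))) ∧
      (∀ t, StieltjesIntegrable
        (outerIntegrand (innerIntegral z (primitive v) (iter z (primitive u) (primitive v) j)) t)
        (primitive u)) ∧
      StieltjesIntegrable (innerIntegral z (primitive v) (iter z (primitive u) (primitive v) j))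
        (primitive u)

/-- The terms `T̃_{2j}(z)` of the expansion of `-ln T = ln (T⁻¹)`: the term of homogeneity `2j` in
the formal expansion of `ln (1 + ∑_{j ≥ 1} T_{2j}(z))`, i.e. the coefficient of `ζ^j` of the formal
power series `ln (1 + ∑_{j ≥ 1} T_{2j}(z) ζ^j)`. -/
def Ttilde (z : ℂ) (u v : Distr) (j : ℕ) : ℂ :=
  PowerSeries.coeff j (PowerSeries.logOf (PowerSeries.mk (T z u v)))

end AKNS

end

noncomputable section

namespace AKNS

/-! The engine is the duality between $U^2$ and bounded 2-variation. Abel summation and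
Cauchy–Schwarz bound the Stieltjes sums of $g$ against an atom by the sup and the 2-variation of $g$
(`norm_step_sum_le`). Summing over atoms, $\int g\,dU$ exists and is controlled by the $U^2$ norm of
$U$ (`HasAtomicDecomp.stieltjes`). Conversely, if $\int c\,w\,dU$ is bounded uniformly over
normalised step functions $c$, then $t\mapsto\int_{x<t}w\,dU$ has bounded 2-variation
(`V2.of_hasLineIntegral`). Integration therefore returns a function of the class it started from and
can be iterated.

Put $\sigma=\operatorname{Im}z$ and cut the line into cells of length $1/\sigma$. The kernel
$e^{2iz(y-x)}$ factors into a function of $y$ and one of $x$ (`exp_kernel`). The oscillating factors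
go into the measures as $e^{\pm2i\operatorname{Re}z\,x}$. The remaining real exponentials have
bounded variation on each cell and decay geometrically in the distance between the cells of $x$ and
$y$. A double integral is then a convolution of the local norms of $v$ with a summable sequence,
paired with the local norms of $u$, so Young's inequality bounds it by the product of the $\ell^2$
norms. Induction on $j$ gives $|T_{2j}|\le q^j$ (`KernelBounds.v2_iter`, `KernelBounds.norm_T_le`).
The recursion coming from $f\,(\ln f)'=f'$ turns this into $|\tilde T_{2j}|\le(2q)^j$
(`norm_logCoeff_le`).

What remains is to supply the local bounds. For (1), a primitive $W$ of
$e^{2i\operatorname{Re}z\,x}u$ is glued from primitives of the localised pieces, and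
$dU=e^{-2i\operatorname{Re}z\,x}dW$ is justified on partitions (`HasStieltjes.wave_mul`). For (2),
the norm lives at unit scale while the cells have length $1/\sigma\le1$. A second use of duality
shows that the constants of the small cells in a unit interval are square summable with sum
controlled by that interval's constant (`sum_sq_cellConst_le`). In the cone
$|2\operatorname{Re}z|\le2\sigma$, so the plane wave is harmless on a small cell. The bounds do not
depend on $z$, which gives uniform convergence. -/

/-! ### Functions of bounded 2-variation -/

/-- `g` is bounded by `C` on `s` and its 2-variation on `s` is at most `C`. -/
structure V2 (g : ℝ → ℂ) (s : Set ℝ) (C : ℝ) : Prop where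
  nonneg : 0 ≤ C
  bound : ∀ x ∈ s, ‖g x‖ ≤ C
  var : ∀ (n : ℕ) (t : ℕ → ℝ), Monotone t → (∀ i, t i ∈ s) →
    ∑ i ∈ Finset.range n, ‖g (t (i + 1)) - g (t i)‖ ^ 2 ≤ C ^ 2

theorem V2.mono {g : ℝ → ℂ} {s s' : Set ℝ} {C C' : ℝ} (h : V2 g s C) (hs : s' ⊆ s) (hC : C ≤ C') :
    V2 g s' C' :=
  ⟨h.nonneg.trans hC, fun x hx => (h.bound x (hs hx)).trans hC, fun n t ht hts =>
    (h.var n t ht fun i => hs (hts i)).trans (pow_le_pow_left₀ h.nonneg hC 2)⟩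

theorem V2.congr {g g' : ℝ → ℂ} {s : Set ℝ} {C : ℝ} (h : V2 g s C) (hg : ∀ x ∈ s, g' x = g x) :
    V2 g' s C :=
  ⟨h.nonneg, fun x hx => by rw [hg x hx]; exact h.bound x hx, fun n t ht hts => by
    have := h.var n t ht hts
    simpa only [hg _ (hts _)] using this⟩

theorem V2.zero (s : Set ℝ) {C : ℝ} (hC : 0 ≤ C) : V2 (fun _ => 0) s C :=
  ⟨hC, fun x _ => by simpa using hC, fun n t _ _ => by simpa using sq_nonneg C⟩

/-- The Leibniz rule for increments. Cross terms are absorbed by $(p+q)^2\le2p^2+2q^2$, and the two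
contributions $2C^2D^2$ add up to $(2CD)^2$. -/
theorem V2.mul {g h : ℝ → ℂ} {s : Set ℝ} {C D : ℝ} (hg : V2 g s C) (hh : V2 h s D) :
    V2 (fun x => g x * h x) s (2 * C * D) := by
  have hCD := mul_nonneg hg.nonneg hh.nonneg
  refine ⟨by linarith, fun x hx => ?_, fun n t ht hts => ?_⟩
  · rw [norm_mul]
    have := mul_le_mul (hg.bound x hx) (hh.bound x hx) (norm_nonneg _) hg.nonneg
    linarith
  · have key : ∀ i, ‖g (t (i + 1)) * h (t (i + 1)) - g (t i) * h (t i)‖ ^ 2 ≤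
        2 * C ^ 2 * ‖h (t (i + 1)) - h (t i)‖ ^ 2 + 2 * D ^ 2 * ‖g (t (i + 1)) - g (t i)‖ ^ 2 := by
      intro i
      have e : g (t (i + 1)) * h (t (i + 1)) - g (t i) * h (t i) =
          g (t (i + 1)) * (h (t (i + 1)) - h (t i)) + (g (t (i + 1)) - g (t i)) * h (t i) := by ring
      have h1 : ‖g (t (i + 1)) * h (t (i + 1)) - g (t i) * h (t i)‖ ≤
          C * ‖h (t (i + 1)) - h (t i)‖ + D * ‖g (t (i + 1)) - g (t i)‖ := by
        rw [e]
        refine (norm_add_le _ _).trans ?_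
        rw [norm_mul, norm_mul, mul_comm (‖g (t (i + 1)) - g (t i)‖)]
        gcongr
        · exact hg.bound _ (hts _)
        · exact hh.bound _ (hts _)
      have h2 := pow_le_pow_left₀ (norm_nonneg _) h1 2
      nlinarith [sq_nonneg (C * ‖h (t (i + 1)) - h (t i)‖ - D * ‖g (t (i + 1)) - g (t i)‖)]
    refine (Finset.sum_le_sum fun i _ => key i).trans ?_
    rw [Finset.sum_add_distrib, ← Finset.mul_sum, ← Finset.mul_sum]
    have h1 := mul_le_mul_of_nonneg_left (hg.var n t ht hts) (by positivity : 0 ≤ 2 * D ^ 2)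
    have h2 := mul_le_mul_of_nonneg_left (hh.var n t ht hts) (by positivity : 0 ≤ 2 * C ^ 2)
    nlinarith

theorem V2.const_mul {g : ℝ → ℂ} {s : Set ℝ} {C : ℝ} (hg : V2 g s C) (c : ℂ) :
    V2 (fun x => c * g x) s (‖c‖ * C) := by
  refine ⟨mul_nonneg (norm_nonneg _) hg.nonneg, fun x hx => ?_, fun n t ht hts => ?_⟩
  · rw [norm_mul]
    exact mul_le_mul_of_nonneg_left (hg.bound x hx) (norm_nonneg _)
  · simp_rw [← mul_sub, norm_mul, mul_pow, ← Finset.mul_sum]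
    exact mul_le_mul_of_nonneg_left (hg.var n t ht hts) (by positivity)

theorem V2.conj {g : ℝ → ℂ} {s : Set ℝ} {C : ℝ} (hg : V2 g s C) :
    V2 (fun x => (starRingEnd ℂ) (g x)) s C :=
  ⟨hg.nonneg, fun x hx => by simpa using hg.bound x hx, fun n t ht hts => by
    simpa only [← map_sub, RCLike.norm_conj] using hg.var n t ht hts⟩

/-- A function whose increments are dominated by those of a function of bounded oscillation. -/
theorem V2.of_dominated {g : ℝ → ℂ} {s : Set ℝ} {C : ℝ} (f : ℝ → ℝ) (hC : 0 ≤ C)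
    (hb : ∀ x ∈ s, ‖g x‖ ≤ C) (hf : ∀ x ∈ s, ∀ y ∈ s, x ≤ y → ‖g y - g x‖ ≤ f y - f x)
    (hfC : ∀ x ∈ s, ∀ y ∈ s, x ≤ y → f y - f x ≤ C) : V2 g s C := by
  refine ⟨hC, hb, fun n t ht hts => ?_⟩
  calc ∑ i ∈ Finset.range n, ‖g (t (i + 1)) - g (t i)‖ ^ 2
      ≤ ∑ i ∈ Finset.range n, C * (f (t (i + 1)) - f (t i)) := by
        refine Finset.sum_le_sum fun i _ => ?_
        have h1 := hf _ (hts i) _ (hts (i + 1)) (ht (Nat.le_succ i))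
        have h2 := hfC _ (hts i) _ (hts (i + 1)) (ht (Nat.le_succ i))
        nlinarith [norm_nonneg (g (t (i + 1)) - g (t i))]
    _ = C * (f (t n) - f (t 0)) := by
        rw [← Finset.mul_sum, Finset.sum_range_sub (fun i => f (t i))]
    _ ≤ C ^ 2 := by
        have := hfC _ (hts 0) _ (hts n) (ht (Nat.zero_le n))
        nlinarith

/-- Localisation of 2-variation. Steps staying inside a fibre of `κ` contribute at most $\sum
C_m^2\le M^2$. By monotonicity each fibre is entered and left at most once, so the crossing steps
contribute at most $4M^2$, estimated by sup norms. The total is $5M^2\le(3M)^2$. -/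
theorem V2.of_fibres {g : ℝ → ℂ} {s : Set ℝ} {κ : ℝ → ℤ} (hκ : MonotoneOn κ s) {C : ℤ → ℝ} {M : ℝ}
    (hM : 0 ≤ M) (hg : ∀ m, V2 g (s ∩ κ ⁻¹' {m}) (C m))
    (hC : ∀ T : Finset ℤ, ∑ m ∈ T, C m ^ 2 ≤ M ^ 2) : V2 g s (3 * M) := by
  classical
  refine ⟨by linarith, fun x hx => ?_, fun n t ht hts => ?_⟩
  · have h1 := (hg (κ x)).bound x ⟨hx, rfl⟩
    have h2 := hC {κ x}
    rw [Finset.sum_singleton] at h2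
    have h3 := abs_le_of_sq_le_sq h2 hM
    linarith [(abs_le.1 h3).2, le_abs_self (C (κ x))]
  · set k : ℕ → ℤ := fun i => κ (t i) with hk
    have hkm : Monotone k := fun i j hij => hκ (hts i) (hts j) (ht hij)
    set d : ℕ → ℝ := fun i => ‖g (t (i + 1)) - g (t i)‖ ^ 2 with hd
    have hb : ∀ i, ‖g (t i)‖ ≤ C (k i) := fun i => (hg (k i)).bound _ ⟨hts i, rfl⟩
    rw [← Finset.sum_filter_add_sum_filter_not (Finset.range n) (fun i => k i = k (i + 1))]
    have hsame : ∑ i ∈ (Finset.range n).filter (fun i => k i = k (i + 1)), d i ≤ M ^ 2 := by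
      set S := (Finset.range n).filter (fun i => k i = k (i + 1)) with hS
      rw [← Finset.sum_fiberwise_of_maps_to (g := k) (t := S.image k)
        (fun i hi => Finset.mem_image_of_mem k hi)]
      refine (Finset.sum_le_sum fun m hm => ?_).trans (hC (S.image k))
      set I := (Finset.range (n + 1)).filter (fun i => k i = m) with hI
      have hne : I.Nonempty := by
        obtain ⟨i, hi, him⟩ := Finset.mem_image.1 hm
        refine ⟨i, ?_⟩
        simp only [hS, hI, Finset.mem_filter, Finset.mem_range] at hi ⊢
        exact ⟨by omega, him⟩
      set i0 := I.min' hne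
      set i1 := I.max' hne
      have h0 : k i0 = m := (Finset.mem_filter.1 (I.min'_mem hne)).2
      have h1 : k i1 = m := (Finset.mem_filter.1 (I.max'_mem hne)).2
      have h01 : i0 ≤ i1 := I.min'_le _ (I.max'_mem hne)
      -- Clamping the index between the first and last visit to fibre `m` gives a monotone sequence
      -- that never leaves the fibre, with unchanged increments in between.
      have hv := (hg m).var n (fun i => t (max i0 (min i i1)))
        (fun i j hij => ht (max_le_max le_rfl (min_le_min hij le_rfl)))
        (fun i => ⟨hts _, by
          have a1 := hkm (le_max_left i0 (min i i1))
          have a2 := hkm (max_le h01 (min_le_right i i1))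
          simp only [mem_preimage, mem_singleton_iff]
          change k _ = m
          omega⟩)
      refine le_trans ?_ hv
      have hsub : S.filter (fun i => k i = m) ⊆ Finset.range n :=
        (Finset.filter_subset _ _).trans (Finset.filter_subset _ _)
      refine le_trans (Finset.sum_le_sum fun i hi => ?_)
        (Finset.sum_le_sum_of_subset_of_nonneg hsub fun i _ _ => by positivity)
      simp only [hS, Finset.mem_filter, Finset.mem_range] at hi
      have b0 : i0 ≤ i := I.min'_le _ (by simp only [hI, Finset.mem_filter, Finset.mem_range]; omega)
      have b1 : i + 1 ≤ i1 :=
        I.le_max' _ (by simp only [hI, Finset.mem_filter, Finset.mem_range]; omega)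
      have e0 : max i0 (min i i1) = i := by omega
      have e1 : max i0 (min (i + 1) i1) = i + 1 := by omega
      simp only [e0, e1, hd]; exact le_rfl
    have hcross : ∑ i ∈ (Finset.range n).filter (fun i => ¬ k i = k (i + 1)), d i ≤ 4 * M ^ 2 := by
      set S := (Finset.range n).filter (fun i => ¬ k i = k (i + 1)) with hS
      have hlt : ∀ i ∈ S, k i < k (i + 1) := fun i hi =>
        lt_of_le_of_ne (hkm (Nat.le_succ i)) (Finset.mem_filter.1 hi).2
      have inj0 : Set.InjOn k S := by
        intro i hi j hj hij
        by_contra hne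
        rcases lt_or_gt_of_ne hne with h | h
        · have := hlt i hi; have := hkm (show i + 1 ≤ j from h); omega
        · have := hlt j hj; have := hkm (show j + 1 ≤ i from h); omega
      have inj1 : Set.InjOn (fun i => k (i + 1)) S := by
        intro i hi j hj hij
        simp only at hij
        by_contra hne
        rcases lt_or_gt_of_ne hne with h | h
        · have := hlt j hj; have := hkm (show i + 1 ≤ j from h); omega
        · have := hlt i hi; have := hkm (show j + 1 ≤ i from h); omega
      have e0 : ∑ i ∈ S, C (k i) ^ 2 ≤ M ^ 2 := by
        have := hC (S.image k)
        rwa [Finset.sum_image inj0] at this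
      have e1 : ∑ i ∈ S, C (k (i + 1)) ^ 2 ≤ M ^ 2 := by
        have := hC (S.image fun i => k (i + 1))
        rwa [Finset.sum_image inj1] at this
      calc ∑ i ∈ S, d i ≤ ∑ i ∈ S, (2 * C (k i) ^ 2 + 2 * C (k (i + 1)) ^ 2) := by
            refine Finset.sum_le_sum fun i _ => ?_
            have h1 := norm_sub_le (g (t (i + 1))) (g (t i))
            have h2 : ‖g (t (i + 1)) - g (t i)‖ ≤ C (k (i + 1)) + C (k i) := by
              linarith [hb i, hb (i + 1)]
            have h3 := pow_le_pow_left₀ (norm_nonneg _) h2 2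
            simp only [hd]
            nlinarith [sq_nonneg (C (k (i + 1)) - C (k i))]
        _ ≤ 4 * M ^ 2 := by
            rw [Finset.sum_add_distrib, ← Finset.mul_sum, ← Finset.mul_sum]; linarith
    nlinarith

theorem V2.of_step {κ : ℝ → ℤ} (hκ : Monotone κ) {φ : ℤ → ℂ}
    (hφ : ∀ T : Finset ℤ, ∑ m ∈ T, ‖φ m‖ ^ 2 ≤ 1) : V2 (fun x => φ (κ x)) univ 3 := by
  have := V2.of_fibres (g := fun x => φ (κ x)) (hκ.monotoneOn univ) (C := fun m => ‖φ m‖)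
    zero_le_one (fun m => ⟨norm_nonneg _, fun x hx => ?_, fun n t ht hts => ?_⟩)
    (by simpa using hφ)
  · simpa using this
  · have : κ x = m := hx.2
    simp [this]
  · have : ∀ i, κ (t i) = m := fun i => (hts i).2
    simp [this]

/-- The extension by zero of a function of bounded 2-variation on `(a, b]`. -/
theorem V2.indicator {g : ℝ → ℂ} {a b C : ℝ} (hg : V2 g (Ioc a b) C) :
    V2 ((Ioc a b).indicator g) univ (3 * C) := by
  classical
  rcases lt_or_ge b a with hab | hab
  · rw [Ioc_eq_empty (by linarith), indicator_empty]
    exact V2.zero _ (by linarith [hg.nonneg])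
  -- Three fibres: left of the interval, the interval, right of it. Only the middle one carries a
  -- nonzero constant.
  set κ : ℝ → ℤ := fun x => if x ≤ a then -1 else if x ≤ b then 0 else 1 with hκ
  refine V2.of_fibres (κ := κ) (C := fun m => if m = 0 then C else 0) ?_ hg.nonneg ?_ ?_
  · intro x _ y _ hxy
    simp only [hκ]
    split_ifs <;> first | omega | (exfalso; linarith)
  · intro m
    by_cases hm : m = 0
    · subst hm
      have hsub : ∀ x ∈ univ ∩ κ ⁻¹' {0}, x ∈ Ioc a b := by
        rintro x ⟨-, hx⟩
        simp only [hκ, mem_preimage, mem_singleton_iff] at hx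
        split_ifs at hx with h1 h2
        · exact ⟨not_le.1 h1, h2⟩
        · exact absurd hx one_ne_zero
      simp only [if_true]
      exact (hg.mono hsub le_rfl).congr fun x hx => indicator_of_mem (hsub x hx) g
    · simp only [hm, if_false]
      refine (V2.zero _ le_rfl).congr fun x hx => indicator_of_notMem ?_ g
      rintro ⟨h1, h2⟩
      apply hm
      have : κ x = m := hx.2
      rw [← this]
      simp [hκ, not_le.2 h1, h2]
  · intro T
    have : ∀ m : ℤ, (if m = 0 then C else 0) ^ 2 = if m = 0 then C ^ 2 else 0 := by
      intro m; split_ifs <;> simp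
    simp only [this, Finset.sum_ite_eq']
    split_ifs
    · exact le_rfl
    · exact sq_nonneg C

/-! ### Duality between step functions and functions of bounded 2-variation -/

theorem norm_sum_mul_le {n : ℕ} (c d : ℕ → ℂ) {C D : ℝ} (hC : 0 ≤ C) (hD : 0 ≤ D)
    (hc : ∑ i ∈ Finset.range n, ‖c i‖ ^ 2 ≤ C ^ 2) (hd : ∑ i ∈ Finset.range n, ‖d i‖ ^ 2 ≤ D ^ 2) :
    ‖∑ i ∈ Finset.range n, c i * d i‖ ≤ C * D := by
  have h1 := Finset.sum_mul_sq_le_sq_mul_sq (Finset.range n) (fun i => ‖c i‖) (fun i => ‖d i‖)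
  have h2 : (∑ i ∈ Finset.range n, ‖c i‖ * ‖d i‖) ^ 2 ≤ (C * D) ^ 2 := by
    rw [mul_pow]
    exact h1.trans (mul_le_mul hc hd (Finset.sum_nonneg fun i _ => by positivity) (sq_nonneg C))
  have h3 := abs_le_of_sq_le_sq h2 (mul_nonneg hC hD)
  refine (norm_sum_le _ _).trans ?_
  simp_rw [norm_mul]
  exact (abs_le.1 h3).2

/-- $\ell^2$ duality, tested with $c_i=\overline{d_i}/\|d\|_{\ell^2}$. -/
theorem sum_sq_le_of_dual {ι : Type*} (s : Finset ι) (d : ι → ℂ) {M : ℝ}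
    (h : ∀ c : ι → ℂ, ∑ i ∈ s, ‖c i‖ ^ 2 ≤ 1 →
      ‖∑ i ∈ s, c i * d i‖ ≤ M) :
    ∑ i ∈ s, ‖d i‖ ^ 2 ≤ M ^ 2 := by
  set S := ∑ i ∈ s, ‖d i‖ ^ 2 with hS
  have hS0 : 0 ≤ S := Finset.sum_nonneg fun i _ => by positivity
  rcases hS0.eq_or_lt with h0 | h0
  · rw [← h0]; positivity
  have hr : 0 < √S := Real.sqrt_pos.2 h0
  have hrr : √S ^ 2 = S := Real.sq_sqrt hS0
  have := h (fun i => (starRingEnd ℂ) (d i) / (√S : ℝ)) (by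
    simp only [norm_div, RCLike.norm_conj, Complex.norm_real, Real.norm_eq_abs, div_pow, sq_abs,
      hrr, ← Finset.sum_div]
    rw [← hS, div_self h0.ne'])
  have e : ∑ i ∈ s, (starRingEnd ℂ) (d i) / (√S : ℝ) * d i = ((√S : ℝ) : ℂ) := by
    have : ∀ i, (starRingEnd ℂ) (d i) / ((√S : ℝ) : ℂ) * d i = ((‖d i‖ ^ 2 / √S : ℝ) : ℂ) := by
      intro i
      rw [div_mul_eq_mul_div, mul_comm, Complex.mul_conj, Complex.normSq_eq_norm_sq]
      push_cast; rfl
    simp_rw [this]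
    rw [← Complex.ofReal_sum, ← Finset.sum_div, ← hS]
    congr 1
    rw [div_eq_iff hr.ne', ← sq, hrr]
  rw [e, Complex.norm_real, Real.norm_eq_abs, abs_of_pos hr] at this
  rw [← hrr]
  exact pow_le_pow_left₀ hr.le this 2

/-- Abel summation moves the differences onto `g`. Indices with the same value of `κ` must be merged
first: otherwise one $\phi_m$ would appear arbitrarily often and $\sum|\phi_m|^2\le1$ would be
useless. After merging, Cauchy–Schwarz gives `C`, and each of the two boundary terms gives another
`C`. -/
theorem norm_step_sum_le {κ : ℝ → ℕ} (hκ : Monotone κ) {φ : ℕ → ℂ}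
    (hφ : ∀ N, ∑ m ∈ Finset.range N, ‖φ m‖ ^ 2 ≤ 1) {g : ℝ → ℂ} {C : ℝ} {s : Set ℝ} (hg : V2 g s C)
    (n : ℕ) {t : ℕ → ℝ} (ht : Monotone t) (hts : ∀ i, t i ∈ s) :
    ‖∑ i ∈ Finset.range n, g (t (i + 1)) * (φ (κ (t (i + 1))) - φ (κ (t i)))‖ ≤ 3 * C := by
  classical
  set k : ℕ → ℕ := fun i => κ (t i) with hk
  have hkm : Monotone k := fun i j hij => hκ (ht hij)
  have hφ1 : ∀ m, ‖φ m‖ ≤ 1 := fun m => by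
    have h1 := (Finset.single_le_sum (f := fun m => ‖φ m‖ ^ 2) (fun i _ => by positivity)
      (Finset.self_mem_range_succ m)).trans (hφ (m + 1))
    exact (sq_le_one_iff₀ (norm_nonneg _)).1 h1
  have hgb : ∀ i, ‖g (t i)‖ ≤ C := fun i => hg.bound _ (hts i)
  have parts : ∀ n, ∑ i ∈ Finset.range n, g (t (i + 1)) * (φ (k (i + 1)) - φ (k i)) =
      g (t n) * φ (k n) - g (t 0) * φ (k 0) -
        ∑ i ∈ Finset.range n, φ (k i) * (g (t (i + 1)) - g (t i)) := by
    intro n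
    induction n with
    | zero => simp
    | succ n ih => rw [Finset.sum_range_succ, ih, Finset.sum_range_succ]; ring
  -- `τ m` is the first index at which `κ ∘ t` reaches level `m`, capped at `n`. The indices on
  -- level `m` form $[\tau(m),\tau(m+1))$, where the increments of `g` telescope.
  set τ : ℕ → ℕ := fun m => ((Finset.range n).filter fun i => k i < m).card with hτ
  have hτm : Monotone τ := fun a b hab => Finset.card_le_card fun i hi => by
    simp only [Finset.mem_filter] at hi ⊢
    exact ⟨hi.1, hi.2.trans_le hab⟩
  have hfilt : ∀ m, (Finset.range n).filter (fun i => k i < m) = Finset.range (τ m) := by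
    intro m
    have hs : ∀ i ∈ (Finset.range n).filter (fun i => k i < m), ∀ j ≤ i,
        j ∈ (Finset.range n).filter (fun i => k i < m) := by
      intro i hi j hj
      simp only [Finset.mem_filter, Finset.mem_range] at hi ⊢
      exact ⟨by omega, (hkm hj).trans_lt hi.2⟩
    refine Finset.eq_of_subset_of_card_le (fun i hi => ?_) (by rw [Finset.card_range])
    rw [Finset.mem_range]
    have : Finset.range (i + 1) ⊆ (Finset.range n).filter (fun i => k i < m) := fun j hj =>
      hs i hi j (by simpa [Nat.lt_succ_iff] using hj)
    simpa using Finset.card_le_card this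
  have hthird : ∑ i ∈ Finset.range n, φ (k i) * (g (t (i + 1)) - g (t i)) =
      ∑ m ∈ Finset.range (k n + 1), φ m * (g (t (τ (m + 1))) - g (t (τ m))) := by
    rw [← Finset.sum_fiberwise_of_maps_to (g := k) (t := Finset.range (k n + 1))
      (fun i hi => Finset.mem_range.2 (Nat.lt_succ_of_le (hkm (Finset.mem_range.1 hi).le)))]
    refine Finset.sum_congr rfl fun m _ => ?_
    have hfib : (Finset.range n).filter (fun i => k i = m) = Finset.Ico (τ m) (τ (m + 1)) := by
      ext i
      have h1 := Finset.ext_iff.1 (hfilt m) i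
      have h2 := Finset.ext_iff.1 (hfilt (m + 1)) i
      simp only [Finset.mem_filter, Finset.mem_range, Finset.mem_Ico] at h1 h2 ⊢
      constructor
      · rintro ⟨hi, him⟩
        exact ⟨not_lt.1 fun h => by have := (h1.2 h).2; omega, h2.1 ⟨hi, by omega⟩⟩
      · rintro ⟨ha, hb⟩
        have hb' := h2.2 hb
        refine ⟨hb'.1, le_antisymm (by omega) (not_lt.1 fun h => ?_)⟩
        exact absurd (h1.1 ⟨hb'.1, h⟩) (by omega)
    rw [hfib, ← Finset.sum_Ico_sub (fun i => g (t i)) (hτm (Nat.le_succ m)), Finset.mul_sum]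
    refine Finset.sum_congr rfl fun i hi => ?_
    rw [← hfib] at hi
    rw [(Finset.mem_filter.1 hi).2]
  have hb3 : ‖∑ i ∈ Finset.range n, φ (k i) * (g (t (i + 1)) - g (t i))‖ ≤ 1 * C := by
    rw [hthird]
    refine norm_sum_mul_le φ _ zero_le_one hg.nonneg (by simpa using hφ _) ?_
    exact hg.var (k n + 1) (fun m => t (τ m)) (fun a b hab => ht (hτm hab)) (fun i => hts _)
  have hb1 : ∀ i, ‖g (t i) * φ (k i)‖ ≤ C := fun i => by
    rw [norm_mul]
    exact (mul_le_mul (hgb i) (hφ1 _) (norm_nonneg _) hg.nonneg).trans (mul_one C).le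
  change ‖∑ i ∈ Finset.range n, g (t (i + 1)) * (φ (k (i + 1)) - φ (k i))‖ ≤ 3 * C
  rw [parts]
  have h1 := norm_sub_le (g (t n) * φ (k n) - g (t 0) * φ (k 0))
    (∑ i ∈ Finset.range n, φ (k i) * (g (t (i + 1)) - g (t i)))
  have h2 := norm_sub_le (g (t n) * φ (k n)) (g (t 0) * φ (k 0))
  linarith [hb1 n, hb1 0]

/-! ### Elementary properties of Stieltjes sums and integrals -/

theorem stieltjesSum_add_right (g U W : ℝ → ℂ) (P : Finset ℝ) :
    stieltjesSum g (fun x => U x + W x) P = stieltjesSum g U P + stieltjesSum g W P := by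
  simp only [stieltjesSum, ← Finset.sum_add_distrib]
  refine Finset.sum_congr rfl fun x _ => ?_
  split_ifs <;> ring

theorem stieltjesSum_mul_right (c : ℂ) (g U : ℝ → ℂ) (P : Finset ℝ) :
    stieltjesSum g (fun x => c * U x) P = c * stieltjesSum g U P := by
  simp only [stieltjesSum, Finset.mul_sum]
  refine Finset.sum_congr rfl fun x _ => ?_
  split_ifs <;> ring

theorem stieltjesSum_const (g : ℝ → ℂ) (c : ℂ) (P : Finset ℝ) :
    stieltjesSum g (fun _ => c) P = 0 := by
  simp [stieltjesSum]

theorem stieltjesSum_add_left (g h U : ℝ → ℂ) (P : Finset ℝ) :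
    stieltjesSum (fun x => g x + h x) U P = stieltjesSum g U P + stieltjesSum h U P := by
  simp only [stieltjesSum, ← Finset.sum_add_distrib]
  refine Finset.sum_congr rfl fun x _ => ?_
  split_ifs <;> ring

theorem stieltjesSum_mul_left (c : ℂ) (g U : ℝ → ℂ) (P : Finset ℝ) :
    stieltjesSum (fun x => c * g x) U P = c * stieltjesSum g U P := by
  simp only [stieltjesSum, Finset.mul_sum]
  refine Finset.sum_congr rfl fun x _ => ?_
  split_ifs <;> ring

theorem stieltjesSum_conj (g U : ℝ → ℂ) (P : Finset ℝ) :
    stieltjesSum (fun x => (starRingEnd ℂ) (g x)) (fun x => (starRingEnd ℂ) (U x)) P =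
      (starRingEnd ℂ) (stieltjesSum g U P) := by
  simp only [stieltjesSum, map_sum]
  refine Finset.sum_congr rfl fun x _ => ?_
  split_ifs <;> simp

theorem stieltjesSum_hasSum (g : ℝ → ℂ) {U : ℝ → ℂ} {W : ℕ → ℝ → ℂ}
    (h : ∀ x, HasSum (fun j => W j x) (U x)) (P : Finset ℝ) :
    HasSum (fun j => stieltjesSum g (W j) P) (stieltjesSum g U P) := by
  simp only [stieltjesSum]
  refine hasSum_sum fun x _ => ?_
  split_ifs
  · exact ((h _).sub (h _)).mul_left _
  · exact hasSum_zero

theorem stieltjesSum_insert_max (g U : ℝ → ℂ) {P : Finset ℝ} {a : ℝ} (ha : ∀ x ∈ P, x < a)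
    (hP : P.Nonempty) :
    stieltjesSum g U (insert a P) = stieltjesSum g U P + g a * (U a - U (P.max' hP)) := by
  have haP : a ∉ P := fun h => lt_irrefl _ (ha a h)
  have h1 : (insert a P).filter (· < a) = P := by
    rw [Finset.filter_insert, if_neg (lt_irrefl a), Finset.filter_true_of_mem ha]
  have h2 : ∀ x ∈ P, (insert a P).filter (· < x) = P.filter (· < x) := fun x hx => by
    rw [Finset.filter_insert, if_neg (not_lt.2 (ha x hx).le)]
  rw [stieltjesSum, Finset.sum_insert haP, add_comm]
  congr 1
  · exact Finset.sum_congr rfl fun x hx => by simp only [h2 x hx]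
  · simp only [h1]
    rw [dif_pos hP]

/-- An enumeration of a partition turns Stieltjes sums into sums over consecutive points. -/
theorem exists_enumeration (P : Finset ℝ) (hP : P.Nonempty) :
    ∃ (n : ℕ) (t : ℕ → ℝ), Monotone t ∧ (∀ i, t i ∈ P) ∧ t n = P.max' hP ∧
      (∀ p ∈ P, ∀ i < n, p ≤ t i ∨ t (i + 1) ≤ p) ∧
      ∀ g U : ℝ → ℂ, stieltjesSum g U P =
        ∑ i ∈ Finset.range n, g (t (i + 1)) * (U (t (i + 1)) - U (t i)) := by
  induction P using Finset.induction_on_max with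
  | empty => exact absurd hP Finset.not_nonempty_empty
  | insert a s ha ih =>
    rcases s.eq_empty_or_nonempty with rfl | hs
    · refine ⟨0, fun _ => a, monotone_const, by simp, by simp, by simp, fun g U => ?_⟩
      simp [stieltjesSum, Finset.filter_singleton]
    · obtain ⟨n, t, ht, hts, htn, hc, hsum⟩ := ih hs
      have hta : ∀ i, t i ≤ a := fun i => (ha _ (hts i)).le
      refine ⟨n + 1, fun i => if i ≤ n then t i else a, ?_, ?_, ?_, ?_, ?_⟩
      · intro i j hij
        simp only
        split_ifs with h1 h2
        · exact ht hij
        · exact hta i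
        · omega
        · exact le_rfl
      · intro i
        simp only
        split_ifs
        · exact Finset.mem_insert_of_mem (hts i)
        · exact Finset.mem_insert_self a s
      · simp only [add_le_iff_nonpos_right, nonpos_iff_eq_zero, one_ne_zero, if_false]
        refine le_antisymm (Finset.le_max' _ _ (Finset.mem_insert_self a s)) ?_
        refine Finset.max'_le _ _ _ fun y hy => ?_
        rcases Finset.mem_insert.1 hy with rfl | hy
        · exact le_rfl
        · exact (ha y hy).le
      · intro p hp i hi
        rcases Finset.mem_insert.1 hp with rfl | hp
        · right
          simp only
          split_ifs
          · exact hta _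
          · exact le_rfl
        · rcases Nat.lt_succ_iff_lt_or_eq.1 hi with h | rfl
          · simpa only [h.le, Nat.succ_le_of_lt h, if_true] using hc p hp i h
          · left
            simp only [le_refl, if_true, htn]
            exact Finset.le_max' _ _ hp
      · intro g U
        rw [stieltjesSum_insert_max g U ha hs, hsum, Finset.sum_range_succ]
        congr 1
        · refine Finset.sum_congr rfl fun i hi => ?_
          have hi := Finset.mem_range.1 hi
          simp only [hi.le, Nat.succ_le_of_lt hi, if_true]
        · simp [htn]

theorem clamp_mono (a b : ℝ) : Monotone fun x : ℝ => max a (min x b) :=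
  fun _ _ h => max_le_max le_rfl (min_le_min h le_rfl)

theorem clamp_mem {a b : ℝ} (hab : a ≤ b) (x : ℝ) : max a (min x b) ∈ Icc a b :=
  ⟨le_max_left _ _, max_le hab (min_le_right _ _)⟩

theorem clamp_of_mem {a b x : ℝ} (h : x ∈ Icc a b) : max a (min x b) = x := by
  rw [min_eq_left h.2, max_eq_right h.1]

/-- A partition containing `b` only sees the integrand on `(a, b]`. -/
theorem stieltjesSum_congr {g g' U : ℝ → ℂ} {a b : ℝ}
    (h : ∀ x ∈ Ioc a b, g x = g' x) {P : Finset ℝ} (hb : b ∈ P) :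
    stieltjesSum g (fun x => U (max a (min x b))) P =
      stieltjesSum g' (fun x => U (max a (min x b))) P := by
  refine Finset.sum_congr rfl fun x _ => ?_
  split_ifs with hx
  · set p := (P.filter (· < x)).max' hx with hp
    have hpx : p < x := (Finset.mem_filter.1 (Finset.max'_mem _ hx)).2
    by_cases h1 : x ≤ a
    · have : max a (min x b) = max a (min p b) := by
        rw [max_eq_left ((min_le_left x b).trans h1), max_eq_left ((min_le_left p b).trans (by linarith))]
      simp only [this, sub_self, mul_zero]
    · by_cases h2 : x ≤ b
      · rw [h x ⟨not_le.1 h1, h2⟩]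
      -- Because `b` is a partition point, no partition interval starting before `b` ends beyond it,
      -- so `g` is never evaluated to the right of `b` against a nonzero increment.
      · have hbp : b ≤ p :=
          (P.filter (· < x)).le_max' b (Finset.mem_filter.2 ⟨hb, not_le.1 h2⟩)
        have : max a (min x b) = max a (min p b) := by
          rw [min_eq_right (not_le.1 h2).le, min_eq_right hbp]
        simp only [this, sub_self, mul_zero]
  · rfl

theorem eventually_mem_partition (a : ℝ) : ∀ᶠ P : Finset ℝ in atTop, a ∈ P :=
  (eventually_ge_atTop {a}).mono fun _ hP => hP (Finset.mem_singleton_self a)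

theorem HasStieltjes.congr {g g' U U' : ℝ → ℂ} {a b : ℝ} {I : ℂ} (h : HasStieltjes g U a b I)
    (hab : a ≤ b) (hg : ∀ x ∈ Ioc a b, g' x = g x) (c : ℂ) (hU : ∀ x ∈ Icc a b, U' x = U x + c) :
    HasStieltjes g' U' a b I := by
  refine Tendsto.congr' ?_ h
  filter_upwards [eventually_mem_partition b] with P hb
  have : (fun x => U' (max a (min x b))) = fun x => U (max a (min x b)) + c :=
    funext fun x => hU _ (clamp_mem hab x)
  rw [this, stieltjesSum_add_right, stieltjesSum_const, add_zero]
  exact stieltjesSum_congr (fun x hx => (hg x hx).symm) hb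

theorem HasStieltjes.add_right {g U W : ℝ → ℂ} {a b : ℝ} {I J : ℂ} (h : HasStieltjes g U a b I)
    (h' : HasStieltjes g W a b J) : HasStieltjes g (fun x => U x + W x) a b (I + J) := by
  exact Tendsto.congr (fun P => (stieltjesSum_add_right g _ _ P).symm) (Tendsto.add h h')

theorem HasStieltjes.mul_right {g U : ℝ → ℂ} {a b : ℝ} {I : ℂ} (h : HasStieltjes g U a b I)
    (c : ℂ) : HasStieltjes g (fun x => c * U x) a b (c * I) := by
  exact Tendsto.congr (fun P => (stieltjesSum_mul_right c g _ P).symm) (Tendsto.const_mul c h)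

theorem HasStieltjes.add_left {g h U : ℝ → ℂ} {a b : ℝ} {I J : ℂ} (hg : HasStieltjes g U a b I)
    (hh : HasStieltjes h U a b J) : HasStieltjes (fun x => g x + h x) U a b (I + J) := by
  exact Tendsto.congr (fun P => (stieltjesSum_add_left g h _ P).symm) (Tendsto.add hg hh)

theorem HasStieltjes.mul_left {g U : ℝ → ℂ} {a b : ℝ} {I : ℂ} (h : HasStieltjes g U a b I)
    (c : ℂ) : HasStieltjes (fun x => c * g x) U a b (c * I) := by
  exact Tendsto.congr (fun P => (stieltjesSum_mul_left c g _ P).symm) (Tendsto.const_mul c h)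

theorem HasStieltjes.conj {g U : ℝ → ℂ} {a b : ℝ} {I : ℂ} (h : HasStieltjes g U a b I) :
    HasStieltjes (fun x => (starRingEnd ℂ) (g x)) (fun x => (starRingEnd ℂ) (U x)) a b
      ((starRingEnd ℂ) I) := by
  exact Tendsto.congr (fun P => (stieltjesSum_conj g _ P).symm)
    ((Complex.continuous_conj.tendsto _).comp h)

theorem HasStieltjes.of_const (g : ℝ → ℂ) (c : ℂ) (a b : ℝ) :
    HasStieltjes g (fun _ => c) a b 0 := by
  exact Tendsto.congr (fun P => (stieltjesSum_const g c P).symm) tendsto_const_nhds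

theorem HasStieltjes.sum_left {ι : Type*} (s : Finset ι) {g : ι → ℝ → ℂ} {U : ℝ → ℂ} {a b : ℝ}
    {I : ι → ℂ} (h : ∀ i ∈ s, HasStieltjes (g i) U a b (I i)) :
    HasStieltjes (fun x => ∑ i ∈ s, g i x) U a b (∑ i ∈ s, I i) := by
  classical
  induction s using Finset.induction_on with
  | empty =>
    simp only [Finset.sum_empty]
    exact Tendsto.congr (fun P => by simp [stieltjesSum]) tendsto_const_nhds
  | insert i s hi ih =>
    simp_rw [Finset.sum_insert hi]
    exact (h i (Finset.mem_insert_self i s)).add_left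
      (ih fun j hj => h j (Finset.mem_insert_of_mem hj))

theorem HasStieltjes.unique {g U : ℝ → ℂ} {a b : ℝ} {I J : ℂ} (h : HasStieltjes g U a b I)
    (h' : HasStieltjes g U a b J) : I = J := tendsto_nhds_unique h h'

theorem HasStieltjes.eq {g U : ℝ → ℂ} {a b : ℝ} {I : ℂ} (h : HasStieltjes g U a b I) :
    stieltjes g U a b = I := Tendsto.limUnder_eq h

/-- Freezing $U$ outside $[a,c]$ gives the sum of its freezings outside $[a,b]$ and $[b,c]$ minus
the constant $U(b)$, so additivity holds exactly for every partition, before any limit. -/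
theorem HasStieltjes.trans {g U : ℝ → ℂ} {a b c : ℝ} {I J : ℂ} (hab : a ≤ b) (hbc : b ≤ c)
    (h : HasStieltjes g U a b I) (h' : HasStieltjes g U b c J) :
    HasStieltjes g U a c (I + J) := by
  have e : (fun x => U (max a (min x c))) =
      fun x => (U (max a (min x b)) + U (max b (min x c))) + -U b := by
    funext x
    rcases le_total x b with hx | hx
    · rw [min_eq_left hx, min_eq_left (hx.trans hbc), max_eq_left hx]; ring
    · rw [min_eq_right hx, max_eq_right hab, max_eq_right (le_min hx hbc),
        max_eq_right (hab.trans (le_min hx hbc))]; ring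
  unfold HasStieltjes
  rw [e]
  refine Tendsto.congr (fun P => ?_) (Tendsto.add h h')
  rw [stieltjesSum_add_right g (fun x => U (max a (min x b)) + U (max b (min x c))),
    stieltjesSum_const, add_zero,
    stieltjesSum_add_right g (fun x => U (max a (min x b))) (fun x => U (max b (min x c)))]

/-- The Heaviside function with jump at `s`. -/
def heaviside (s x : ℝ) : ℂ := if s ≤ x then 1 else 0

/-- Only the increment ending at `s` sees the jump. The point `s - 1` guarantees that `s` has a
predecessor, since the first partition point contributes nothing. -/
theorem stieltjesSum_heaviside (g : ℝ → ℂ) (s : ℝ) {P : Finset ℝ} (h0 : s - 1 ∈ P) (h1 : s ∈ P) :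
    stieltjesSum g (heaviside s) P = g s := by
  rw [stieltjesSum, Finset.sum_eq_single_of_mem s h1]
  · have hne : (P.filter (· < s)).Nonempty := ⟨s - 1, Finset.mem_filter.2 ⟨h0, by linarith⟩⟩
    rw [dif_pos hne]
    have := (Finset.mem_filter.1 ((P.filter (· < s)).max'_mem hne)).2
    simp [heaviside, not_le.2 this]
  · intro x _ hxs
    split_ifs with hne
    · rcases lt_or_gt_of_ne hxs with h | h
      · have := (Finset.mem_filter.1 ((P.filter (· < x)).max'_mem hne)).2
        simp [heaviside, not_le.2 h, not_le.2 (this.trans h)]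
      · have : s ≤ (P.filter (· < x)).max' hne := Finset.le_max' _ _ (Finset.mem_filter.2 ⟨h1, h⟩)
        simp [heaviside, h.le, this]
    · rfl

theorem exists_hasStieltjes_heaviside (g : ℝ → ℂ) (s : ℝ) {a b : ℝ} (hab : a ≤ b) :
    ∃ I, HasStieltjes g (heaviside s) a b I := by
  rcases le_or_gt s a with h | h
  · refine ⟨0, (HasStieltjes.of_const g 0 a b).congr hab (fun _ _ => rfl) 1 fun x hx => ?_⟩
    simp [heaviside, h.trans hx.1]
  rcases lt_or_ge b s with h' | h'
  · refine ⟨0, (HasStieltjes.of_const g 0 a b).congr hab (fun _ _ => rfl) 0 fun x hx => ?_⟩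
    simp [heaviside, not_le.2 (hx.2.trans_lt h')]
  refine ⟨g s, tendsto_nhds_of_eventually_eq ?_⟩
  filter_upwards [eventually_mem_partition s, eventually_mem_partition (s - 1)] with P h1 h0
  have : (fun x => heaviside s (max a (min x b))) = heaviside s := by
    funext x
    simp only [heaviside, le_max_iff, le_min_iff, not_le.2 h, h', and_true, false_or]
  rw [this, stieltjesSum_heaviside g s h0 h1]

/-! ### Atoms and the atomic space -/

/-- An atom is a finite combination of Heaviside functions, for which the sums are eventually
constant. No regularity of `g` is needed for existence. -/
theorem IsU2Atom.exists_hasStieltjes {f : ℝ → ℂ} (hf : IsU2Atom f) (g : ℝ → ℂ) {a b : ℝ}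
    (hab : a ≤ b) : ∃ I, HasStieltjes g f a b I := by
  obtain ⟨n, t, φ, ht, -, rfl⟩ := hf
  have key : ∀ m ≤ n, ∃ I, HasStieltjes g (fun x => ∑ j ∈ Finset.range m,
      if t j ≤ x ∧ (j + 1 < n → x < t (j + 1)) then φ j else 0) a b I := by
    intro m
    induction m with
    | zero => exact fun _ => ⟨0, by simpa using HasStieltjes.of_const g 0 a b⟩
    | succ m ih =>
      intro hm
      obtain ⟨I, hI⟩ := ih (by omega)
      obtain ⟨J, hJ⟩ := exists_hasStieltjes_heaviside g (t m) hab
      obtain ⟨K, hK⟩ := exists_hasStieltjes_heaviside g (t (m + 1)) hab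
      refine ⟨_, (hI.add_right ((hJ.mul_right (φ m)).add_right
        (hK.mul_right (if m + 1 < n then -φ m else 0)))).congr hab (fun _ _ => rfl) 0
          fun x _ => ?_⟩
      rw [Finset.sum_range_succ, add_zero]
      congr 1
      have hlt := ht (Nat.lt_succ_self m)
      simp only [Nat.succ_eq_add_one] at hlt
      by_cases h1 : m + 1 < n <;> by_cases h2 : t m ≤ x <;> by_cases h3 : x < t (m + 1)
      all_goals simp only [heaviside, h1, h2, h3, if_true, if_false,
        forall_true_left, and_true, and_false, IsEmpty.forall_iff]
      all_goals first
        | (exfalso; linarith)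
        | simp [not_lt.1 h3]
        | simp [not_le.2 h3]
  exact key n le_rfl

theorem le_iff_lt_card {t : ℕ → ℝ} (ht : Monotone t) {n j : ℕ} (hj : j < n) (x : ℝ) :
    t j ≤ x ↔ j < ((Finset.range n).filter fun i => t i ≤ x).card := by
  constructor
  · intro h
    have : Finset.range (j + 1) ⊆ (Finset.range n).filter fun i => t i ≤ x := by
      intro i hi
      simp only [Finset.mem_filter, Finset.mem_range] at hi ⊢
      exact ⟨by omega, (ht (by omega : i ≤ j)).trans h⟩
    simpa using Finset.card_le_card this
  · intro h
    by_contra hx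
    have : (Finset.range n).filter (fun i => t i ≤ x) ⊆ Finset.range j := by
      intro i hi
      simp only [Finset.mem_filter, Finset.mem_range] at hi ⊢
      by_contra hij
      exact hx ((ht (not_lt.1 hij)).trans hi.2)
    have := Finset.card_le_card this
    rw [Finset.card_range] at this
    exact absurd h (not_lt.2 this)

/-- `κ` counts the jump points up to `x`. Level `0` is the region left of all jumps, where the atom
vanishes, so the values are shifted by one: `ψ (j + 1) = φ j`. The set `D` contains the jump points.
-/
theorem IsU2Atom.exists_step {f : ℝ → ℂ} (hf : IsU2Atom f) :
    ∃ (κ : ℝ → ℕ) (ψ : ℕ → ℂ) (D : Finset ℝ), Monotone κ ∧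
      (∀ N, ∑ m ∈ Finset.range N, ‖ψ m‖ ^ 2 ≤ 1) ∧ (f = fun x => ψ (κ x)) ∧
      ∀ x y, x ≤ y → (∀ d ∈ D, ¬ (x < d ∧ d ≤ y)) → κ x = κ y := by
  classical
  obtain ⟨n, t, φ, ht, hφ, rfl⟩ := hf
  set κ : ℝ → ℕ := fun x => ((Finset.range n).filter fun j => t j ≤ x).card with hκ
  have hlt : ∀ x j, j < n → (t j ≤ x ↔ j < κ x) := fun x j hj => le_iff_lt_card ht.monotone hj x
  have hn : ∀ x, κ x ≤ n := fun x => by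
    simpa using Finset.card_filter_le (Finset.range n) fun j => t j ≤ x
  set ψ : ℕ → ℂ := fun m => if 0 < m ∧ m ≤ n then φ (m - 1) else 0 with hψ
  refine ⟨κ, ψ, (Finset.range n).image t, ?_, ?_, ?_, ?_⟩
  · intro x y hxy
    exact Finset.card_le_card fun i hi => by
      simp only [Finset.mem_filter] at hi ⊢
      exact ⟨hi.1, hi.2.trans hxy⟩
  · intro N
    have h1 : ∑ m ∈ Finset.range N, ‖ψ m‖ ^ 2 ≤ ∑ m ∈ Finset.range (max N (n + 1)), ‖ψ m‖ ^ 2 :=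
      Finset.sum_le_sum_of_subset_of_nonneg (Finset.range_mono (le_max_left _ _))
        fun _ _ _ => by positivity
    have h2 : ∑ m ∈ Finset.range (max N (n + 1)), ‖ψ m‖ ^ 2 =
        ∑ m ∈ Finset.range (n + 1), ‖ψ m‖ ^ 2 := by
      refine (Finset.sum_subset (Finset.range_mono (le_max_right _ _)) fun m _ hm => ?_).symm
      simp only [Finset.mem_range] at hm
      simp [hψ, show ¬ m ≤ n by omega]
    rw [h2, Finset.sum_range_succ'] at h1
    refine h1.trans (le_trans (le_of_eq ?_) hφ)
    simp only [hψ, lt_irrefl, false_and, if_false, norm_zero, ne_eq, OfNat.ofNat_ne_zero,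
      not_false_eq_true, zero_pow, add_zero]
    refine Finset.sum_congr rfl fun m hm => ?_
    rw [if_pos ⟨Nat.succ_pos m, Finset.mem_range.1 hm⟩, Nat.add_sub_cancel]
  · funext x
    have hite : ∀ j ∈ Finset.range n, (if t j ≤ x ∧ (j + 1 < n → x < t (j + 1)) then φ j else 0) =
        if j + 1 = κ x then φ j else 0 := by
      intro j hj
      have hj := Finset.mem_range.1 hj
      have h1 := hlt x j hj
      congr 1
      rw [eq_iff_iff, h1]
      constructor
      · rintro ⟨ha, hb⟩
        rcases Nat.lt_or_ge (j + 1) n with h | h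
        · have := (hlt x (j + 1) h).not.1 (not_le.2 (hb h))
          omega
        · have := hn x; omega
      · intro h
        refine ⟨by omega, fun hjn => not_le.1 fun hx => ?_⟩
        have := (hlt x (j + 1) hjn).1 hx
        omega
    rw [Finset.sum_congr rfl hite]
    simp only [hψ]
    rcases Nat.eq_zero_or_pos (κ x) with h0 | h0
    · simp [h0]
    · rw [if_pos ⟨h0, hn x⟩, Finset.sum_eq_single_of_mem (κ x - 1)
        (Finset.mem_range.2 (by have := hn x; omega))]
      · rw [if_pos (by omega)]
      · intro j _ hj
        rw [if_neg (by omega)]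
  · intro x y hxy hD
    refine congrArg Finset.card (Finset.filter_congr fun j hj => ⟨fun h => h.trans hxy, fun h => not_lt.1 fun hx => ?_⟩)
    exact hD (t j) (Finset.mem_image_of_mem t hj) ⟨hx, h⟩

theorem IsU2Atom.norm_le {f : ℝ → ℂ} (hf : IsU2Atom f) (x : ℝ) : ‖f x‖ ≤ 1 := by
  obtain ⟨κ, ψ, D, -, hψ, rfl, -⟩ := hf.exists_step
  have h1 := (Finset.single_le_sum (f := fun m => ‖ψ m‖ ^ 2) (fun i _ => by positivity)
    (Finset.self_mem_range_succ (κ x))).trans (hψ (κ x + 1))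
  exact (sq_le_one_iff₀ (norm_nonneg _)).1 h1

/-- The constant is $3\cdot3$: extending `g` by zero off `(a, b]` costs one factor, the step
function duality the other. Freezing preserves the step structure because clamping is monotone. -/
theorem IsU2Atom.norm_stieltjesSum_le {f : ℝ → ℂ} (hf : IsU2Atom f) {g : ℝ → ℂ} {a b C : ℝ}
    (hg : V2 g (Ioc a b) C) {P : Finset ℝ} (hb : b ∈ P) :
    ‖stieltjesSum g (fun x => f (max a (min x b))) P‖ ≤ 9 * C := by
  rw [stieltjesSum_congr (fun x hx => (indicator_of_mem hx g).symm) hb]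
  obtain ⟨κ, ψ, D, hκ, hψ, rfl, -⟩ := hf.exists_step
  obtain ⟨n, t, ht, -, -, -, hsum⟩ := exists_enumeration P ⟨b, hb⟩
  rw [hsum]
  have := norm_step_sum_le (hκ.comp (clamp_mono a b)) hψ hg.indicator n ht (fun _ => mem_univ _)
  simp only [Function.comp_def] at this
  linarith

/-- `F` has an atomic decomposition with coefficients of `ℓ¹` norm at most `Λ`. -/
def HasAtomicDecomp (F : ℝ → ℂ) (Λ : ℝ) : Prop :=
  ∃ (l : ℕ → ℂ) (a : ℕ → ℝ → ℂ), (∀ j, IsU2Atom (a j)) ∧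
    (∀ x, HasSum (fun j => l j * a j x) (F x)) ∧ Summable (fun j => ‖l j‖) ∧ ∑' j, ‖l j‖ ≤ Λ

theorem hasAtomicDecomp_of_lt {F : ℝ → ℂ} {Λ : ℝ} (h : u2Norm F < ENNReal.ofReal Λ) :
    HasAtomicDecomp F Λ := by
  simp only [u2Norm, iInf_lt_iff] at h
  obtain ⟨l, a, ha, hF, hl⟩ := h
  have hne : ∑' j, ‖l j‖ₑ ≠ ⊤ := (hl.trans_le le_top).ne
  have hs : Summable fun j => ‖l j‖ := by
    have := ENNReal.summable_toReal hne
    simpa using this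
  refine ⟨l, a, ha, hF, hs, ?_⟩
  have e : ∑' j, ‖l j‖ = (∑' j, ‖l j‖ₑ).toReal := by
    rw [ENNReal.tsum_toReal_eq fun j => enorm_ne_top]
    simp
  rw [e]
  have hΛ : 0 ≤ Λ := by
    by_contra hneg
    rw [ENNReal.ofReal_of_nonpos (not_le.1 hneg).le] at hl
    exact not_lt_bot hl
  exact ENNReal.toReal_le_of_le_ofReal hΛ hl.le

/-- Dominated convergence along the filter of partitions: for partitions containing `b`, the
contribution of the atom $a_j$ is at most $9C|\lambda_j|$, which is summable. -/
theorem HasAtomicDecomp.stieltjes {F : ℝ → ℂ} {Λ : ℝ} (hF : HasAtomicDecomp F Λ) {g : ℝ → ℂ}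
    {a b C : ℝ} (hab : a ≤ b) (hg : V2 g (Ioc a b) C) :
    ∃ I, HasStieltjes g F a b I ∧ ‖I‖ ≤ 9 * Λ * C := by
  obtain ⟨l, f, hf, hs, hl, hΛ⟩ := hF
  choose J hJ using fun j => (hf j).exists_hasStieltjes g hab
  have hsum : ∀ P, stieltjesSum g (fun x => F (max a (min x b))) P =
      ∑' j, stieltjesSum g (fun x => l j * f j (max a (min x b))) P := fun P =>
    (stieltjesSum_hasSum g (fun x => hs (max a (min x b))) P).tsum_eq.symm
  have hb : ∀ᶠ P : Finset ℝ in atTop,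
      ∀ j, ‖stieltjesSum g (fun x => l j * f j (max a (min x b))) P‖ ≤ ‖l j‖ * (9 * C) := by
    filter_upwards [eventually_mem_partition b] with P hb j
    rw [stieltjesSum_mul_right (l j) g (fun x => f j (max a (min x b))), norm_mul]
    exact mul_le_mul_of_nonneg_left ((hf j).norm_stieltjesSum_le hg hb) (norm_nonneg _)
  have hlim : HasStieltjes g F a b (∑' j, l j * J j) := by
    unfold HasStieltjes
    rw [funext hsum]
    exact tendsto_tsum_of_dominated_convergence (hl.mul_right (9 * C))
      (fun j => (hJ j).mul_right (l j)) hb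
  refine ⟨_, hlim, ?_⟩
  have hJb : ∀ j, ‖l j * J j‖ ≤ ‖l j‖ * (9 * C) := fun j =>
    le_of_tendsto ((hJ j).mul_right (l j)).norm (hb.mono fun P hP => hP j)
  have h1 := tsum_of_norm_bounded (hl.mul_right (9 * C)).hasSum hJb
  rw [tsum_mul_right] at h1
  nlinarith [hg.nonneg]

/-! ### Locally controlled primitives -/

/-- Up to a small error, `W` is a right continuous step function on `[a, b]`. -/
def NearStep (W : ℝ → ℂ) (a b : ℝ) : Prop :=
  ∀ ε > 0, ∃ D : Finset ℝ, ∀ x ∈ Icc a b, ∀ y ∈ Icc a b, x ≤ y →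
    (∀ d ∈ D, ¬ (x < d ∧ d ≤ y)) → ‖W y - W x‖ ≤ ε

/-- Only the jumps of finitely many atoms matter. Atoms have sup norm at most one, so a tail of
$\ell^1$ mass below $\varepsilon/2$ oscillates by at most $\varepsilon$. -/
theorem HasAtomicDecomp.nearStep {F : ℝ → ℂ} {Λ : ℝ} (hF : HasAtomicDecomp F Λ) (a b : ℝ) :
    NearStep F a b := by
  classical
  intro ε hε
  obtain ⟨l, f, hf, hs, hl, -⟩ := hF
  choose κ ψ D hκ hψ hfκ hD using fun j => (hf j).exists_step
  have htail := tendsto_sum_nat_add fun j => ‖l j‖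
  obtain ⟨N, hN⟩ := (htail.eventually (gt_mem_nhds (show (0 : ℝ) < ε / 2 by linarith))).exists
  refine ⟨(Finset.range N).biUnion D, fun x _ y _ hxy hd => ?_⟩
  have h1 := (hs y).sub (hs x)
  have h0 : ∀ j ∈ Finset.range N, l j * f j y - l j * f j x = 0 := fun j hj => by
    rw [hfκ j]
    simp only
    rw [hD j x y hxy fun d hdj => hd d (Finset.mem_biUnion.2 ⟨j, hj, hdj⟩), sub_self]
  have h2 := (hasSum_nat_add_iff' N).2 h1
  rw [Finset.sum_eq_zero h0, sub_zero] at h2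
  have h3 : Summable fun j => ‖l (j + N)‖ := (summable_nat_add_iff N).2 hl
  have h4 := h2.norm_le_of_bounded (h3.mul_right 2).hasSum fun j => by
    rw [← mul_sub, norm_mul]
    refine mul_le_mul_of_nonneg_left ?_ (norm_nonneg _)
    have := norm_sub_le (f (j + N) y) (f (j + N) x)
    linarith [(hf (j + N)).norm_le x, (hf (j + N)).norm_le y]
  rw [tsum_mul_right] at h4
  linarith

/-- Right continuity follows from the approximation by right continuous step functions. -/
theorem NearStep.continuousWithinAt {W : ℝ → ℂ} (h : ∀ a b, NearStep W a b) (x : ℝ) :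
    ContinuousWithinAt W (Ici x) x := by
  rw [Metric.continuousWithinAt_iff']
  intro ε hε
  obtain ⟨D, hD⟩ := h x (x + 1) (ε / 2) (by linarith)
  have hev : ∀ᶠ y in 𝓝[≥] x, ∀ d ∈ D, ¬ (x < d ∧ d ≤ y) := by
    rw [Finset.eventually_all]
    intro d _
    rcases le_or_gt d x with hd | hd
    · exact Eventually.of_forall fun y hy => absurd hy.1 (not_lt.2 hd)
    · filter_upwards [mem_nhdsWithin_of_mem_nhds (Iio_mem_nhds hd)] with y hy h'
      exact absurd h'.2 (not_le.2 hy)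
  filter_upwards [hev, self_mem_nhdsWithin,
    mem_nhdsWithin_of_mem_nhds (Iio_mem_nhds (lt_add_one x))] with y h1 h2 h3
  rw [dist_eq_norm]
  exact (hD x ⟨le_rfl, by linarith⟩ y ⟨h2, (le_of_lt h3)⟩ h2 h1).trans_lt (by linarith)

/-- On `[a, b]`, `W` is close to step functions, and functions of bounded 2-variation can be
integrated against `dW`, with constant `A`. -/
structure Controlled (W : ℝ → ℂ) (a b A : ℝ) : Prop where
  nearStep : NearStep W a b
  integral : ∀ a' b', a ≤ a' → a' ≤ b' → b' ≤ b → ∀ (g : ℝ → ℂ) (C : ℝ), V2 g (Ioc a' b') C →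
    ∃ I, HasStieltjes g W a' b' I ∧ ‖I‖ ≤ A * C

theorem HasAtomicDecomp.controlled {F : ℝ → ℂ} {Λ : ℝ} (hF : HasAtomicDecomp F Λ) (a b : ℝ) :
    Controlled F a b (9 * Λ) :=
  ⟨hF.nearStep a b, fun _ _ _ hab _ _ _ hg => hF.stieltjes hab hg⟩

theorem Controlled.mono {W : ℝ → ℂ} {a b a' b' A A' : ℝ} (h : Controlled W a b A) (ha : a ≤ a')
    (hb : b' ≤ b) (hA : A ≤ A') : Controlled W a' b' A' := by
  refine ⟨fun ε hε => ?_, fun a₁ b₁ h1 h2 h3 g C hg => ?_⟩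
  · obtain ⟨D, hD⟩ := h.nearStep ε hε
    exact ⟨D, fun x hx y hy => hD x ⟨ha.trans hx.1, hx.2.trans hb⟩ y ⟨ha.trans hy.1, hy.2.trans hb⟩⟩
  · obtain ⟨I, hI, hIb⟩ := h.integral a₁ b₁ (ha.trans h1) h2 (h3.trans hb) g C hg
    exact ⟨I, hI, hIb.trans (mul_le_mul_of_nonneg_right hA hg.nonneg)⟩

theorem Controlled.congr {W W' : ℝ → ℂ} {a b A : ℝ} (h : Controlled W a b A) (c : ℂ)
    (hW : ∀ x ∈ Icc a b, W' x = W x + c) : Controlled W' a b A := by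
  refine ⟨fun ε hε => ?_, fun a' b' h1 h2 h3 g C hg => ?_⟩
  · obtain ⟨D, hD⟩ := h.nearStep ε hε
    refine ⟨D, fun x hx y hy hxy hd => ?_⟩
    rw [hW x hx, hW y hy, add_sub_add_right_eq_sub]
    exact hD x hx y hy hxy hd
  · obtain ⟨I, hI, hIb⟩ := h.integral a' b' h1 h2 h3 g C hg
    exact ⟨I, hI.congr h2 (fun _ _ => rfl) c fun x hx => hW x ⟨h1.trans hx.1, hx.2.trans h3⟩, hIb⟩

theorem Controlled.const (c : ℂ) (a b : ℝ) : Controlled (fun _ => c) a b 0 :=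
  ⟨fun ε hε => ⟨∅, fun _ _ _ _ _ _ => by simpa using hε.le⟩,
    fun a' b' _ _ _ g C _ => ⟨0, HasStieltjes.of_const g c a' b', by simp⟩⟩

theorem Controlled.add {W W' : ℝ → ℂ} {a b A A' : ℝ} (h : Controlled W a b A)
    (h' : Controlled W' a b A') : Controlled (fun x => W x + W' x) a b (A + A') := by
  classical
  refine ⟨fun ε hε => ?_, fun a' b' h1 h2 h3 g C hg => ?_⟩
  · obtain ⟨D, hD⟩ := h.nearStep (ε / 2) (by linarith)
    obtain ⟨D', hD'⟩ := h'.nearStep (ε / 2) (by linarith)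
    refine ⟨D ∪ D', fun x hx y hy hxy hd => ?_⟩
    have e1 := hD x hx y hy hxy fun d hd' => hd d (Finset.mem_union_left _ hd')
    have e2 := hD' x hx y hy hxy fun d hd' => hd d (Finset.mem_union_right _ hd')
    rw [add_sub_add_comm]
    exact (norm_add_le _ _).trans (by linarith)
  · obtain ⟨I, hI, hIb⟩ := h.integral a' b' h1 h2 h3 g C hg
    obtain ⟨J, hJ, hJb⟩ := h'.integral a' b' h1 h2 h3 g C hg
    exact ⟨I + J, hI.add_right hJ, (norm_add_le _ _).trans (by linarith)⟩

theorem Controlled.sum {ι : Type*} (s : Finset ι) {W : ι → ℝ → ℂ} {a b : ℝ} {A : ι → ℝ}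
    (h : ∀ i ∈ s, Controlled (W i) a b (A i)) :
    Controlled (fun x => ∑ i ∈ s, W i x) a b (∑ i ∈ s, A i) := by
  classical
  induction s using Finset.induction_on with
  | empty => simpa using Controlled.const 0 a b
  | insert i s hi ih =>
    simp_rw [Finset.sum_insert hi]
    exact (h i (Finset.mem_insert_self i s)).add (ih fun j hj => h j (Finset.mem_insert_of_mem hj))

/-- The integral does not depend on `A'`, so its bound passes to the limit. This compensates for the
infimum in the norm not being attained. -/
theorem Controlled.of_forall_lt {W : ℝ → ℂ} {a b A : ℝ} (h : ∀ A' > A, Controlled W a b A') :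
    Controlled W a b A := by
  refine ⟨(h (A + 1) (by linarith)).nearStep, fun a' b' h1 h2 h3 g C hg => ?_⟩
  obtain ⟨I, hI, -⟩ := (h (A + 1) (by linarith)).integral a' b' h1 h2 h3 g C hg
  refine ⟨I, hI, ?_⟩
  have hlim : Tendsto (fun A' => A' * C) (𝓝[>] A) (𝓝 (A * C)) :=
    (tendsto_nhdsWithin_of_tendsto_nhds tendsto_id).mul_const C
  refine ge_of_tendsto hlim ?_
  filter_upwards [self_mem_nhdsWithin] with A' hA'
  obtain ⟨J, hJ, hJb⟩ := (h A' hA').integral a' b' h1 h2 h3 g C hg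
  rw [hI.unique hJ]
  exact hJb

/-! ### Change of the integrator by a plane wave -/

/-- The plane wave `e^{i ξ x}`. -/
def wave (ξ x : ℝ) : ℂ := Complex.exp (Complex.I * ((ξ * x : ℝ) : ℂ))

theorem norm_wave (ξ x : ℝ) : ‖wave ξ x‖ = 1 := by
  rw [wave, mul_comm, Complex.norm_exp_ofReal_mul_I]

/-- This is $e^{i\xi x}\,dU=dW$ at the level of sums. Replacing one increment by the other on a
partition interval costs $|\xi|$ times the integrated oscillation of $W$. Once the partition
contains the significant jumps, that oscillation is at most $\delta$ times the length, so the errors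
add up to $O(\delta)$. -/
theorem HasStieltjes.wave_mul {W U h : ℝ → ℂ} {ξ a b C : ℝ} {I : ℂ} (hab : a ≤ b)
    (hW : NearStep W a b)
    (hU : ∀ x ∈ Icc a b, ∀ y ∈ Icc a b, x ≤ y →
      ‖wave ξ y * (U y - U x) - (W y - W x)‖ ≤ |ξ| * ∫ s in x..y, ‖W s - W x‖)
    (hWi : IntervalIntegrable W volume a b) (hh : ∀ x ∈ Ioc a b, ‖h x‖ ≤ C)
    (hI : HasStieltjes h W a b I) : HasStieltjes (fun x => wave ξ x * h x) U a b I := by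
  classical
  have key : Tendsto (fun P => stieltjesSum (fun x => wave ξ x * h x) (fun x => U (max a (min x b))) P
      - stieltjesSum h (fun x => W (max a (min x b))) P) atTop (𝓝 0) := by
    rw [Metric.tendsto_nhds]
    intro ε hε
    set δ := ε / (|C| * |ξ| * (b - a) + 1) with hδ
    have hden : 0 < |C| * |ξ| * (b - a) + 1 := by
      have := mul_nonneg (mul_nonneg (abs_nonneg C) (abs_nonneg ξ)) (sub_nonneg.2 hab)
      linarith
    have hδ0 : 0 < δ := div_pos hε hden
    obtain ⟨D, hD⟩ := hW δ hδ0
    filter_upwards [eventually_mem_partition a, eventually_mem_partition b,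
      eventually_ge_atTop D] with P ha hb hDP
    rw [dist_zero_right]
    obtain ⟨n, t, ht, htP, -, hc, hsum⟩ := exists_enumeration P ⟨a, ha⟩
    rw [hsum, hsum, ← Finset.sum_sub_distrib]
    set u : ℕ → ℝ := fun i => max a (min (t i) b) with hu
    have hum : Monotone u := (clamp_mono a b).comp ht
    have hui : ∀ i, u i ∈ Icc a b := fun i => clamp_mem hab _
    have hterm : ∀ i ∈ Finset.range n,
        ‖wave ξ (t (i + 1)) * h (t (i + 1)) * (U (u (i + 1)) - U (u i)) -
          h (t (i + 1)) * (W (u (i + 1)) - W (u i))‖ ≤ |C| * |ξ| * δ * (u (i + 1) - u i) := by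
      intro i hi
      rcases (hum (Nat.le_succ i)).eq_or_lt with heq | hlt
      · have heq : u i = u (i + 1) := heq
        rw [heq]; simp
      have hlt : u i < u (i + 1) := hlt
      have h1 : a < t (i + 1) := by
        by_contra hcon
        have e : u (i + 1) = a := max_eq_left ((min_le_left _ _).trans (not_lt.1 hcon))
        linarith [(hui i).1]
      have h2 : t i < b := by
        by_contra hcon
        have e : u i = b := by
          simp only [hu]; rw [min_eq_right (not_lt.1 hcon), max_eq_right hab]
        linarith [(hui (i + 1)).2]
      have h3 : a ≤ t i := (hc a ha i (Finset.mem_range.1 hi)).resolve_right (not_le.2 h1)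
      have h4 : t (i + 1) ≤ b := (hc b hb i (Finset.mem_range.1 hi)).resolve_left (not_le.2 h2)
      have e0 : u i = t i := clamp_of_mem ⟨h3, h2.le⟩
      have e1 : u (i + 1) = t (i + 1) := clamp_of_mem ⟨h1.le, h4⟩
      rw [e0, e1]
      have h5 : t i ≤ t (i + 1) := ht (Nat.le_succ i)
      -- The comparison is made on the open interval, because $W$ may have a large jump exactly at
      -- the right endpoint.
      have hint : ∫ s in t i..t (i + 1), ‖W s - W (t i)‖ ≤ ∫ _ in t i..t (i + 1), δ := by
        refine intervalIntegral.integral_mono_on_of_le_Ioo h5 ?_ intervalIntegrable_const ?_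
        · refine ((hWi.mono_set ?_).sub intervalIntegrable_const).norm
          rw [uIcc_of_le h5, uIcc_of_le hab]
          exact Icc_subset_Icc h3 h4
        · intro s hs
          refine hD _ ⟨h3, h2.le⟩ s ⟨h3.trans hs.1.le, hs.2.le.trans h4⟩ hs.1.le ?_
          rintro d hd ⟨hd1, hd2⟩
          rcases hc d (hDP hd) i (Finset.mem_range.1 hi) with h | h <;> linarith [hs.2]
      rw [intervalIntegral.integral_const, smul_eq_mul] at hint
      have e : wave ξ (t (i + 1)) * h (t (i + 1)) * (U (t (i + 1)) - U (t i)) -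
          h (t (i + 1)) * (W (t (i + 1)) - W (t i)) = h (t (i + 1)) *
            (wave ξ (t (i + 1)) * (U (t (i + 1)) - U (t i)) - (W (t (i + 1)) - W (t i))) := by ring
      rw [e, norm_mul]
      have h6 := hU (t i) ⟨h3, h2.le⟩ (t (i + 1)) ⟨h1.le, h4⟩ h5
      have h7 : ‖h (t (i + 1))‖ ≤ |C| := (hh _ ⟨h1, h4⟩).trans (le_abs_self C)
      calc _ ≤ |C| * (|ξ| * ((t (i + 1) - t i) * δ)) := by
            gcongr
            exact h6.trans (mul_le_mul_of_nonneg_left hint (abs_nonneg ξ))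
        _ = _ := by ring
    refine (norm_sum_le _ _).trans_lt ((Finset.sum_le_sum hterm).trans_lt ?_)
    rw [← Finset.mul_sum, Finset.sum_range_sub]
    have h8 : u n - u 0 ≤ b - a := by linarith [(hui n).2, (hui 0).1]
    calc |C| * |ξ| * δ * (u n - u 0) ≤ |C| * |ξ| * δ * (b - a) := by gcongr
      _ < δ * (|C| * |ξ| * (b - a) + 1) := by nlinarith
      _ = ε := by rw [hδ]; field_simp
  have := key.add hI
  rw [zero_add] at this
  refine Tendsto.congr (fun P => ?_) this
  simp

/-! ### Improper Stieltjes integrals -/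

/-- The improper integral `∫_ℝ g dU` exists and is equal to `I`. -/
def HasLineIntegral (g U : ℝ → ℂ) (I : ℂ) : Prop :=
  (∀ a b, a ≤ b → ∃ J, HasStieltjes g U a b J) ∧
    Tendsto (fun p : ℝ × ℝ => stieltjes g U p.1 p.2) (atBot ×ˢ atTop) (𝓝 I)

theorem HasLineIntegral.integrable {g U : ℝ → ℂ} {I : ℂ} (h : HasLineIntegral g U I) :
    StieltjesIntegrable g U := ⟨h.1, I, h.2⟩

theorem HasLineIntegral.eq {g U : ℝ → ℂ} {I : ℂ} (h : HasLineIntegral g U I) :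
    stieltjesLine g U = I := h.2.limUnder_eq

theorem eventually_fst_le_snd : ∀ᶠ p : ℝ × ℝ in atBot ×ˢ atTop, p.1 ≤ p.2 := by
  filter_upwards [prod_mem_prod (Iic_mem_atBot (0 : ℝ)) (Ici_mem_atTop (0 : ℝ))] with p hp
  exact le_trans hp.1 hp.2

theorem HasLineIntegral.mul_left {g U : ℝ → ℂ} {I : ℂ} (h : HasLineIntegral g U I) (c : ℂ) :
    HasLineIntegral (fun x => c * g x) U (c * I) := by
  refine ⟨fun a b hab => (h.1 a b hab).imp' (c * ·) fun J hJ => hJ.mul_left c,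
    (h.2.const_mul c).congr' ?_⟩
  filter_upwards [eventually_fst_le_snd] with p hp
  obtain ⟨J, hJ⟩ := h.1 _ _ hp
  rw [hJ.eq, (hJ.mul_left c).eq]

theorem HasLineIntegral.add_left {g g' U : ℝ → ℂ} {I I' : ℂ} (h : HasLineIntegral g U I)
    (h' : HasLineIntegral g' U I') : HasLineIntegral (fun x => g x + g' x) U (I + I') := by
  refine ⟨fun a b hab => ?_, (h.2.add h'.2).congr' ?_⟩
  · obtain ⟨J, hJ⟩ := h.1 a b hab
    obtain ⟨J', hJ'⟩ := h'.1 a b hab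
    exact ⟨_, hJ.add_left hJ'⟩
  · filter_upwards [eventually_fst_le_snd] with p hp
    obtain ⟨J, hJ⟩ := h.1 _ _ hp
    obtain ⟨J', hJ'⟩ := h'.1 _ _ hp
    rw [hJ.eq, hJ'.eq, (hJ.add_left hJ').eq]

theorem HasLineIntegral.zero (U : ℝ → ℂ) : HasLineIntegral (fun _ => 0) U 0 := by
  have h : ∀ a b, HasStieltjes (fun _ => 0) U a b 0 := fun a b =>
    Tendsto.congr (fun P => by simp [stieltjesSum]) tendsto_const_nhds
  refine ⟨fun a b _ => ⟨0, h a b⟩, ?_⟩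
  simp_rw [(h _ _).eq]
  exact tendsto_const_nhds

theorem HasLineIntegral.sum_left {ι : Type*} (s : Finset ι) {g : ι → ℝ → ℂ} {U : ℝ → ℂ}
    {I : ι → ℂ} (h : ∀ i ∈ s, HasLineIntegral (g i) U (I i)) :
    HasLineIntegral (fun x => ∑ i ∈ s, g i x) U (∑ i ∈ s, I i) := by
  classical
  induction s using Finset.induction_on with
  | empty => simpa using HasLineIntegral.zero U
  | insert i s hi ih =>
    simp_rw [Finset.sum_insert hi]
    exact (h i (Finset.mem_insert_self i s)).add_left
      (ih fun j hj => h j (Finset.mem_insert_of_mem hj))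

theorem exists_limits_of_summable {q : ℤ → ℂ} {w : ℤ → ℝ} (hw : Summable w)
    (hq : ∀ m, ‖q (m + 1) - q m‖ ≤ w m) :
    ∃ l l' : ℂ, Tendsto q atTop (𝓝 l) ∧ Tendsto q atBot (𝓝 l') ∧ ‖l - l'‖ ≤ ∑' m, w m := by
  have hw0 : ∀ m, 0 ≤ w m := fun m => (norm_nonneg _).trans (hq m)
  have hinj : Function.Injective fun n : ℕ => (n : ℤ) := Nat.cast_injective
  have hinj' : Function.Injective fun n : ℕ => -(n : ℤ) - 1 := fun a b h => by
    simp only at h; omega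
  obtain ⟨l, hl⟩ := cauchySeq_tendsto_of_complete
    (cauchySeq_of_summable_dist (f := fun n : ℕ => q n)
      (Summable.of_nonneg_of_le (fun _ => dist_nonneg) (fun n => by
        rw [dist_comm, dist_eq_norm]
        have := hq n
        push_cast
        exact this) (hw.comp_injective hinj)))
  obtain ⟨l', hl'⟩ := cauchySeq_tendsto_of_complete
    (cauchySeq_of_summable_dist (f := fun n : ℕ => q (-(n : ℤ)))
      (Summable.of_nonneg_of_le (fun _ => dist_nonneg) (fun n => by
        rw [dist_eq_norm]
        have := hq (-(n : ℤ) - 1)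
        simp only [sub_add_cancel] at this
        have e : -((n.succ : ℕ) : ℤ) = -(n : ℤ) - 1 := by push_cast; ring
        rw [e]
        exact this) (hw.comp_injective hinj')))
  refine ⟨l, l', ?_, ?_, ?_⟩
  · have h1 : Tendsto Int.toNat atTop atTop := by
      refine tendsto_atTop.2 fun n => ?_
      filter_upwards [eventually_ge_atTop (n : ℤ)] with m hm
      omega
    refine (hl.comp h1).congr' ?_
    filter_upwards [eventually_ge_atTop (0 : ℤ)] with m hm
    simp [Int.toNat_of_nonneg hm]
  · have h1 : Tendsto (fun m : ℤ => Int.toNat (-m)) atBot atTop := by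
      refine tendsto_atTop.2 fun n => ?_
      filter_upwards [eventually_le_atBot (-(n : ℤ))] with m hm
      omega
    refine (hl'.comp h1).congr' ?_
    filter_upwards [eventually_le_atBot (0 : ℤ)] with m hm
    have : ((-m).toNat : ℤ) = -m := Int.toNat_of_nonneg (by omega)
    simp [this]
  · have hb : ∀ (m : ℤ) (n : ℕ), ‖q (m + n) - q m‖ ≤ ∑' m, w m := by
      intro m n
      have h1 : ‖q (m + n) - q m‖ ≤ ∑ i ∈ Finset.range n, w (m + i) := by
        induction n with
        | zero => simp
        | succ n ih =>
          rw [Finset.sum_range_succ]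
          have e : q (m + (n + 1 : ℕ)) - q m = (q (m + n) - q m) + (q (m + n + 1) - q (m + n)) := by
            push_cast; rw [← add_assoc]; ring
          rw [e]
          exact (norm_add_le _ _).trans (add_le_add ih (hq _))
      have hi : Function.Injective fun i : ℕ => m + (i : ℤ) := fun a b h => by
        simp only at h; omega
      refine h1.trans (((hw.comp_injective hi).sum_le_tsum _ fun i _ => hw0 _).trans ?_)
      exact tsum_comp_le_tsum_of_inj hw hw0 hi
    refine le_of_tendsto ((hl.sub hl').norm) (Eventually.of_forall fun n => ?_)
    have := hb (-(n : ℤ)) (2 * n)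
    have e : -(n : ℤ) + ((2 * n : ℕ) : ℤ) = n := by push_cast; ring
    rwa [e] at this

/-- Local bounds, on the cells `(m/σ, (m+1)/σ]`, for integrals against `e^{i ξ x} dU`. -/
def LocallyBounded (U : ℝ → ℂ) (ξ σ : ℝ) (A : ℤ → ℝ) : Prop :=
  ∀ (m : ℤ) (a b : ℝ), m / σ ≤ a → a ≤ b → b ≤ (m + 1) / σ → ∀ (h : ℝ → ℂ) (C : ℝ),
    V2 h (Ioc a b) C → ∃ I, HasStieltjes (fun x => wave ξ x * h x) U a b I ∧ ‖I‖ ≤ A m * C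

theorem conj_wave (ξ x : ℝ) : (starRingEnd ℂ) (wave ξ x) = wave (-ξ) x := by
  simp [wave, ← Complex.exp_conj]

theorem LocallyBounded.conj {U : ℝ → ℂ} {ξ σ : ℝ} {A : ℤ → ℝ} (hU : LocallyBounded U ξ σ A) :
    LocallyBounded (fun x => (starRingEnd ℂ) (U x)) (-ξ) σ A := by
  intro m a b h1 h2 h3 h C hh
  obtain ⟨I, hI, hIb⟩ := hU m a b h1 h2 h3 _ C hh.conj
  refine ⟨(starRingEnd ℂ) I, ?_, by simpa using hIb⟩
  have := hI.conj
  simpa only [map_mul, conj_wave, Complex.conj_conj] using this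

/-- Existence on bounded intervals follows by gluing finitely many cells. The indefinite integral
`E` has summable increments over the cells, so it has limits along the grid at both ends. -/
theorem LocallyBounded.exists_hasLineIntegral {U : ℝ → ℂ} {ξ σ : ℝ} {A c : ℤ → ℝ} {h : ℝ → ℂ}
    (hU : LocallyBounded U ξ σ A) (hσ : 0 < σ)
    (hh : ∀ m : ℤ, V2 h (Ioc (m / σ) ((m + 1) / σ)) (c m)) (hs : Summable fun m => A m * c m) :
    ∃ I, HasLineIntegral (fun x => wave ξ x * h x) U I ∧ ‖I‖ ≤ ∑' m, A m * c m := by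
  set g : ℝ → ℂ := fun x => wave ξ x * h x with hg
  have hcell : ∀ (m : ℤ) (a b : ℝ), m / σ ≤ a → a ≤ b → b ≤ (m + 1) / σ →
      ∃ I, HasStieltjes g U a b I ∧ ‖I‖ ≤ A m * c m := fun m a b h1 h2 h3 =>
    hU m a b h1 h2 h3 h (c m) ((hh m).mono (Ioc_subset_Ioc h1 h3) le_rfl)
  have hex' : ∀ (n : ℕ) (m : ℤ) (a b : ℝ), m / σ ≤ a → a ≤ b → b ≤ (m + n) / σ →
      ∃ I, HasStieltjes g U a b I := by
    intro n
    induction n with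
    | zero =>
      intro m a b h1 h2 h3
      obtain ⟨I, hI, -⟩ := hcell m a b h1 h2 (h3.trans (by gcongr; simp))
      exact ⟨I, hI⟩
    | succ n ih =>
      intro m a b h1 h2 h3
      push_cast at h3
      rcases le_total b ((m + n) / σ) with hb | hb
      · exact ih m a b h1 h2 hb
      rcases le_total ((m + n) / σ) a with ha | ha
      · obtain ⟨I, hI, -⟩ := hcell (m + n) a b (by push_cast; exact ha) h2
          (by push_cast; rwa [add_assoc])
        exact ⟨I, hI⟩
      · obtain ⟨I, hI⟩ := ih m a _ h1 ha le_rfl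
        obtain ⟨J, hJ, -⟩ := hcell (m + n) ((m + n) / σ) b (by push_cast; exact le_rfl) hb
          (by push_cast; rwa [add_assoc])
        exact ⟨I + J, hI.trans ha hb hJ⟩
  have hex : ∀ a b, a ≤ b → ∃ I, HasStieltjes g U a b I := by
    intro a b hab
    refine hex' (⌈σ * b⌉ - ⌊σ * a⌋).toNat ⌊σ * a⌋ a b ?_ hab ?_
    · rw [div_le_iff₀ hσ, mul_comm]; exact Int.floor_le _
    · rw [le_div_iff₀ hσ, mul_comm]
      refine (Int.le_ceil _).trans ?_
      have := Int.self_le_toNat (⌈σ * b⌉ - ⌊σ * a⌋)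
      have : (⌈σ * b⌉ : ℤ) ≤ ⌊σ * a⌋ + ((⌈σ * b⌉ - ⌊σ * a⌋).toNat : ℤ) := by omega
      exact_mod_cast this
  have hadd : ∀ a b c, a ≤ b → b ≤ c → stieltjes g U a c = stieltjes g U a b + stieltjes g U b c := by
    intro a b c hab hbc
    obtain ⟨I, hI⟩ := hex a b hab
    obtain ⟨J, hJ⟩ := hex b c hbc
    rw [hI.eq, hJ.eq, (hI.trans hab hbc hJ).eq]
  set E : ℝ → ℂ := fun x => if 0 ≤ x then stieltjes g U 0 x else -stieltjes g U x 0 with hE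
  have hEsub : ∀ a b, a ≤ b → stieltjes g U a b = E b - E a := by
    intro a b hab
    simp only [hE]
    split_ifs with h1 h2 h2
    · rw [hadd 0 a b h2 hab]; ring
    · rw [hadd a 0 b (not_le.1 h2).le h1]; ring
    · exact absurd (h2.trans hab) h1
    · rw [hadd a b 0 hab (not_le.1 h1).le]; ring
  have hEcell : ∀ (m : ℤ) (a b : ℝ), m / σ ≤ a → a ≤ b → b ≤ (m + 1) / σ →
      ‖E b - E a‖ ≤ A m * c m := by
    intro m a b h1 h2 h3
    obtain ⟨I, hI, hIb⟩ := hcell m a b h1 h2 h3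
    rw [← hEsub a b h2, hI.eq]
    exact hIb
  obtain ⟨l, l', hl, hl', hll⟩ := exists_limits_of_summable (q := fun m : ℤ => E (m / σ)) hs
    fun m => by
      push_cast
      exact hEcell m _ _ le_rfl (by gcongr; simp) le_rfl
  -- Passing from the grid to real endpoints costs at most one term of a summable family, which
  -- tends to zero.
  have herr : ∀ x, ‖E x - E (⌊σ * x⌋ / σ)‖ ≤ A ⌊σ * x⌋ * c ⌊σ * x⌋ := fun x => by
    have h0 : (⌊σ * x⌋ : ℝ) / σ ≤ x := by
      rw [div_le_iff₀ hσ, mul_comm]; exact Int.floor_le _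
    refine hEcell _ _ _ le_rfl h0 ?_
    rw [le_div_iff₀ hσ, mul_comm]; exact (Int.lt_floor_add_one _).le
  have hzero := hs.tendsto_cofinite_zero
  rw [Int.cofinite_eq, tendsto_sup] at hzero
  have hfl : Tendsto (fun x : ℝ => ⌊σ * x⌋) atTop atTop :=
    tendsto_floor_atTop.comp (tendsto_id.const_mul_atTop hσ)
  have hfl' : Tendsto (fun x : ℝ => ⌊σ * x⌋) atBot atBot :=
    tendsto_floor_atBot.comp (tendsto_id.const_mul_atBot hσ)
  have hET : Tendsto E atTop (𝓝 l) := by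
    have h1 := squeeze_zero_norm herr (hzero.2.comp hfl)
    simpa using h1.add (hl.comp hfl)
  have hEB : Tendsto E atBot (𝓝 l') := by
    have h1 := squeeze_zero_norm herr (hzero.1.comp hfl')
    simpa using h1.add (hl'.comp hfl')
  refine ⟨l - l', ⟨hex, ?_⟩, hll⟩
  refine Tendsto.congr' ?_ ((hET.comp tendsto_snd).sub (hEB.comp tendsto_fst))
  filter_upwards [eventually_fst_le_snd] with p hp
  exact (hEsub _ _ hp).symm

/-! ### Primitives of functions against `dU` have bounded 2-variation -/

theorem V2.one (s : Set ℝ) : V2 (fun _ => 1) s 1 :=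
  ⟨zero_le_one, fun _ _ => by simp, fun n t _ _ => by simp⟩

theorem V2.indicator_lt (y : ℝ) : V2 (fun x => if x < y then 1 else 0) univ 3 := by
  classical
  have hκ : Monotone fun x : ℝ => if x < y then (0 : ℤ) else 1 := by
    intro x x' hx
    simp only
    split_ifs <;> first | omega | (exfalso; linarith)
  refine (V2.of_step hκ (φ := fun m => if m = 0 then 1 else 0) fun T => ?_).congr fun x _ => ?_
  · have : ∀ m : ℤ, ‖(if m = 0 then 1 else 0 : ℂ)‖ ^ 2 = if m = 0 then 1 else 0 := by
      intro m; split_ifs <;> simp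
    simp only [this, Finset.sum_ite_eq']
    split_ifs <;> norm_num
  · by_cases h : x < y <;> simp [h]

/-- The function is $\sum_i c_i\chi_{[t_i,t_{i+1})}$, a step function with $\ell^2$ normalised
values. Counting the points up to `x` gives the level function, and degenerate intervals simply skip
a level. -/
theorem V2.sum_indicator_sub {n : ℕ} {c : ℕ → ℂ} (hc : ∑ i ∈ Finset.range n, ‖c i‖ ^ 2 ≤ 1)
    {t : ℕ → ℝ} (ht : Monotone t) :
    V2 (fun x => ∑ i ∈ Finset.range n,
      c i * ((if x < t (i + 1) then 1 else 0) - (if x < t i then 1 else 0))) univ 3 := by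
  classical
  set κ : ℝ → ℤ := fun x => (((Finset.range (n + 1)).filter fun i => t i ≤ x).card : ℤ) with hκ
  have hκm : Monotone κ := fun x y hxy => Nat.cast_le.2 <| Finset.card_le_card fun i hi => by
    simp only [Finset.mem_filter] at hi ⊢
    exact ⟨hi.1, hi.2.trans hxy⟩
  set φ : ℤ → ℂ := fun m => ∑ i ∈ Finset.range n, if m = i + 1 then c i else 0 with hφ
  have hφi : ∀ i < n, φ (i + 1) = c i := by
    intro i hi
    simp only [hφ]
    rw [Finset.sum_eq_single_of_mem i (Finset.mem_range.2 hi)]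
    · simp
    · intro j _ hj
      rw [if_neg (by omega)]
  have hφ0 : ∀ m, m ∉ (Finset.range n).image (fun i : ℕ => (i : ℤ) + 1) → φ m = 0 := by
    intro m hm
    refine Finset.sum_eq_zero fun i hi => if_neg fun h => hm ?_
    exact Finset.mem_image.2 ⟨i, hi, h.symm⟩
  refine (V2.of_step hκm (φ := φ) fun T => ?_).congr fun x _ => ?_
  · refine le_trans ?_ hc
    calc ∑ m ∈ T, ‖φ m‖ ^ 2 ≤ ∑ m ∈ T ∪ (Finset.range n).image (fun i : ℕ => (i : ℤ) + 1), ‖φ m‖ ^ 2 :=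
          Finset.sum_le_sum_of_subset_of_nonneg Finset.subset_union_left fun _ _ _ => by positivity
      _ = ∑ m ∈ (Finset.range n).image (fun i : ℕ => (i : ℤ) + 1), ‖φ m‖ ^ 2 :=
          (Finset.sum_subset Finset.subset_union_right fun m _ hm => by simp [hφ0 m hm]).symm
      _ = ∑ i ∈ Finset.range n, ‖c i‖ ^ 2 := by
          rw [Finset.sum_image fun i _ j _ h => by simpa using h]
          exact Finset.sum_congr rfl fun i hi => by rw [hφi i (Finset.mem_range.1 hi)]
  · simp only [hφ]
    refine Finset.sum_congr rfl fun i hi => ?_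
    have hi := Finset.mem_range.1 hi
    have h1 := le_iff_lt_card ht (show i < n + 1 by omega) x
    have h2 := le_iff_lt_card ht (show i + 1 < n + 1 by omega) x
    have hle : t i ≤ t (i + 1) := ht (Nat.le_succ i)
    by_cases hx1 : t (i + 1) ≤ x
    · have hx0 := hle.trans hx1
      rw [if_neg (not_lt.2 hx1), if_neg (not_lt.2 hx0), if_neg]
      · simp
      · have := h2.1 hx1
        simp only [hκ]; omega
    · by_cases hx0 : t i ≤ x
      · rw [if_pos (not_le.1 hx1), if_neg (not_lt.2 hx0), if_pos]
        · simp
        · have h3 := h1.1 hx0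
          have h4 := mt h2.2 hx1
          simp only [hκ]; omega
      · rw [if_pos (not_le.1 hx1), if_pos (not_le.1 hx0), if_neg]
        · simp
        · have h3 := mt h1.2 hx0
          simp only [hκ]; omega

/-- Converse duality. The pairing $\sum c_i(f(t_{i+1})-f(t_i))$ is one integral of $w$ against the
step function $\sum c_i\chi_{[t_i,t_{i+1})}$, hence at most `M`. Only test functions vanishing to
the right of `s` are admitted, because the exponential weight later used as `w` grows to the right.
-/
theorem V2.of_hasLineIntegral {w U f : ℝ → ℂ} {s : Set ℝ} {M : ℝ}
    (H : ∀ c : ℝ → ℂ, V2 c univ 3 → (∀ x, (∀ t ∈ s, t ≤ x) → c x = 0) →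
      ∃ I, HasLineIntegral (fun x => c x * w x) U I ∧ ‖I‖ ≤ M)
    (hf : ∀ t ∈ s, f t = stieltjesLine (fun x => (if x < t then 1 else 0) * w x) U) : V2 f s M := by
  have hind : ∀ t ∈ s, HasLineIntegral (fun x => (if x < t then 1 else 0) * w x) U (f t) ∧
      ‖f t‖ ≤ M := by
    intro t hts
    obtain ⟨I, hI, hIb⟩ := H _ (V2.indicator_lt t) fun x hx => if_neg (not_lt.2 (hx t hts))
    rw [hf t hts, hI.eq]
    exact ⟨hI, hIb⟩
  have hM : 0 ≤ M := by
    obtain ⟨I, -, hIb⟩ := H _ (V2.zero univ (by norm_num)) fun _ _ => rfl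
    exact (norm_nonneg I).trans hIb
  refine ⟨hM, fun x hx => (hind x hx).2, fun n t ht hts => sum_sq_le_of_dual _ _ fun c hc => ?_⟩
  obtain ⟨I, hI, hIb⟩ := H _ (V2.sum_indicator_sub hc ht) fun x hx => by
    refine Finset.sum_eq_zero fun i _ => ?_
    rw [if_neg (not_lt.2 (hx _ (hts _))), if_neg (not_lt.2 (hx _ (hts _))), sub_self, mul_zero]
  have hsum := HasLineIntegral.sum_left (Finset.range n) fun i _ =>
    (((hind _ (hts (i + 1))).1.add_left ((hind _ (hts i)).1.mul_left (-1))).mul_left (c i))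
  have e : (fun x => ∑ i ∈ Finset.range n, c i * ((if x < t (i + 1) then 1 else 0) * w x +
      -1 * ((if x < t i then 1 else 0) * w x))) = fun x => (∑ i ∈ Finset.range n,
      c i * ((if x < t (i + 1) then 1 else 0) - (if x < t i then 1 else 0))) * w x := by
    funext x
    rw [Finset.sum_mul]
    exact Finset.sum_congr rfl fun i _ => by ring
  rw [e] at hsum
  have hval : ∑ i ∈ Finset.range n, c i * (f (t (i + 1)) - f (t i)) = I := by
    rw [← hI.eq, hsum.eq]
    exact Finset.sum_congr rfl fun i _ => by ring
  rw [hval]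
  exact hIb

/-! ### Square summable local bounds -/

/-- `A` is nonnegative with `ℓ²` norm at most `a`. -/
structure L2Bound (A : ℤ → ℝ) (a : ℝ) : Prop where
  nonneg : 0 ≤ a
  nonneg_apply : ∀ m, 0 ≤ A m
  sum_le : ∀ T : Finset ℤ, ∑ m ∈ T, A m ^ 2 ≤ a ^ 2

theorem L2Bound.le {A : ℤ → ℝ} {a : ℝ} (h : L2Bound A a) (m : ℤ) : A m ≤ a := by
  have := h.sum_le {m}
  rw [Finset.sum_singleton] at this
  exact (abs_le_of_sq_le_sq' this h.nonneg).2

/-- The exponentially decaying kernel `e^{-2(n-1)}`, `n ≥ 0`. -/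
def decay (n : ℤ) : ℝ := if 0 ≤ n then Real.exp (-2 * (n - 1)) else 0

theorem decay_nonneg (n : ℤ) : 0 ≤ decay n := by
  unfold decay; split_ifs <;> positivity

theorem summable_decay : Summable decay := by
  refine Summable.of_nat_of_neg_add_one ?_ ?_
  · have h1 : Summable fun n : ℕ => Real.exp 2 * Real.exp (-2) ^ n :=
      (summable_geometric_of_lt_one (Real.exp_pos _).le (by simp)).mul_left _
    refine h1.congr fun n => ?_
    rw [decay, if_pos (Int.natCast_nonneg n), ← Real.exp_nat_mul, ← Real.exp_add]
    congr 1
    push_cast; ring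
  · refine summable_zero.congr fun n => ?_
    rw [decay, if_neg (by omega)]

theorem L2Bound.summable_conv {A : ℤ → ℝ} {a : ℝ} (h : L2Bound A a) (k : ℤ) :
    Summable fun l => A l * decay (k - l) := by
  have h1 : Summable fun l => decay (k - l) := summable_decay.comp_injective sub_right_injective
  exact Summable.of_nonneg_of_le (fun l => mul_nonneg (h.nonneg_apply l) (decay_nonneg _))
    (fun l => mul_le_mul_of_nonneg_right (h.le l) (decay_nonneg _)) (h1.mul_left a)

/-- Young's inequality: for each fixed offset $n=k-l$, apply Cauchy–Schwarz in $k$, then sum over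
$n$ against `decay`. -/
theorem L2Bound.sum_conv_le {A B : ℤ → ℝ} {a b : ℝ} (hA : L2Bound A a) (hB : L2Bound B b)
    (T : Finset ℤ) :
    ∑ k ∈ T, B k * ∑' l, A l * decay (k - l) ≤ (∑' n, decay n) * (a * b) := by
  have e : ∀ k, ∑' l, A l * decay (k - l) = ∑' n, A (k - n) * decay n := fun k => by
    rw [← (Equiv.subLeft k).tsum_eq]
    simp
  have hs : ∀ k, Summable fun n => A (k - n) * decay n := fun k => by
    have := (Equiv.subLeft k).summable_iff.2 (hA.summable_conv k)
    refine this.congr fun n => ?_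
    simp
  have e2 : ∑ k ∈ T, B k * ∑' l, A l * decay (k - l) =
      ∑' n, ∑ k ∈ T, B k * (A (k - n) * decay n) := by
    rw [Summable.tsum_finsetSum fun k _ => (hs k).mul_left _]
    exact Finset.sum_congr rfl fun k _ => by rw [e, tsum_mul_left]
  rw [e2, ← tsum_mul_right]
  refine Summable.tsum_le_tsum (fun n => ?_) (summable_sum fun k _ => (hs k).mul_left _)
    (summable_decay.mul_right _)
  have h1 := Finset.sum_mul_sq_le_sq_mul_sq T (fun k => B k) (fun k => A (k - n))
  have h2 : ∑ k ∈ T, A (k - n) ^ 2 ≤ a ^ 2 := by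
    have := hA.sum_le (T.image fun k => k - n)
    rwa [Finset.sum_image fun x _ y _ h => by simpa using h] at this
  have h3 : (∑ k ∈ T, B k * A (k - n)) ^ 2 ≤ (a * b) ^ 2 := by
    refine h1.trans ?_
    rw [mul_pow, mul_comm]
    exact mul_le_mul h2 (hB.sum_le T) (Finset.sum_nonneg fun _ _ => sq_nonneg _) (sq_nonneg a)
  have h4 := (abs_le_of_sq_le_sq' h3 (mul_nonneg hA.nonneg hB.nonneg)).2
  calc ∑ k ∈ T, B k * (A (k - n) * decay n) = decay n * ∑ k ∈ T, B k * A (k - n) := by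
        rw [Finset.mul_sum]; exact Finset.sum_congr rfl fun k _ => by ring
    _ ≤ decay n * (a * b) := mul_le_mul_of_nonneg_left h4 (decay_nonneg n)

/-! ### The iterated integrals -/

theorem wave_mul_wave_neg (ξ x : ℝ) : wave ξ x * wave (-ξ) x = 1 := by
  rw [wave, wave, ← Complex.exp_add, ← mul_add, ← Complex.ofReal_add]
  simp

/-- Separation of variables, normalised at `k`: when `k` is the index of the cell of `y`, the `y`
factor is at most one there, and the `x` factor decays geometrically over the cells to the left. -/
theorem exp_kernel (z : ℂ) (k x y : ℝ) :
    Complex.exp (2 * Complex.I * z * ((y : ℂ) - (x : ℂ))) =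
      wave (2 * z.re) y * (Real.exp (-2 * (z.im * y - k)) : ℂ) *
        (wave (-(2 * z.re)) x * (Real.exp (-2 * (k - z.im * x)) : ℂ)) := by
  rw [wave, wave, Complex.ofReal_exp, Complex.ofReal_exp, ← Complex.exp_add, ← Complex.exp_add,
    ← Complex.exp_add]
  congr 1
  conv_lhs => rw [← Complex.re_add_im z]
  push_cast
  linear_combination (-2 * (z.im : ℂ) * (x : ℂ) + 2 * (z.im : ℂ) * (y : ℂ)) * Complex.I_sq

/-- Being increasing and positive, the weight has variation at most its value at the right endpoint
$(l+1)/\sigma$. This endpoint is the origin of the shift by one in `decay`. -/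
theorem V2.exp_mul {σ : ℝ} (hσ : 0 < σ) (k l : ℤ) :
    V2 (fun x => (Real.exp (-2 * (k - σ * x)) : ℂ)) (Ioc (l / σ) ((l + 1) / σ))
      (Real.exp (-2 * ((k - l : ℤ) - 1))) := by
  have hmono : Monotone fun x : ℝ => Real.exp (-2 * (k - σ * x)) := fun x y hxy =>
    Real.exp_le_exp.2 (by nlinarith)
  have hle : ∀ x ∈ Ioc (l / σ) ((l + 1) / σ),
      Real.exp (-2 * (k - σ * x)) ≤ Real.exp (-2 * ((k - l : ℤ) - 1)) := by
    intro x hx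
    have := (le_div_iff₀ hσ).1 hx.2
    refine Real.exp_le_exp.2 ?_
    push_cast
    nlinarith
  refine V2.of_dominated (fun x => Real.exp (-2 * (k - σ * x))) (Real.exp_pos _).le ?_ ?_ ?_
  · intro x hx
    rw [Complex.norm_real, Real.norm_eq_abs, abs_of_pos (Real.exp_pos _)]
    exact hle x hx
  · intro x _ y _ hxy
    rw [← Complex.ofReal_sub, Complex.norm_real, Real.norm_eq_abs,
      abs_of_nonneg (sub_nonneg.2 (hmono hxy))]
  · intro x _ y hy _
    linarith [hle y hy, Real.exp_pos (-2 * (k - σ * x))]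

theorem V2.exp_neg {σ : ℝ} (hσ : 0 < σ) (k : ℤ) :
    V2 (fun y => (Real.exp (-2 * (σ * y - k)) : ℂ)) (Icc (k / σ) ((k + 1) / σ)) 1 := by
  have hanti : Antitone fun x : ℝ => Real.exp (-2 * (σ * x - k)) := fun x y hxy =>
    Real.exp_le_exp.2 (by nlinarith)
  have hle : ∀ x ∈ Icc (k / σ) ((k + 1) / σ), Real.exp (-2 * (σ * x - k)) ≤ 1 := by
    intro x hx
    have := (div_le_iff₀ hσ).1 hx.1
    exact Real.exp_le_one_iff.2 (by nlinarith)
  refine V2.of_dominated (fun x => -Real.exp (-2 * (σ * x - k))) zero_le_one ?_ ?_ ?_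
  · intro x hx
    rw [Complex.norm_real, Real.norm_eq_abs, abs_of_pos (Real.exp_pos _)]
    exact hle x hx
  · intro x _ y _ hxy
    rw [← Complex.ofReal_sub, Complex.norm_real, Real.norm_eq_abs,
      abs_of_nonpos (sub_nonpos.2 (hanti hxy))]
    linarith
  · intro x hx y _ _
    linarith [hle x hx, Real.exp_pos (-2 * (σ * y - k))]

/-- The hypotheses on the primitives `U`, `V` for the estimate of the iterated integrals. -/
structure KernelBounds (z : ℂ) (U V : ℝ → ℂ) (A B : ℤ → ℝ) (a b : ℝ) : Prop where
  im_pos : 0 < z.im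
  left : LocallyBounded V (2 * z.re) z.im A
  right : LocallyBounded U (2 * z.re) z.im B
  l2_left : L2Bound A a
  l2_right : L2Bound B b

section KernelBounds

variable {z : ℂ} {U V φ : ℝ → ℂ} {A B : ℤ → ℝ} {a b Φ : ℝ}

/-- On each cell $l\le k$ two applications of the product rule give $2\cdot3\cdot2=12$ times `Φ` and
the decay. Cells to the right of `k` drop out because `c` vanishes there. -/
theorem KernelBounds.hasLineIntegral_left (h : KernelBounds z U V A B a b) (hφ : V2 φ univ Φ)
    (k : ℤ) {c : ℝ → ℂ} (hc : V2 c univ 3) (hc0 : ∀ x, (k + 1) / z.im ≤ x → c x = 0) :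
    ∃ I, HasLineIntegral (fun x => c x * (wave (-(2 * z.re)) x *
        ((Real.exp (-2 * (k - z.im * x)) : ℂ) * φ x))) (fun x => (starRingEnd ℂ) (V x)) I ∧
      ‖I‖ ≤ 12 * Φ * ∑' l, A l * decay (k - l) := by
  have hs := h.l2_left.summable_conv k
  have hΦ := hφ.nonneg
  have hcell : ∀ l : ℤ, V2 (fun x => c x * ((Real.exp (-2 * (k - z.im * x)) : ℂ) * φ x))
      (Ioc (l / z.im) ((l + 1) / z.im)) (12 * Φ * decay (k - l)) := by
    intro l
    rcases le_or_gt l k with hl | hl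
    · refine ((hc.mono (subset_univ _) le_rfl).mul
        ((V2.exp_mul h.im_pos k l).mul (hφ.mono (subset_univ _) le_rfl))).mono subset_rfl ?_
      rw [decay, if_pos (by omega)]
      exact le_of_eq (by ring)
    · refine (V2.zero _ (mul_nonneg (by linarith) (decay_nonneg _))).congr fun x hx => ?_
      have : ((k : ℝ) + 1) / z.im ≤ l / z.im := by
        have : (k : ℝ) + 1 ≤ l := by exact_mod_cast hl
        have := h.im_pos
        gcongr
      rw [hc0 x (this.trans hx.1.le), zero_mul]
  obtain ⟨I, hI, hIb⟩ := h.left.conj.exists_hasLineIntegral h.im_pos hcell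
    ((hs.mul_left (12 * Φ)).congr fun l => by ring)
  refine ⟨I, ?_, hIb.trans (le_of_eq ?_)⟩
  · have e : (fun x => c x * (wave (-(2 * z.re)) x *
        ((Real.exp (-2 * (k - z.im * x)) : ℂ) * φ x))) = fun x => wave (-(2 * z.re)) x *
        (c x * ((Real.exp (-2 * (k - z.im * x)) : ℂ) * φ x)) := funext fun x => by ring
    rw [e]
    exact hI
  · rw [← tsum_mul_left]
    exact tsum_congr fun l => by ring

theorem innerIntegrand_eq (z : ℂ) (φ : ℝ → ℂ) (k x y : ℝ) :
    innerIntegrand z φ y x = wave (2 * z.re) y * (Real.exp (-2 * (z.im * y - k)) : ℂ) *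
      ((if x < y then 1 else 0) * (wave (-(2 * z.re)) x *
        ((Real.exp (-2 * (k - z.im * x)) : ℂ) * φ x))) := by
  unfold innerIntegrand
  split_ifs
  · rw [exp_kernel z k]; ring
  · ring

theorem KernelBounds.hasLineIntegral_inner (h : KernelBounds z U V A B a b) (hφ : V2 φ univ Φ)
    (k : ℤ) {y : ℝ} (hy : y ≤ (k + 1) / z.im) :
    HasLineIntegral (innerIntegrand z φ y) (fun x => (starRingEnd ℂ) (V x))
      (wave (2 * z.re) y * (Real.exp (-2 * (z.im * y - k)) : ℂ) *
        stieltjesLine (fun x => (if x < y then 1 else 0) * (wave (-(2 * z.re)) x *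
          ((Real.exp (-2 * (k - z.im * x)) : ℂ) * φ x))) (fun x => (starRingEnd ℂ) (V x))) := by
  obtain ⟨I, hI, -⟩ := h.hasLineIntegral_left hφ k (V2.indicator_lt y)
    fun x hx => if_neg (not_lt.2 (hy.trans hx))
  rw [funext fun x => innerIntegrand_eq z φ k x y, hI.eq]
  exact hI.mul_left _

theorem KernelBounds.integrable_inner (h : KernelBounds z U V A B a b) (hφ : V2 φ univ Φ) (y : ℝ) :
    StieltjesIntegrable (innerIntegrand z φ y) (fun x => (starRingEnd ℂ) (V x)) := by
  refine (h.hasLineIntegral_inner hφ ⌊y * z.im⌋ ?_).integrable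
  rw [le_div_iff₀ h.im_pos]
  exact (Int.lt_floor_add_one _).le

/-- On cell `k` the inner integral is a plane wave times a decreasing exponential times a primitive.
Converse duality controls the primitive, and the product rule doubles 12 to 24. Removing the wave is
essential: its frequency is not bounded in terms of the scale. -/
theorem KernelBounds.v2_innerIntegral (h : KernelBounds z U V A B a b) (hφ : V2 φ univ Φ)
    (k : ℤ) :
    V2 (fun y => wave (-(2 * z.re)) y * innerIntegral z V φ y)
      (Icc (k / z.im) ((k + 1) / z.im)) (24 * Φ * ∑' l, A l * decay (k - l)) := by
  have hle : (k : ℝ) / z.im ≤ (k + 1) / z.im := by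
    have := h.im_pos
    gcongr
    linarith
  have h1 : V2 (fun y => stieltjesLine (fun x => (if x < y then 1 else 0) *
      (wave (-(2 * z.re)) x * ((Real.exp (-2 * (k - z.im * x)) : ℂ) * φ x)))
      (fun x => (starRingEnd ℂ) (V x))) (Icc (k / z.im) ((k + 1) / z.im))
      (12 * Φ * ∑' l, A l * decay (k - l)) :=
    V2.of_hasLineIntegral (fun c hc hc0 => h.hasLineIntegral_left hφ k hc fun x hx =>
      hc0 x fun t ht => ht.2.trans hx) fun _ _ => rfl
  refine (((V2.exp_neg h.im_pos k).mul h1).congr fun y hy => ?_).mono subset_rfl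
    (le_of_eq (by ring))
  rw [innerIntegral, (h.hasLineIntegral_inner hφ k hy.2).eq]
  linear_combination (Real.exp (-2 * (z.im * y - k)) : ℂ) *
    stieltjesLine (fun x => (if x < y then 1 else 0) * (wave (-(2 * z.re)) x *
      ((Real.exp (-2 * (k - z.im * x)) : ℂ) * φ x))) (fun x => (starRingEnd ℂ) (V x)) *
    wave_mul_wave_neg (2 * z.re) y

/-- The constant in the estimate of the double integral. -/
def kernelConst : ℝ := 144 * ∑' n, decay n

theorem kernelConst_nonneg : 0 ≤ kernelConst :=
  mul_nonneg (by norm_num) (tsum_nonneg decay_nonneg)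

/-- The factor left over after demodulating the inner integral is exactly the
$e^{2i\operatorname{Re}z\,y}$ needed for the local bounds on $dU$. The product with `c` gives
$144=2\cdot3\cdot24$, and the sum over cells is the discrete convolution estimate. -/
theorem KernelBounds.hasLineIntegral_right (h : KernelBounds z U V A B a b) (hφ : V2 φ univ Φ)
    {c : ℝ → ℂ} (hc : V2 c univ 3) :
    ∃ I, HasLineIntegral (fun y => c y * innerIntegral z V φ y) U I ∧
      ‖I‖ ≤ kernelConst * (a * b) * Φ := by
  have hΦ := hφ.nonneg
  have hD : ∀ k, 0 ≤ ∑' l, A l * decay (k - l) := fun k =>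
    tsum_nonneg fun l => mul_nonneg (h.l2_left.nonneg_apply l) (decay_nonneg _)
  have hnn : ∀ k, 0 ≤ B k * ∑' l, A l * decay (k - l) := fun k =>
    mul_nonneg (h.l2_right.nonneg_apply k) (hD k)
  have hs : Summable fun k => B k * ∑' l, A l * decay (k - l) :=
    summable_of_sum_le hnn (h.l2_left.sum_conv_le h.l2_right)
  obtain ⟨I, hI, hIb⟩ := h.right.exists_hasLineIntegral h.im_pos
    (h := fun y => c y * (wave (-(2 * z.re)) y * innerIntegral z V φ y))
    (c := fun k => 144 * Φ * ∑' l, A l * decay (k - l))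
    (fun k => ((hc.mono (subset_univ _) le_rfl).mul ((h.v2_innerIntegral hφ k).mono
      Ioc_subset_Icc_self le_rfl)).mono subset_rfl (le_of_eq (by ring)))
    ((hs.mul_left (144 * Φ)).congr fun k => by ring)
  refine ⟨I, ?_, hIb.trans ?_⟩
  · have e : (fun y => c y * innerIntegral z V φ y) = fun y => wave (2 * z.re) y *
        (c y * (wave (-(2 * z.re)) y * innerIntegral z V φ y)) := funext fun y => by
      linear_combination -(c y * innerIntegral z V φ y) * wave_mul_wave_neg (2 * z.re) y
    rw [e]
    exact hI
  · have e : ∑' k, B k * (144 * Φ * ∑' l, A l * decay (k - l)) =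
        144 * Φ * ∑' k, B k * ∑' l, A l * decay (k - l) := by
      rw [← tsum_mul_left]
      exact tsum_congr fun k => by ring
    rw [e]
    have := hs.tsum_le_of_sum_le (h.l2_left.sum_conv_le h.l2_right)
    rw [kernelConst]
    nlinarith

theorem outerIntegrand_eq (w : ℝ → ℂ) (t : ℝ) :
    outerIntegrand w t = fun y => (if y < t then 1 else 0) * w y := by
  funext y
  unfold outerIntegrand
  split_ifs <;> simp

theorem KernelBounds.integrable_outer (h : KernelBounds z U V A B a b) (hφ : V2 φ univ Φ) (t : ℝ) :
    StieltjesIntegrable (outerIntegrand (innerIntegral z V φ) t) U := by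
  obtain ⟨I, hI, -⟩ := h.hasLineIntegral_right hφ (V2.indicator_lt t)
  rw [outerIntegrand_eq]
  exact hI.integrable

theorem KernelBounds.hasLineIntegral_total (h : KernelBounds z U V A B a b) (hφ : V2 φ univ Φ) :
    ∃ I, HasLineIntegral (innerIntegral z V φ) U I ∧ ‖I‖ ≤ kernelConst * (a * b) * Φ := by
  obtain ⟨I, hI, hIb⟩ := h.hasLineIntegral_right hφ ((V2.one univ).mono subset_rfl (by norm_num))
  simp only [one_mul] at hI
  exact ⟨I, hI, hIb⟩

/-- The bound for the double integral holds uniformly over test functions `c`, which is precisely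
the input of converse duality. Hence the induction closes with one factor per step. -/
theorem KernelBounds.v2_iter (h : KernelBounds z U V A B a b) (j : ℕ) :
    V2 (iter z U V j) univ ((kernelConst * (a * b)) ^ j) := by
  induction j with
  | zero => simpa [iter] using V2.one univ
  | succ j ih =>
    rw [pow_succ']
    refine V2.of_hasLineIntegral (fun c hc _ => h.hasLineIntegral_right ih hc) fun t _ => ?_
    simp only [iter, outerIntegrand_eq]

theorem KernelBounds.iteratedIntegralsExist {u v : Distr}
    (h : KernelBounds z (primitive u) (primitive v) A B a b) (hu : ∃ U, IsPrimitive U u)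
    (hv : ∃ V, IsPrimitive V v) : IteratedIntegralsExist z u v :=
  ⟨hu, hv, fun j => ⟨fun y => h.integrable_inner (h.v2_iter j) y,
    fun t => h.integrable_outer (h.v2_iter j) t,
    (h.hasLineIntegral_total (h.v2_iter j)).choose_spec.1.integrable⟩⟩

theorem KernelBounds.norm_T_le {u v : Distr}
    (h : KernelBounds z (primitive u) (primitive v) A B a b) (j : ℕ) :
    ‖T z u v j‖ ≤ (kernelConst * (a * b)) ^ j := by
  cases j with
  | zero => simp [T]
  | succ j =>
    obtain ⟨I, hI, hIb⟩ := h.hasLineIntegral_total (h.v2_iter j)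
    rw [T, hI.eq, pow_succ']
    exact hIb

end KernelBounds

/-! ### The logarithm of a power series -/

-- The formal identity $f\,(\ln f)'=f'$: substitute $f-1$ into $\log'(1+X)\cdot(1+X)=1$ and use the
-- chain rule.
open PowerSeries in
theorem derivative_logOf_mul {f : PowerSeries ℂ} (hf : constantCoeff f = 1) :
    derivative ℂ (logOf f) * f = derivative ℂ f := by
  have hs : HasSubst (f - 1) := HasSubst.of_constantCoeff_zero' (by simp [hf])
  have h1 : derivative ℂ (log ℂ) * (1 + X) = 1 := by
    rw [deriv_log]
    ext n
    cases n with
    | zero => simp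
    | succ n =>
      rw [mul_add, mul_one, map_add, coeff_succ_mul_X, coeff_mk, coeff_mk, coeff_one,
        if_neg (Nat.succ_ne_zero n)]
      simp [pow_succ]
  have h2 := congrArg (substAlgHom hs) h1
  rw [map_mul, map_add, map_one, substAlgHom_X, add_sub_cancel] at h2
  rw [logOf_eq, derivative_subst hs, ← coe_substAlgHom hs, map_sub, derivative_one, sub_zero]
  linear_combination (derivative ℂ f) * h2

section Log

variable {t : ℕ → ℂ}

/-- The coefficients of the logarithm of `∑ t_j ζ^j`. -/
def logCoeff (t : ℕ → ℂ) (j : ℕ) : ℂ :=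
  PowerSeries.coeff j (PowerSeries.logOf (PowerSeries.mk t))

theorem logCoeff_zero (h0 : t 0 = 1) : logCoeff t 0 = 0 := by
  rw [logCoeff, PowerSeries.coeff_zero_eq_constantCoeff_apply]
  refine PowerSeries.constantCoeff_logOf ?_
  rw [← PowerSeries.coeff_zero_eq_constantCoeff_apply, PowerSeries.coeff_mk, h0]

theorem logCoeff_recursion (h0 : t 0 = 1) (n : ℕ) :
    ∑ p ∈ Finset.HasAntidiagonal.antidiagonal n, logCoeff t (p.1 + 1) * (p.1 + 1) * t p.2 =
      t (n + 1) * (n + 1) := by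
  have h := derivative_logOf_mul (f := PowerSeries.mk t) (by
    rw [← PowerSeries.coeff_zero_eq_constantCoeff_apply, PowerSeries.coeff_mk, h0])
  have h2 := congrArg (PowerSeries.coeff n) h
  rw [PowerSeries.coeff_mul, PowerSeries.coeff_derivative, PowerSeries.coeff_mk] at h2
  rw [← h2]
  refine Finset.sum_congr rfl fun p _ => ?_
  rw [PowerSeries.coeff_derivative, PowerSeries.coeff_mk, logCoeff]

/-- Strong induction on the recursion. After division by $n+1$ the right side is at most
$A^{n+1}\bigl(1+\sum_{k<n}2^{k+1}\bigr)=A^{n+1}(2^{n+1}-1)$. -/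
theorem norm_logCoeff_le (h0 : t 0 = 1) {A : ℝ} (hA : 0 ≤ A) (ht : ∀ j, ‖t j‖ ≤ A ^ j) (j : ℕ) :
    ‖logCoeff t j‖ ≤ (2 * A) ^ j := by
  induction j using Nat.strong_induction_on with
  | h j ih =>
    cases j with
    | zero => simp [logCoeff_zero h0]
    | succ n =>
      have h := logCoeff_recursion h0 n
      rw [Finset.Nat.sum_antidiagonal_eq_sum_range_succ_mk, Finset.sum_range_succ] at h
      simp only [Nat.sub_self, h0, mul_one] at h
      have hn : (0 : ℝ) < n + 1 := by positivity
      have hnorm : ‖((n : ℂ) + 1)‖ = n + 1 := by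
        rw [← Nat.cast_succ, Complex.norm_natCast, Nat.cast_succ]
      have hsum : ‖∑ k ∈ Finset.range n, logCoeff t (k + 1) * (k + 1) * t (n - k)‖ ≤
          (n + 1) * (A ^ (n + 1) * (2 ^ (n + 1) - 2)) := by
        have e : ∀ n : ℕ, (2 : ℝ) ^ (n + 1) - 2 = ∑ k ∈ Finset.range n, 2 ^ (k + 1) := by
          intro n
          induction n with
          | zero => simp
          | succ n ih => rw [Finset.sum_range_succ, ← ih]; ring
        rw [e, Finset.mul_sum, Finset.mul_sum]
        refine norm_sum_le_of_le _ fun k hk => ?_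
        have hk := Finset.mem_range.1 hk
        have hknorm : ‖((k : ℂ) + 1)‖ ≤ n + 1 := by
          rw [← Nat.cast_succ, Complex.norm_natCast, Nat.cast_succ]
          have : (k : ℝ) ≤ n := by exact_mod_cast hk.le
          linarith
        rw [norm_mul, norm_mul]
        calc ‖logCoeff t (k + 1)‖ * ‖((k : ℂ) + 1)‖ * ‖t (n - k)‖
            ≤ (2 * A) ^ (k + 1) * (n + 1) * A ^ (n - k) := by
              gcongr
              · exact ih (k + 1) (by omega)
              · exact ht _
          _ = (n + 1) * (A ^ (n + 1) * 2 ^ (k + 1)) := by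
              have : n + 1 = (k + 1) + (n - k) := by omega
              rw [this, pow_add A, mul_pow]; ring
      have h3 : logCoeff t (n + 1) * (n + 1) = t (n + 1) * (n + 1) -
          ∑ k ∈ Finset.range n, logCoeff t (k + 1) * (k + 1) * t (n - k) := by rw [← h]; ring
      have h4 : ‖logCoeff t (n + 1)‖ * (n + 1) ≤ (2 * A) ^ (n + 1) * (n + 1) := by
        rw [← hnorm, ← norm_mul, h3, hnorm]
        refine (norm_sub_le _ _).trans ?_
        rw [norm_mul, hnorm]
        have h5 := mul_le_mul_of_nonneg_right (ht (n + 1)) hn.le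
        have h6 : 0 ≤ A ^ (n + 1) := pow_nonneg hA _
        rw [mul_pow]
        nlinarith
      exact le_of_mul_le_mul_right h4 hn

/-- Coefficients below $4^{-j}$ on the disc of radius 2 give terms dominated by $n2^{-n}$. This disc
contains both 0 and 1, the two points compared later. -/
theorem hasDerivAt_powerSeries {c : ℕ → ℂ} (hc : ∀ j, ‖c j‖ ≤ (1 / 4) ^ j) {s : ℂ}
    (hs : s ∈ Metric.ball (0 : ℂ) 2) :
    HasDerivAt (fun s : ℂ => ∑' n, c n * s ^ n) (∑' n : ℕ, c (n + 1) * (n + 1) * s ^ n) s := by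
  have hu : Summable fun n : ℕ => (n : ℝ) * (1 / 2 : ℝ) ^ n := by
    simpa using summable_pow_mul_geometric_of_norm_lt_one 1 (r := (1 / 2 : ℝ)) (by norm_num)
  have hb : ∀ (n : ℕ) (s : ℂ), s ∈ Metric.ball (0 : ℂ) 2 →
      ‖c n * (n * s ^ (n - 1))‖ ≤ (n : ℝ) * (1 / 2 : ℝ) ^ n := by
    intro n s hs
    rcases Nat.eq_zero_or_pos n with rfl | hn
    · simp
    have hs' : ‖s‖ ≤ 2 := by simpa using (mem_ball_zero_iff.1 hs).le
    rw [norm_mul, norm_mul, norm_pow, Complex.norm_natCast]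
    calc ‖c n‖ * (n * ‖s‖ ^ (n - 1)) ≤ (1 / 4) ^ n * (n * 2 ^ (n - 1)) := by
          gcongr
          exact hc n
      _ ≤ (1 / 4) ^ n * (n * 2 ^ n) := by
          gcongr
          · norm_num
          · omega
      _ = n * (1 / 2 : ℝ) ^ n := by
          rw [show (1 / 2 : ℝ) = 1 / 4 * 2 by norm_num, mul_pow]; ring
  have h := hasDerivAt_tsum_of_isPreconnected (g := fun n s => c n * s ^ n)
    (g' := fun n s => c n * (n * s ^ (n - 1))) (y₀ := 0) hu Metric.isOpen_ball
    (convex_ball (0 : ℂ) 2).isPreconnected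
    (fun n y _ => (hasDerivAt_pow n y).const_mul (c n)) hb (Metric.mem_ball_self (by norm_num))
    (summable_of_ne_finset_zero (s := {0}) fun n hn => by
      simp only [Finset.mem_singleton] at hn; simp [hn]) hs
  have hsum : Summable fun n : ℕ => c n * (n * s ^ (n - 1)) :=
    Summable.of_norm_bounded hu fun n => hb n s hs
  rw [hsum.tsum_eq_zero_add] at h
  simp only [Nat.cast_zero, zero_mul, mul_zero, zero_add] at h
  refine h.congr_deriv (tsum_congr fun n => ?_)
  rw [Nat.add_sub_cancel]; push_cast; ring

theorem summable_norm_powerSeries {c : ℕ → ℂ} (hc : ∀ j, ‖c j‖ ≤ (1 / 4) ^ j) {s : ℂ}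
    (hs : s ∈ Metric.ball (0 : ℂ) 2) : Summable fun n => ‖c n * s ^ n‖ := by
  have hs' : ‖s‖ ≤ 2 := by simpa using (mem_ball_zero_iff.1 hs).le
  refine Summable.of_nonneg_of_le (fun _ => norm_nonneg _) (fun n => ?_)
    (summable_geometric_of_lt_one (r := (1 / 2 : ℝ)) (by norm_num) (by norm_num))
  rw [norm_mul, norm_pow, show (1 / 2 : ℝ) = 1 / 4 * 2 by norm_num, mul_pow]
  gcongr
  exact hc n

theorem summable_norm_powerSeries_deriv {c : ℕ → ℂ} (hc : ∀ j, ‖c j‖ ≤ (1 / 4) ^ j) {s : ℂ}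
    (hs : s ∈ Metric.ball (0 : ℂ) 2) : Summable fun n : ℕ => ‖c (n + 1) * (n + 1) * s ^ n‖ := by
  have hs' : ‖s‖ ≤ 2 := by simpa using (mem_ball_zero_iff.1 hs).le
  have hu : Summable fun n : ℕ => ((n : ℝ) + 1) * (1 / 2 : ℝ) ^ n := by
    have h1 : Summable fun n : ℕ => (n : ℝ) * (1 / 2 : ℝ) ^ n := by
      simpa using summable_pow_mul_geometric_of_norm_lt_one 1 (r := (1 / 2 : ℝ)) (by norm_num)
    have h2 := summable_geometric_of_lt_one (r := (1 / 2 : ℝ)) (by norm_num) (by norm_num)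
    exact (h1.add h2).congr fun n => by ring
  refine Summable.of_nonneg_of_le (fun _ => norm_nonneg _) (fun n => ?_) hu
  rw [norm_mul, norm_mul, norm_pow, ← Nat.cast_succ, Complex.norm_natCast]
  calc ‖c (n + 1)‖ * (n.succ : ℝ) * ‖s‖ ^ n ≤ (1 / 4) ^ (n + 1) * n.succ * 2 ^ n := by
        gcongr
        exact hc _
    _ ≤ (1 / 4) ^ n * n.succ * 2 ^ n := by
        gcongr ?_ * _ * _
        exact pow_le_pow_of_le_one (by norm_num) (by norm_num) (Nat.le_succ n)
    _ = ((n : ℝ) + 1) * (1 / 2 : ℝ) ^ n := by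
        rw [show (1 / 2 : ℝ) = 1 / 4 * 2 by norm_num, mul_pow, Nat.cast_succ]; ring

/-- With $f=\sum t_ns^n$ and $g$ the series of logarithmic coefficients, $g'f=f'$ makes $fe^{-g}$
constant on the disc of radius 2. Compare $s=0$ with $s=1$. The condition $A\le1/8$ puts the
coefficients of both series, bounded by $A^j$ and $(2A)^j$, below $4^{-j}$. -/
theorem exp_tsum_logCoeff (h0 : t 0 = 1) {A : ℝ} (hA : 0 ≤ A) (hA' : A ≤ 1 / 8)
    (ht : ∀ j, ‖t j‖ ≤ A ^ j) : Complex.exp (∑' j, logCoeff t j) = ∑' j, t j := by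
  have ht4 : ∀ j, ‖t j‖ ≤ (1 / 4) ^ j := fun j =>
    (ht j).trans (pow_le_pow_left₀ hA (by linarith) j)
  have hl4 : ∀ j, ‖logCoeff t j‖ ≤ (1 / 4) ^ j := fun j =>
    (norm_logCoeff_le h0 hA ht j).trans (pow_le_pow_left₀ (by linarith) (by linarith) j)
  set f : ℂ → ℂ := fun s => ∑' n, t n * s ^ n with hf
  set g : ℂ → ℂ := fun s => ∑' n, logCoeff t n * s ^ n with hg
  have hder : ∀ s ∈ Metric.ball (0 : ℂ) 2, HasDerivAt (fun s => f s * Complex.exp (-g s)) 0 s := by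
    intro s hs
    have hfs := hasDerivAt_powerSeries ht4 hs
    have hgs := hasDerivAt_powerSeries hl4 hs
    have hprod : (∑' n : ℕ, logCoeff t (n + 1) * (n + 1) * s ^ n) * f s =
        ∑' n : ℕ, t (n + 1) * (n + 1) * s ^ n := by
      rw [hf, tsum_mul_tsum_eq_tsum_sum_antidiagonal_of_summable_norm
        (summable_norm_powerSeries_deriv hl4 hs) (summable_norm_powerSeries ht4 hs)]
      refine tsum_congr fun n => ?_
      rw [← logCoeff_recursion h0 n, Finset.sum_mul]
      refine Finset.sum_congr rfl fun p hp => ?_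
      rw [← Finset.HasAntidiagonal.mem_antidiagonal.1 hp, pow_add]; ring
    have h := hfs.mul hgs.neg.cexp
    refine h.congr_deriv ?_
    rw [← hprod]
    simp only [hf, Pi.neg_apply]
    ring
  have hconst := Metric.isOpen_ball.is_const_of_deriv_eq_zero (convex_ball (0 : ℂ) 2).isPreconnected
    (fun s hs => (hder s hs).differentiableAt.differentiableWithinAt)
    (fun s hs => (hder s hs).deriv) (x := 1) (y := 0) (by simp) (by simp)
  have hz : ∀ c : ℕ → ℂ, ∑' n, c n * (0 : ℂ) ^ n = c 0 := fun c => by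
    rw [tsum_eq_single 0 fun n hn => by simp [hn]]; simp
  simp only [hf, hg, hz, h0, logCoeff_zero h0, one_pow, mul_one, neg_zero, Complex.exp_zero]
    at hconst
  rw [Complex.exp_neg, ← div_eq_mul_inv, div_eq_one_iff_eq (Complex.exp_ne_zero _)] at hconst
  exact hconst.symm

end Log

/-! ### Distributional derivatives -/

theorem Test.integrable_mul_deriv {F : ℝ → ℂ} (hF : LocallyIntegrable F) (φ : Test) :
    Integrable fun x => F x * deriv φ x := by
  have h := hF.integrable_smul_right_of_hasCompactSupport (g := deriv φ)
    (φ.contDiff.continuous_deriv (by simp)) φ.hasCompactSupport.deriv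
  exact h

theorem Test.integrable_mul {F : ℝ → ℂ} (hF : LocallyIntegrable F) (φ : Test) :
    Integrable fun x => F x * φ x :=
  hF.integrable_smul_right_of_hasCompactSupport φ.continuous φ.hasCompactSupport

theorem Test.exists_support_subset (φ : Test) : ∃ M : ℕ, ∀ x, φ x ≠ 0 → |x| < M := by
  obtain ⟨r, hr⟩ := φ.hasCompactSupport.isCompact.isBounded.subset_ball 0
  obtain ⟨M, hM⟩ := exists_nat_ge r
  refine ⟨M, fun x hx => ?_⟩
  have := mem_ball_zero_iff.1 (hr (subset_tsupport _ hx))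
  rw [Real.norm_eq_abs] at this
  linarith

theorem Test.integral_deriv (φ : Test) : ∫ x, deriv φ x = 0 :=
  integral_eq_zero_of_hasDerivAt_of_integrable
    (fun x => (φ.contDiff.differentiable (by simp) x).hasDerivAt)
    ((φ.contDiff.continuous_deriv (by simp)).integrable_of_hasCompactSupport
      φ.hasCompactSupport.deriv)
    (φ.continuous.integrable_of_hasCompactSupport φ.hasCompactSupport)

/-- Right continuity everywhere. -/
abbrev RightContinuous (F : ℝ → ℂ) : Prop := ∀ x, ContinuousWithinAt F (Ici x) x

/-- A deviation at one point would persist on an interval to its right, a set of positive measure.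
-/
theorem RightContinuous.eq_of_ae_eq {F : ℝ → ℂ} (hF : RightContinuous F) {c : ℂ} {α β : ℝ}
    (h : ∀ᵐ x, x ∈ Ioo α β → F x = c) {x : ℝ} (hx : x ∈ Ioo α β) : F x = c := by
  by_contra hne
  have h1 : ∀ᶠ y in 𝓝[>] x, F y ≠ c :=
    ((hF x).mono Ioi_subset_Ici_self).eventually_ne hne
  have h2 : ∀ᶠ y in 𝓝[>] x, y ∈ Ioo α β :=
    mem_nhdsWithin_of_mem_nhds (Ioo_mem_nhds hx.1 hx.2)
  obtain ⟨b, hb, hsub⟩ := mem_nhdsGT_iff_exists_Ioo_subset.1 (h1.and h2)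
  have hnull : volume (Ioo x b) = 0 :=
    measure_mono_null (fun y hy => by
      have := hsub hy
      simp only [mem_compl_iff, mem_ofPred_eq, Classical.not_imp]
      exact ⟨this.2, this.1⟩) h
  rw [Real.volume_Ioo, ENNReal.ofReal_eq_zero] at hnull
  linarith [mem_Ioi.1 hb]

/-- The du Bois-Reymond lemma: a function whose distributional derivative vanishes on an interval
is constant there. -/
theorem constant_of_distrDeriv_zero {F : ℝ → ℂ} (hF : RightContinuous F)
    (hi : LocallyIntegrable F) {α β : ℝ}
    (h : ∀ φ : Test, tsupport φ ⊆ Ioo α β → ∫ x, F x * deriv φ x = 0) {x y : ℝ}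
    (hx : x ∈ Ioo α β) (hy : y ∈ Ioo α β) : F x = F y := by
  have hαβ : α < β := hx.1.trans hx.2
  set ρ : ContDiffBump ((α + β) / 2) := ⟨(β - α) / 8, (β - α) / 4, by linarith, by linarith⟩ with hρ
  set r : ℝ → ℝ := ρ.normed volume with hr
  have hrs : ContDiff ℝ ∞ r := ρ.contDiff_normed
  have hrc : HasCompactSupport r := ρ.hasCompactSupport_normed
  have hr1 : ∫ x, r x = 1 := ρ.integral_normed
  have hrt : tsupport r ⊆ Icc ((3 * α + β) / 4) ((α + 3 * β) / 4) := by
    rw [hr, ρ.tsupport_normed_eq, Real.closedBall_eq_Icc]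
    refine Icc_subset_Icc ?_ ?_ <;> simp only [hρ] <;> linarith
  set c : ℂ := ∫ x, r x • F x with hc
  have key : ∀ g : ℝ → ℝ, ContDiff ℝ ∞ g → HasCompactSupport g → tsupport g ⊆ Ioo α β →
      ∫ x, g x • (F x - c) = 0 := by
    intro g hg hgc hgt
    have hgi : Integrable g := hg.continuous.integrable_of_hasCompactSupport hgc
    have hri : Integrable r := hrs.continuous.integrable_of_hasCompactSupport hrc
    set m := ∫ x, g x with hm
    -- Subtracting the right multiple of a unit-mass bump makes the mean vanish, so the result is
    -- the derivative of a test function supported in the same interval.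
    set ψ : ℝ → ℝ := fun x => g x - m * r x with hψ
    have hψs : ContDiff ℝ ∞ ψ := hg.sub (contDiff_const.mul hrs)
    obtain ⟨a, b, ha, hab, hb, hgab, hrab⟩ : ∃ a b, α < a ∧ a ≤ b ∧ b < β ∧
        tsupport g ⊆ Icc a b ∧ tsupport r ⊆ Icc a b := by
      set K := tsupport g ∪ Icc ((3 * α + β) / 4) ((α + 3 * β) / 4) with hK
      have hKc : IsCompact K := hgc.isCompact.union isCompact_Icc
      have hKs : K ⊆ Ioo α β := union_subset hgt fun x hx => ⟨by linarith [hx.1], by linarith [hx.2]⟩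
      have hne : K.Nonempty := ⟨(α + β) / 2, Or.inr ⟨by linarith, by linarith⟩⟩
      obtain ⟨a, haK, ha⟩ := hKc.exists_isLeast hne
      obtain ⟨b, hbK, hb⟩ := hKc.exists_isGreatest hne
      exact ⟨a, b, (hKs haK).1, ha hbK, (hKs hbK).2, fun x hx => ⟨ha (Or.inl hx), hb (Or.inl hx)⟩,
        fun x hx => ⟨ha (Or.inr (hrt hx)), hb (Or.inr (hrt hx))⟩⟩
    have hψ0 : ∀ x, x ∉ Icc a b → ψ x = 0 := fun x hx => by
      simp only [hψ]
      rw [image_eq_zero_of_notMem_tsupport fun h => hx (hgab h),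
        image_eq_zero_of_notMem_tsupport fun h => hx (hrab h)]
      simp
    have hψint : ∫ x, ψ x = 0 := by
      simp only [hψ]
      rw [integral_sub hgi (hri.const_mul m), integral_const_mul, hr1, mul_one, ← hm, sub_self]
    set Ψ : ℝ → ℝ := fun x => ∫ s in a..x, ψ s with hΨ
    have hΨd : ∀ x, HasDerivAt Ψ (ψ x) x := fun x =>
      intervalIntegral.integral_hasDerivAt_right (hψs.continuous.intervalIntegrable _ _)
        (hψs.continuous.stronglyMeasurableAtFilter _ _) hψs.continuous.continuousAt
    have hΨs : ContDiff ℝ ∞ Ψ := by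
      rw [contDiff_infty_iff_deriv]
      refine ⟨fun x => (hΨd x).differentiableAt, ?_⟩
      rw [show deriv Ψ = ψ from funext fun x => (hΨd x).deriv]
      exact hψs
    have hΨ0 : ∀ x, x ∉ Icc a b → Ψ x = 0 := by
      intro x hx
      simp only [hΨ]
      rcases lt_or_ge x a with hxa | hxa
      · rw [intervalIntegral.integral_symm, neg_eq_zero]
        refine (intervalIntegral.integral_congr_ae ?_).trans intervalIntegral.integral_zero
        have : ∀ᵐ s : ℝ, s ≠ a := by simp [ae_iff, measure_singleton]
        filter_upwards [this] with s hs hsI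
        rw [uIoc_of_le hxa.le] at hsI
        exact hψ0 s fun h => hs (le_antisymm hsI.2 h.1)
      · have hxb : b < x := not_le.1 fun h => hx ⟨hxa, h⟩
        have : ∫ s in (a - 1)..x, ψ s = 0 := by
          rw [intervalIntegral.integral_eq_integral_of_support_subset, hψint]
          intro s hs
          have : s ∈ Icc a b := by_contra fun h => hs (hψ0 s h)
          exact ⟨by linarith [this.1], by linarith [this.2]⟩
        rw [← intervalIntegral.integral_add_adjacent_intervals
          (hψs.continuous.intervalIntegrable (a - 1) a) (hψs.continuous.intervalIntegrable a x)]
          at this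
        have h0 : ∫ s in (a - 1)..a, ψ s = 0 := by
          refine (intervalIntegral.integral_congr_ae ?_).trans intervalIntegral.integral_zero
          have : ∀ᵐ s : ℝ, s ≠ a := by simp [ae_iff, measure_singleton]
          filter_upwards [this] with s hs hsI
          rw [uIoc_of_le (by linarith)] at hsI
          exact hψ0 s fun h => hs (le_antisymm hsI.2 h.1)
        rwa [h0, zero_add] at this
    have hΨt : tsupport (fun x => (Ψ x : ℂ)) ⊆ Icc a b :=
      closure_minimal (fun x hx => by_contra fun h => hx (by simp [hΨ0 x h])) isClosed_Icc
    let φ : Test := ⟨fun x => (Ψ x : ℂ), Complex.ofRealCLM.contDiff.comp hΨs,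
      HasCompactSupport.of_support_subset_isCompact isCompact_Icc ((subset_tsupport _).trans hΨt),
      fun _ _ => trivial⟩
    have hφ : ∀ x, deriv φ x = (ψ x : ℂ) := fun x => (hΨd x).ofReal_comp.deriv
    have h0 := h φ (hΨt.trans fun x hx => ⟨ha.trans_le hx.1, hx.2.trans_lt hb⟩)
    simp only [hφ, hψ] at h0
    have hgF : Integrable fun x => g x • F x :=
      hi.integrable_smul_left_of_hasCompactSupport hg.continuous hgc
    have hrF : Integrable fun x => r x • F x :=
      hi.integrable_smul_left_of_hasCompactSupport hrs.continuous hrc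
    have e1 : (fun x => F x * ((g x - m * r x : ℝ) : ℂ)) =
        fun x => g x • F x - (m : ℂ) * (r x • F x) := funext fun x => by
      simp only [Complex.real_smul]; push_cast; ring
    rw [e1, integral_sub hgF (hrF.const_mul _), integral_const_mul, ← hc] at h0
    simp_rw [smul_sub]
    rw [integral_sub hgF (hgi.smul_const c), integral_smul_const, ← hm, Complex.real_smul]
    exact h0
  have hae := isOpen_Ioo.ae_eq_zero_of_integral_contDiff_smul_eq_zero (U := Ioo α β)
    (f := fun x => F x - c) (μ := volume)
    ((hi.sub (locallyIntegrable_const c)).locallyIntegrableOn _) key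
  have hae' : ∀ᵐ x, x ∈ Ioo α β → F x = c := hae.mono fun x hx hxI => sub_eq_zero.1 (hx hxI)
  rw [hF.eq_of_ae_eq hae' hx, hF.eq_of_ae_eq hae' hy]

theorem IsPrimitive.eq_on_Ioo {F : ℝ → ℂ} {w : Distr} (hF : IsPrimitive F w) {α β : ℝ}
    (hw : ∀ φ : Test, tsupport φ ⊆ Ioo α β → w φ = 0) {x y : ℝ}
    (hx : x ∈ Ioo α β) (hy : y ∈ Ioo α β) : F x = F y :=
  constant_of_distrDeriv_zero hF.1 hF.2.1
    (fun φ hφ => by rw [← neg_eq_zero, ← hF.2.2 φ, hw φ hφ]) hx hy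

theorem IsPrimitive.unique {F G : ℝ → ℂ} {w : Distr} (hF : IsPrimitive F w)
    (hG : IsPrimitive G w) : ∃ c, ∀ x, G x = F x + c := by
  refine ⟨G 0 - F 0, fun x => ?_⟩
  have := constant_of_distrDeriv_zero (F := fun x => G x - F x) (fun x => (hG.1 x).sub (hF.1 x))
    (hG.2.1.sub hF.2.1) (α := -|x| - 1) (β := |x| + 1) (fun φ _ => ?_)
    (x := x) (y := 0) ⟨by linarith [neg_abs_le x], by linarith [le_abs_self x]⟩
    ⟨by linarith [abs_nonneg x], by linarith [abs_nonneg x]⟩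
  · linear_combination this
  · simp_rw [sub_mul]
    rw [integral_sub (φ.integrable_mul_deriv hG.2.1) (φ.integrable_mul_deriv hF.2.1)]
    have h1 := hF.2.2 φ
    have h2 := hG.2.2 φ
    linear_combination h2 - h1

theorem IsPrimitive.primitive_eq {U : ℝ → ℂ} {w : Distr} (hU : IsPrimitive U w) :
    ∃ c, ∀ x, primitive w x = U x + c := by
  have h : ∃ U, IsPrimitive U w := ⟨U, hU⟩
  have : primitive w = Classical.choose h := dif_pos h
  rw [this]
  exact hU.unique (Classical.choose_spec h)

/-- A primitive of the product of a smooth function `ψ` with `F'`. -/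
def mulPrimitive (ψ F : ℝ → ℂ) (x : ℝ) : ℂ := ψ x * F x - ∫ s in (0 : ℝ)..x, deriv ψ s * F s

theorem LocallyIntegrable.intervalIntegrable' {F : ℝ → ℂ} (hF : LocallyIntegrable F) (a b : ℝ) :
    IntervalIntegrable F volume a b :=
  (hF.integrableOn_isCompact isCompact_uIcc).intervalIntegrable

/-- Rearranged product rule: $\psi F'=(\psi F)'-\psi'F$. -/
theorem IsPrimitive.mul {F : ℝ → ℂ} {w : Distr} (hF : IsPrimitive F w) {ψ : ℝ → ℂ}
    (hψ : ContDiff ℝ ∞ ψ) : IsPrimitive (mulPrimitive ψ F) (mulDistr ψ hψ w) := by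
  have hψd : Continuous (deriv ψ) := hψ.continuous_deriv (by simp)
  have hli : LocallyIntegrable fun s => deriv ψ s * F s := by
    have := hF.2.1.continuous_smul hψd
    exact this
  have hii := LocallyIntegrable.intervalIntegrable' hli
  set P : ℝ → ℂ := fun x => ∫ s in (0 : ℝ)..x, deriv ψ s * F s with hP
  have hPc : Continuous P := intervalIntegral.continuous_primitive hii 0
  have hPd : ∀ x, HasDerivWithinAt P (deriv ψ x * F x) (Ioi x) x := fun x =>
    (intervalIntegral.integral_hasDerivWithinAt_right (s := Ici x) (t := Ioi x) (hii 0 x)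
      hli.aestronglyMeasurable.stronglyMeasurableAtFilter
      ((hψd.continuousWithinAt.mul (hF.1 x)).mono Ioi_subset_Ici_self)).mono Ioi_subset_Ici_self
  have hψF : LocallyIntegrable fun s => ψ s * F s := hF.2.1.continuous_smul hψ.continuous
  refine ⟨fun x => (hψ.continuous.continuousWithinAt.mul (hF.1 x)).sub hPc.continuousWithinAt,
    hψF.sub hPc.locallyIntegrable, fun φ => ?_⟩
  obtain ⟨M, hM⟩ := φ.exists_support_subset
  have hM0 : (0 : ℝ) ≤ M := Nat.cast_nonneg M
  have hφ0 : ∀ x : ℝ, (M : ℝ) ≤ |x| → φ x = 0 := fun x hx => by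
    by_contra h
    exact absurd (hM x h) (not_lt.2 hx)
  have hφd : ∀ x, HasDerivAt φ (deriv φ x) x := fun x =>
    (φ.contDiff.differentiable (by simp) x).hasDerivAt
  have hφdc : Continuous (deriv φ) := φ.contDiff.continuous_deriv (by simp)
  have hφd0 : ∀ x : ℝ, (M : ℝ) < |x| → deriv φ x = 0 := fun x hx => by
    have h1 : φ =ᶠ[𝓝 x] fun _ => 0 := by
      filter_upwards [continuous_abs.continuousAt.eventually (lt_mem_nhds hx)] with y hy
      exact hφ0 y (le_of_lt hy)
    rw [h1.deriv_eq, deriv_const]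
  have hfull : ∀ f : ℝ → ℂ, (∀ x : ℝ, (M : ℝ) + 1 ≤ |x| → f x = 0) →
      ∫ x, f x = ∫ x in (-(M + 1 : ℝ))..(M + 1), f x := by
    intro f hf
    rw [intervalIntegral.integral_eq_integral_of_support_subset]
    intro x hx
    have : |x| < M + 1 := not_le.1 fun h => hx (hf x h)
    exact ⟨(abs_lt.1 this).1, (abs_lt.1 this).2.le⟩
  -- Since `F` is only right continuous, `P` is only known to be right differentiable, hence this
  -- form of integration by parts.
  have hparts : ∫ x, P x * deriv φ x = -∫ x, deriv ψ x * F x * φ x := by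
    rw [hfull (fun x => P x * deriv φ x) fun x hx => by
        rw [hφd0 x (by linarith), mul_zero],
      hfull (fun x => deriv ψ x * F x * φ x) fun x hx => by
        rw [hφ0 x (by linarith), mul_zero],
      intervalIntegral.integral_mul_deriv_eq_deriv_mul_of_hasDeriv_right hPc.continuousOn
        φ.continuous.continuousOn (fun x _ => hPd x) (fun x _ => (hφd x).hasDerivWithinAt)
        (hii _ _) (hφdc.intervalIntegrable _ _),
      hφ0 (M + 1) (by rw [abs_of_nonneg (by linarith)]; linarith),
      hφ0 (-(M + 1)) (by rw [abs_neg, abs_of_nonneg (by linarith)]; linarith)]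
    ring
  have hw : mulDistr ψ hψ w φ = -∫ x, F x * deriv (mulTest ψ hψ φ) x := hF.2.2 (mulTest ψ hψ φ)
  have hd : ∀ x, deriv (mulTest ψ hψ φ) x = deriv φ x * ψ x + φ x * deriv ψ x := fun x =>
    ((hφd x).mul (hψ.differentiable (by simp) x).hasDerivAt).deriv
  have e1 : (fun x => F x * deriv (mulTest ψ hψ φ) x) =
      fun x => ψ x * F x * deriv φ x + deriv ψ x * F x * φ x := funext fun x => by
    rw [hd]; ring
  have e2 : (fun x => mulPrimitive ψ F x * deriv φ x) =
      fun x => ψ x * F x * deriv φ x - P x * deriv φ x := funext fun x => by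
    rw [mulPrimitive]; ring
  rw [hw, e1, e2, integral_add (φ.integrable_mul_deriv hψF) (φ.integrable_mul hli),
    integral_sub (φ.integrable_mul_deriv hψF) (φ.integrable_mul_deriv hPc.locallyIntegrable),
    hparts]
  ring

theorem contDiff_waveFun (ξ : ℝ) : ContDiff ℝ ∞ (wave ξ) := contDiff_wave ξ

theorem hasDerivAt_wave (ξ x : ℝ) : HasDerivAt (wave ξ) (Complex.I * ξ * wave ξ x) x := by
  have h1 : HasDerivAt (fun x : ℝ => Complex.I * ((ξ * x : ℝ) : ℂ)) (Complex.I * ξ) x := by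
    have := (((hasDerivAt_id x).const_mul ξ).ofReal_comp).const_mul Complex.I
    simpa using this
  have := h1.cexp
  rw [mul_comm] at this
  exact this

/-- Subtracting $W(x)$ under the integral absorbs the variation of the wave, and the defect is
exactly $-e^{i\xi y}\int_x^y(e^{-i\xi s})'(W(s)-W(x))\,ds$. It is the discrepancy estimate required
by `HasStieltjes.wave_mul`. -/
theorem norm_mulPrimitive_wave_sub_le {W : ℝ → ℂ} (hW : LocallyIntegrable W) (ξ : ℝ) {x y : ℝ}
    (hxy : x ≤ y) :
    ‖wave ξ y * (mulPrimitive (wave (-ξ)) W y - mulPrimitive (wave (-ξ)) W x) - (W y - W x)‖ ≤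
      |ξ| * ∫ s in x..y, ‖W s - W x‖ := by
  have hwc : ∀ ξ, Continuous (wave ξ) := fun ξ => (contDiff_waveFun ξ).continuous
  have hd : ∀ s, deriv (wave (-ξ)) s = -(Complex.I * ξ) * wave (-ξ) s := fun s => by
    rw [(hasDerivAt_wave (-ξ) s).deriv]; push_cast; ring
  have hli : LocallyIntegrable fun s => deriv (wave (-ξ)) s * W s :=
    hW.continuous_smul ((contDiff_waveFun (-ξ)).continuous_deriv (by simp))
  have hii := LocallyIntegrable.intervalIntegrable' hli
  have h1 : ∫ s in x..y, deriv (wave (-ξ)) s = wave (-ξ) y - wave (-ξ) x :=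
    intervalIntegral.integral_deriv_eq_sub
      (fun s _ => (hasDerivAt_wave (-ξ) s).differentiableAt)
      (((contDiff_waveFun (-ξ)).continuous_deriv (by simp)).intervalIntegrable _ _)
  have h2 : (∫ s in (0 : ℝ)..y, deriv (wave (-ξ)) s * W s) -
      ∫ s in (0 : ℝ)..x, deriv (wave (-ξ)) s * W s = ∫ s in x..y, deriv (wave (-ξ)) s * W s :=
    intervalIntegral.integral_interval_sub_left (hii 0 y) (hii 0 x)
  have h3 : ∫ s in x..y, deriv (wave (-ξ)) s * (W s - W x) =
      (∫ s in x..y, deriv (wave (-ξ)) s * W s) - (wave (-ξ) y - wave (-ξ) x) * W x := by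
    simp_rw [mul_sub]
    rw [intervalIntegral.integral_sub (hii x y), intervalIntegral.integral_mul_const, h1]
    exact (((contDiff_waveFun (-ξ)).continuous_deriv (by simp)).mul continuous_const).intervalIntegrable
      _ _
  have h4 : wave ξ y * (mulPrimitive (wave (-ξ)) W y - mulPrimitive (wave (-ξ)) W x) -
      (W y - W x) = -(wave ξ y * ∫ s in x..y, deriv (wave (-ξ)) s * (W s - W x)) := by
    rw [h3, ← h2]
    simp only [mulPrimitive]
    linear_combination (W y - W x) * wave_mul_wave_neg ξ y
  rw [h4, norm_neg, norm_mul, norm_wave, one_mul, ← intervalIntegral.integral_const_mul]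
  refine (intervalIntegral.norm_integral_le_integral_norm hxy).trans (le_of_eq ?_)
  refine intervalIntegral.integral_congr fun s _ => ?_
  simp only [hd, norm_mul, norm_neg, Complex.norm_I, Complex.norm_real, norm_wave,
    Real.norm_eq_abs, one_mul, mul_one]

theorem mulDistr_wave_neg_modulate (ξ : ℝ) (w : Distr) :
    mulDistr (wave (-ξ)) (contDiff_waveFun (-ξ)) (modulate ξ w) = w := by
  ext φ
  change w (mulTest _ _ (mulTest _ _ φ)) = w φ
  congr 1
  ext x
  rw [mulTest_apply, mulTest_apply]
  have := wave_mul_wave_neg ξ x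
  simp only [wave] at this ⊢
  linear_combination (φ x) * this

/-! ### Functions with an atomic decomposition as primitives -/

theorem IsU2Atom.measurable {f : ℝ → ℂ} (hf : IsU2Atom f) : Measurable f := by
  obtain ⟨κ, ψ, D, hκ, -, rfl, -⟩ := hf.exists_step
  exact (measurable_of_countable ψ).comp hκ.measurable

theorem HasAtomicDecomp.locallyIntegrable {F : ℝ → ℂ} {Λ : ℝ} (hF : HasAtomicDecomp F Λ) :
    LocallyIntegrable F := by
  obtain ⟨l, f, hf, hs, hl, hΛ⟩ := hF
  have hm : Measurable F :=
    measurable_of_tendsto_metrizable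
      (f := fun N x => ∑ j ∈ Finset.range N, l j * f j x)
      (fun N => Finset.measurable_sum _ fun j _ => (hf j).measurable.const_mul (l j))
      (tendsto_pi_nhds.2 fun x => (hs x).tendsto_sum_nat)
  refine (locallyIntegrable_const Λ).mono hm.aestronglyMeasurable (Eventually.of_forall fun x => ?_)
  have h1 := (hs x).norm_le_of_bounded hl.hasSum fun j => by
    rw [norm_mul]
    exact (mul_le_mul_of_nonneg_left ((hf j).norm_le x) (norm_nonneg _)).trans (mul_one _).le
  exact (h1.trans hΛ).trans (le_abs_self Λ)

theorem HasAtomicDecomp.isPrimitive {F : ℝ → ℂ} {Λ : ℝ} (hF : HasAtomicDecomp F Λ) {w : Distr}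
    (hw : HasDistrDeriv F w) : IsPrimitive F w :=
  ⟨NearStep.continuousWithinAt hF.nearStep, hF.locallyIntegrable, hw⟩

theorem exists_hasAtomicDecomp_of_lt {w : Distr} {Λ : ℝ} (h : du2Norm w < ENNReal.ofReal Λ) :
    ∃ F, HasAtomicDecomp F Λ ∧ IsPrimitive F w := by
  simp only [du2Norm, iInf_lt_iff] at h
  obtain ⟨F, hF, hΛ⟩ := h
  have := hasAtomicDecomp_of_lt hΛ
  exact ⟨F, this, this.isPrimitive hF⟩

/-- Almost optimal decompositions may belong to different primitives, but these differ by constants,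
which integrals do not see. So one fixed primitive inherits every bound above the infimum. -/
theorem exists_primitive_of_du2Norm {w : Distr} (h : du2Norm w ≠ ⊤) :
    ∃ F, IsPrimitive F w ∧ ∀ a b, Controlled F a b (9 * (du2Norm w).toReal) := by
  have hlt : ∀ Λ > (du2Norm w).toReal, ∃ F, HasAtomicDecomp F Λ ∧ IsPrimitive F w := fun Λ hΛ =>
    exists_hasAtomicDecomp_of_lt (by
      rw [← ENNReal.ofReal_toReal h]
      exact (ENNReal.ofReal_lt_ofReal_iff (ENNReal.toReal_nonneg.trans_lt hΛ)).2 hΛ)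
  obtain ⟨F, -, hF⟩ := hlt _ (lt_add_one _)
  refine ⟨F, hF, fun a b => Controlled.of_forall_lt fun A' hA' => ?_⟩
  obtain ⟨G, hG, hGw⟩ := hlt (A' / 9) (by linarith)
  obtain ⟨c, hc⟩ := hGw.unique hF
  have := (hG.controlled a b).congr c fun x _ => hc x
  rwa [mul_div_cancel₀ A' (by norm_num)] at this

/-! ### Gluing the local primitives -/

theorem Cutoff.exists_radius (χ : Cutoff) : ∃ R : ℕ, ∀ x, (R : ℝ) < |x| → χ.toFun x = 0 := by
  obtain ⟨r, hr⟩ := χ.compact.isCompact.isBounded.subset_ball 0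
  obtain ⟨R, hR⟩ := exists_nat_ge r
  refine ⟨R, fun x hx => ?_⟩
  by_contra h
  have := mem_ball_zero_iff.1 (hr (subset_tsupport _ h))
  rw [Real.norm_eq_abs] at this
  linarith

theorem Test.deriv_eq_zero {φ : Test} {M : ℝ} (h : ∀ x, φ x ≠ 0 → |x| < M) {x : ℝ}
    (hx : M < |x|) : deriv φ x = 0 := by
  have h1 : φ =ᶠ[𝓝 x] fun _ => 0 := by
    filter_upwards [continuous_abs.continuousAt.eventually (lt_mem_nhds hx)] with y hy
    by_contra h0
    exact absurd (h y h0) (not_lt.2 hy.le)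
  rw [h1.deriv_eq, deriv_const]

/-- The `ℓ²` norm of the local `DU²` norms. -/
theorem l2Bound_du2Norm {χ : Cutoff} {σ : ℝ} {w : Distr} (h : l2du2Norm χ σ w ≠ ⊤) :
    (∀ k, du2Norm (mulDistr (χ.at σ k) (χ.contDiff_at σ k) w) ≠ ⊤) ∧
      L2Bound (fun k => (du2Norm (mulDistr (χ.at σ k) (χ.contDiff_at σ k) w)).toReal)
        (l2du2Norm χ σ w).toReal := by
  set d : ℤ → ℝ≥0∞ := fun k => du2Norm (mulDistr (χ.at σ k) (χ.contDiff_at σ k) w) with hd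
  have hl : l2du2Norm χ σ w = (∑' k, d k ^ 2) ^ (1 / 2 : ℝ) := rfl
  have hs : ∑' k, d k ^ 2 ≠ ⊤ := by
    intro htop
    rw [hl, htop, ENNReal.top_rpow_of_pos (by norm_num)] at h
    exact h rfl
  have hfin : ∀ k, d k ≠ ⊤ := by
    intro k hk
    have := ENNReal.ne_top_of_tsum_ne_top hs k
    rw [hk] at this
    exact this (by simp)
  refine ⟨hfin, ENNReal.toReal_nonneg, fun _ => ENNReal.toReal_nonneg, fun T => ?_⟩
  have e : (l2du2Norm χ σ w).toReal ^ 2 = (∑' k, d k ^ 2).toReal := by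
    rw [hl, ← ENNReal.toReal_pow, ← ENNReal.rpow_natCast, ← ENNReal.rpow_mul]
    norm_num
  rw [e]
  calc ∑ k ∈ T, (d k).toReal ^ 2 = (∑ k ∈ T, d k ^ 2).toReal := by
        rw [ENNReal.toReal_sum fun k _ => ENNReal.pow_ne_top (hfin k)]
        exact Finset.sum_congr rfl fun k _ => (ENNReal.toReal_pow _ _).symm
    _ ≤ _ := ENNReal.toReal_mono hs (ENNReal.sum_le_tsum T)

theorem L2Bound.sum_shift {d : ℤ → ℝ} {D : ℝ} (h : L2Bound d D) (J : Finset ℤ) :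
    L2Bound (fun m => ∑ i ∈ J, d (m + i)) (J.card * D) := by
  refine ⟨mul_nonneg (Nat.cast_nonneg _) h.nonneg,
    fun m => Finset.sum_nonneg fun i _ => h.nonneg_apply _, fun T => ?_⟩
  have h1 : ∀ i, ∑ m ∈ T, d (m + i) ^ 2 ≤ D ^ 2 := fun i => by
    have := h.sum_le (T.image fun m => m + i)
    rwa [Finset.sum_image fun x _ y _ h => by simpa using h] at this
  calc ∑ m ∈ T, (∑ i ∈ J, d (m + i)) ^ 2 ≤ ∑ m ∈ T, J.card * ∑ i ∈ J, d (m + i) ^ 2 :=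
        Finset.sum_le_sum fun m _ => sq_sum_le_card_mul_sum_sq
    _ = J.card * ∑ i ∈ J, ∑ m ∈ T, d (m + i) ^ 2 := by
        rw [← Finset.mul_sum, Finset.sum_comm]
    _ ≤ J.card * ∑ i ∈ J, D ^ 2 := by
        gcongr with i
        exact h1 i
    _ = _ := by rw [Finset.sum_const, nsmul_eq_mul]; ring

theorem L2Bound.const_mul {d : ℤ → ℝ} {D c : ℝ} (h : L2Bound d D) (hc : 0 ≤ c) :
    L2Bound (fun m => c * d m) (c * D) :=
  ⟨mul_nonneg hc h.nonneg, fun m => mul_nonneg hc (h.nonneg_apply m), fun T => by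
    simp_rw [mul_pow, ← Finset.mul_sum]
    exact mul_le_mul_of_nonneg_left (h.sum_le T) (sq_nonneg c)⟩

section Glue

variable {χ : Cutoff} {σ : ℝ} {w : Distr} {R : ℕ} {F : ℤ → ℝ → ℂ}

/-- The sum of the local primitives, normalized to vanish at `0`. -/
def gluedPrimitive (F : ℤ → ℝ → ℂ) (x : ℝ) : ℂ := ∑ᶠ k, (F k x - F k 0)

theorem localPrimitive_eq (hR : ∀ x, (R : ℝ) < |x| → χ.toFun x = 0)
    (hF : ∀ k, IsPrimitive (F k) (mulDistr (χ.at σ k) (χ.contDiff_at σ k) w)) {k : ℤ} {α β : ℝ}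
    (hk : ∀ x ∈ Ioo α β, (R : ℝ) < |σ * x - k|) {x y : ℝ} (hx : x ∈ Ioo α β)
    (hy : y ∈ Ioo α β) : F k x = F k y := by
  refine (hF k).eq_on_Ioo (fun φ hφ => ?_) hx hy
  have : mulTest (χ.at σ k) (χ.contDiff_at σ k) φ = 0 := by
    ext s
    rw [mulTest_apply]
    by_cases hs : s ∈ Ioo α β
    · rw [Cutoff.at, hR _ (hk s hs)]; simp
    · rw [image_eq_zero_of_notMem_tsupport fun h => hs (hφ h), zero_mul]; rfl
  rw [mulDistr, ContinuousLinearMap.comp_apply, this, map_zero]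

/-- When the support of the `k`-th cutoff lies far from both `0` and `x`, the local primitive is
constant between them. Normalising at `0` is what makes the sum locally finite. -/
theorem gluedPrimitive_eq_sum (hσ : 0 < σ) (hR : ∀ x, (R : ℝ) < |x| → χ.toFun x = 0)
    (hF : ∀ k, IsPrimitive (F k) (mulDistr (χ.at σ k) (χ.contDiff_at σ k) w)) {M : ℕ} {x : ℝ}
    (hx : |σ * x| ≤ M) :
    gluedPrimitive F x =
      ∑ k ∈ Finset.Icc (-(R + M + 1) : ℤ) (R + M + 1), (F k x - F k 0) := by
  refine finsum_eq_sum_of_support_subset _ fun k hk => ?_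
  by_contra hkS
  have hM : (0 : ℝ) ≤ M := Nat.cast_nonneg M
  have hkb : (R : ℝ) + M + 1 < |(k : ℝ)| := by
    have : (R : ℤ) + M + 1 < |k| := by
      rw [Finset.coe_Icc, mem_Icc, ← abs_le, not_le] at hkS
      exact hkS
    exact_mod_cast this
  have hmem : ∀ y, |σ * y| ≤ M → y ∈ Ioo (-((M + 1) / σ)) ((M + 1) / σ) := by
    intro y hy
    rw [abs_le] at hy
    constructor
    · rw [← neg_div, div_lt_iff₀ hσ]; linarith
    · rw [lt_div_iff₀ hσ]; linarith
  refine hk (sub_eq_zero.2 (localPrimitive_eq hR hF (fun y hy => ?_) (hmem x hx)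
    (hmem 0 (by simp))))
  have h1 : |σ * y| < M + 1 := by
    rw [abs_lt]
    have a1 := hy.1
    have a2 := hy.2
    rw [← neg_div, div_lt_iff₀ hσ] at a1
    rw [lt_div_iff₀ hσ] at a2
    constructor <;> linarith
  have h2 := abs_sub_abs_le_abs_sub (k : ℝ) (σ * y)
  rw [abs_sub_comm] at h2
  linarith

/-- On the support of a test function finitely many cutoffs already add up to one, and the
normalising constants pair to zero with $\varphi'$. -/
theorem gluedPrimitive_isPrimitive (hσ : 0 < σ) (hR : ∀ x, (R : ℝ) < |x| → χ.toFun x = 0)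
    (hF : ∀ k, IsPrimitive (F k) (mulDistr (χ.at σ k) (χ.contDiff_at σ k) w)) :
    IsPrimitive (gluedPrimitive F) w := by
  have hsumLI : ∀ S : Finset ℤ, LocallyIntegrable fun x => ∑ k ∈ S, (F k x - F k 0) := fun S =>
    locallyIntegrable_finsetSum S fun k _ => (hF k).2.1.sub (locallyIntegrable_const _)
  have hloc : ∀ x : ℝ, ∃ M : ℕ, |σ * x| < M := fun x => exists_nat_gt _
  have hopen : ∀ M : ℕ, IsOpen {y : ℝ | |σ * y| < M} := fun M =>
    isOpen_lt (continuous_abs.comp (continuous_const.mul continuous_id)) continuous_const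
  refine ⟨fun x => ?_, fun x => ?_, fun φ => ?_⟩
  · obtain ⟨M, hM⟩ := hloc x
    have h1 : ContinuousWithinAt (fun y => ∑ k ∈ Finset.Icc (-(R + M + 1) : ℤ) (R + M + 1),
        (F k y - F k 0)) (Ici x) x :=
      tendsto_finsetSum _ fun k _ => ((hF k).1 x).sub continuousWithinAt_const
    refine h1.congr_of_eventuallyEq ?_ (gluedPrimitive_eq_sum hσ hR hF hM.le)
    filter_upwards [mem_nhdsWithin_of_mem_nhds ((hopen M).mem_nhds hM)] with y hy
    exact gluedPrimitive_eq_sum hσ hR hF (le_of_lt hy)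
  · obtain ⟨M, hM⟩ := hloc x
    obtain ⟨s, hs, hi⟩ := hsumLI (Finset.Icc (-(R + M + 1) : ℤ) (R + M + 1)) x
    refine ⟨s ∩ {y : ℝ | |σ * y| < M}, inter_mem hs ((hopen M).mem_nhds hM), ?_⟩
    refine (hi.mono_set inter_subset_left).congr ?_
    refine ae_mono (Measure.restrict_mono inter_subset_right le_rfl)
      ((ae_restrict_mem (hopen M).measurableSet).mono fun y hy => ?_)
    exact (gluedPrimitive_eq_sum hσ hR hF (le_of_lt hy)).symm
  · obtain ⟨M', hM'⟩ := φ.exists_support_subset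
    obtain ⟨M, hM⟩ := exists_nat_ge (σ * M')
    have hb : ∀ x : ℝ, |x| ≤ M' → |σ * x| ≤ M := fun x hx => by
      rw [abs_mul, abs_of_pos hσ]
      exact (mul_le_mul_of_nonneg_left hx hσ.le).trans hM
    set S := Finset.Icc (-(R + M + 1) : ℤ) (R + M + 1) with hS
    have e1 : (fun x => gluedPrimitive F x * deriv φ x) =
        fun x => ∑ k ∈ S, (F k x * deriv φ x - F k 0 * deriv φ x) := by
      funext x
      rcases le_or_gt |x| M' with hx | hx
      · rw [gluedPrimitive_eq_sum hσ hR hF (hb x hx), Finset.sum_mul]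
        exact Finset.sum_congr rfl fun k _ => by ring
      · simp [Test.deriv_eq_zero hM' hx]
    have hint : ∀ k, ∫ x, (F k x * deriv φ x - F k 0 * deriv φ x) =
        -mulDistr (χ.at σ k) (χ.contDiff_at σ k) w φ := fun k => by
      rw [integral_sub (φ.integrable_mul_deriv (hF k).2.1)
        (φ.integrable_mul_deriv (locallyIntegrable_const _)), integral_const_mul,
        φ.integral_deriv, (hF k).2.2 φ]
      ring
    have hφ : ∑ k ∈ S, mulTest (χ.at σ k) (χ.contDiff_at σ k) φ = φ := by
      ext x
      have e2 : (∑ k ∈ S, mulTest (χ.at σ k) (χ.contDiff_at σ k) φ) x =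
          ∑ k ∈ S, φ x * χ.at σ k x := by
        have : ∀ T : Finset ℤ, (∑ k ∈ T, mulTest (χ.at σ k) (χ.contDiff_at σ k) φ) x =
            ∑ k ∈ T, φ x * χ.at σ k x := by
          intro T
          induction T using Finset.induction_on with
          | empty => rfl
          | insert k T hk ih =>
            rw [Finset.sum_insert hk, Finset.sum_insert hk, ← ih]; rfl
        exact this S
      rw [e2, ← Finset.mul_sum]
      by_cases hx : φ x = 0
      · rw [hx, zero_mul]
      · have h1 : ∑ k ∈ S, χ.toFun (σ * x - k) = 1 := by
          rw [← χ.sum_one (σ * x)]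
          symm
          refine finsum_eq_sum_of_support_subset _ fun k hk => ?_
          by_contra hkS
          have hkb : (R : ℝ) + M + 1 < |(k : ℝ)| := by
            have : (R : ℤ) + M + 1 < |k| := by
              rw [hS, Finset.coe_Icc, mem_Icc, ← abs_le, not_le] at hkS
              exact hkS
            exact_mod_cast this
          refine hk (hR _ ?_)
          have h2 := abs_sub_abs_le_abs_sub (k : ℝ) (σ * x)
          rw [abs_sub_comm] at h2
          linarith [hb x (hM' x hx).le]
        have h2 : ∑ k ∈ S, χ.at σ k x = 1 := by
          simp only [Cutoff.at]
          rw [← Complex.ofReal_sum, h1, Complex.ofReal_one]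
        rw [h2, mul_one]
    rw [e1, integral_finsetSum]
    · rw [Finset.sum_congr rfl fun k _ => hint k, Finset.sum_neg_distrib, neg_neg]
      conv_lhs => rw [← hφ, map_sum]
      rfl
    · intro k _
      exact (φ.integrable_mul_deriv (hF k).2.1).sub
        (φ.integrable_mul_deriv (locallyIntegrable_const _))

/-- Only local primitives with $k-m$ in a fixed window vary on this interval. Two cells are covered
because a shorter cell, as used for the second claim, can straddle a cell boundary. -/
theorem gluedPrimitive_controlled (hσ : 0 < σ) (hR : ∀ x, (R : ℝ) < |x| → χ.toFun x = 0)
    (hF : ∀ k, IsPrimitive (F k) (mulDistr (χ.at σ k) (χ.contDiff_at σ k) w)) {d : ℤ → ℝ}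
    (hd0 : ∀ k, 0 ≤ d k) (hd : ∀ k a b, Controlled (F k) a b (d k)) (m : ℤ) :
    Controlled (gluedPrimitive F) (m / σ) ((m + 2) / σ)
      (∑ i ∈ Finset.Icc (-(R + 1) : ℤ) (R + 3), d (m + i)) := by
  classical
  set J := Finset.Icc (-(R + 1) : ℤ) (R + 3) with hJ
  obtain ⟨M, hM⟩ := exists_nat_ge (|(m : ℝ)| + 2)
  set S := Finset.Icc (-(R + M + 1) : ℤ) (R + M + 1) with hS
  have h1 : Controlled (fun x => ∑ k ∈ S, (F k x - F k 0)) (m / σ) ((m + 2) / σ)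
      (∑ k ∈ S, if k - m ∈ J then d k else 0) := by
    refine Controlled.sum S fun k _ => ?_
    split_ifs with hk
    · exact (hd k _ _).congr (-F k 0) fun x _ => by ring
    · refine (Controlled.const 0 _ _).congr (F k (m / σ) - F k 0) fun x hx => ?_
      have hk' : (k : ℝ) + R + 2 ≤ m ∨ (m : ℝ) + R + 4 ≤ k := by
        rw [hJ, Finset.mem_Icc] at hk
        have : k + R + 2 ≤ m ∨ m + R + 4 ≤ k := by omega
        exact_mod_cast this
      have e : F k x = F k (m / σ) := by
        refine localPrimitive_eq hR hF (α := (m - 1) / σ) (β := (m + 3) / σ) (fun y hy => ?_) ?_ ?_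
        · have a1 := (div_lt_iff₀ hσ).1 hy.1
          have a2 := (lt_div_iff₀ hσ).1 hy.2
          rw [lt_abs]
          rcases hk' with h | h
          · left; linarith
          · right; linarith
        · exact ⟨lt_of_lt_of_le (by gcongr; linarith) hx.1,
            lt_of_le_of_lt hx.2 (by gcongr; norm_num)⟩
        · exact ⟨by gcongr; linarith, by gcongr; linarith⟩
      rw [e, zero_add]
  refine (h1.congr 0 fun x hx => ?_).mono le_rfl le_rfl ?_
  · rw [add_zero]
    refine gluedPrimitive_eq_sum hσ hR hF ?_
    have a1 := (div_le_iff₀ hσ).1 hx.1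
    have a2 := (le_div_iff₀ hσ).1 hx.2
    rw [abs_le]
    have := neg_abs_le (m : ℝ)
    have := le_abs_self (m : ℝ)
    constructor <;> linarith
  · rw [← Finset.sum_filter]
    have e : ∑ i ∈ J, d (m + i) = ∑ k ∈ J.image (fun i => m + i), d k := by
      rw [Finset.sum_image fun x _ y _ h => by simpa using h]
    rw [e]
    refine Finset.sum_le_sum_of_subset_of_nonneg (fun k hk => ?_) fun k _ _ => hd0 k
    exact Finset.mem_image.2 ⟨k - m, (Finset.mem_filter.1 hk).2, by ring⟩

end Glue

/-- A distribution with finite `l²_σ DU²` norm has a primitive which is controlled on intervals of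
length `2/σ`, with square summable constants. -/
theorem exists_controlled_primitive (χ : Cutoff) : ∃ N : ℝ, 0 ≤ N ∧ ∀ σ > 0, ∀ w : Distr,
    l2du2Norm χ σ w ≠ ⊤ → ∃ (W : ℝ → ℂ) (A : ℤ → ℝ), IsPrimitive W w ∧
      (∀ m : ℤ, Controlled W (m / σ) ((m + 2) / σ) (A m)) ∧
      L2Bound A (N * (l2du2Norm χ σ w).toReal) := by
  obtain ⟨R, hR⟩ := χ.exists_radius
  set J := Finset.Icc (-(R + 1) : ℤ) (R + 3) with hJ
  refine ⟨J.card * 9, by positivity, fun σ hσ w hw => ?_⟩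
  obtain ⟨hfin, hl2⟩ := l2Bound_du2Norm hw
  choose F hF hd using fun k => exists_primitive_of_du2Norm (hfin k)
  have h9 := (hl2.const_mul (c := 9) (by norm_num))
  refine ⟨gluedPrimitive F, _, gluedPrimitive_isPrimitive hσ hR hF,
    gluedPrimitive_controlled hσ hR hF (fun k => h9.nonneg_apply k) hd, ?_⟩
  rw [mul_assoc]
  exact h9.sum_shift J

/-! ### Local bounds at the frequency `Re z` and the scale `Im z` -/

/-- A controlled primitive of the modulated distribution is demodulated to a primitive of `u`. The
change of integrator then transfers its bounds without loss. -/
theorem exists_locallyBounded (χ : Cutoff) : ∃ N : ℝ, 0 ≤ N ∧ ∀ σ > 0, ∀ (ξ : ℝ) (u : Distr),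
    l2du2Norm χ σ (modulate ξ u) ≠ ⊤ → (∃ U, IsPrimitive U u) ∧
      ∃ A, LocallyBounded (primitive u) ξ σ A ∧
        L2Bound A (N * (l2du2Norm χ σ (modulate ξ u)).toReal) := by
  obtain ⟨N, hN, H⟩ := exists_controlled_primitive χ
  refine ⟨N, hN, fun σ hσ ξ u hu => ?_⟩
  obtain ⟨W, A, hW, hC, hA⟩ := H σ hσ _ hu
  have hU : IsPrimitive (mulPrimitive (wave (-ξ)) W) u := by
    have := hW.mul (contDiff_waveFun (-ξ))
    rwa [mulDistr_wave_neg_modulate] at this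
  obtain ⟨c, hc⟩ := hU.primitive_eq
  refine ⟨⟨_, hU⟩, A, fun m a b h1 h2 h3 h C hh => ?_, hA⟩
  have hCm := (hC m).mono h1 (h3.trans (by gcongr; norm_num)) le_rfl
  obtain ⟨I, hI, hIb⟩ := hCm.integral a b le_rfl h2 le_rfl h C hh
  refine ⟨I, ?_, hIb⟩
  exact (HasStieltjes.wave_mul h2 hCm.nearStep
    (fun x _ y _ hxy => norm_mulPrimitive_wave_sub_le hW.2.1 ξ hxy)
    (LocallyIntegrable.intervalIntegrable' hW.2.1 a b) hh.bound hI).congr h2 (fun _ _ => rfl) c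
      fun x _ => hc x

/-! ### From unit scale to finer scales at comparable frequency -/

theorem HasStieltjes.indicator {g U : ℝ → ℂ} {a b a₀ b₀ : ℝ} {I : ℂ} (h : HasStieltjes g U a b I)
    (ha : a₀ ≤ a) (hab : a ≤ b) (hb : b ≤ b₀) :
    HasStieltjes ((Ioc a b).indicator g) U a₀ b₀ I := by
  have hz : ∀ {p q : ℝ}, p ≤ q → (∀ x ∈ Ioc p q, x ∉ Ioc a b) →
      HasStieltjes ((Ioc a b).indicator g) U p q 0 := by
    intro p q hpq hx
    have h0 : HasStieltjes (fun _ => 0) U p q 0 :=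
      Tendsto.congr (fun P => by simp [stieltjesSum]) tendsto_const_nhds
    exact h0.congr hpq (fun x hxI => indicator_of_notMem (hx x hxI) g) 0 fun _ _ => by simp
  have h1 := hz ha fun x hx hx' => absurd hx'.1 (not_lt.2 hx.2)
  have h2 := hz hb fun x hx hx' => absurd hx.1 (not_lt.2 hx'.2)
  have h3 : HasStieltjes ((Ioc a b).indicator g) U a b I :=
    h.congr hab (fun x hx => indicator_of_mem hx g) 0 fun _ _ => by simp
  have := (h1.trans ha hab h3).trans (ha.trans hab) hb h2
  rwa [zero_add, add_zero] at this

/-- On a cell of length $1/\sigma$ the phase moves by at most $|\xi|/\sigma\le2$. -/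
theorem V2.wave {ξ σ : ℝ} (hσ : 0 < σ) (hξ : |ξ| ≤ 2 * σ) (m : ℤ) :
    V2 (wave ξ) (Ioc (m / σ) ((m + 1) / σ)) 2 := by
  have hlip : ∀ x y, x ≤ y → ‖AKNS.wave ξ y - AKNS.wave ξ x‖ ≤ |ξ| * y - |ξ| * x := by
    intro x y hxy
    have := (convex_univ (𝕜 := ℝ) (E := ℝ)).norm_image_sub_le_of_norm_hasDerivWithin_le
      (C := |ξ|) (fun x _ => (hasDerivAt_wave ξ x).hasDerivWithinAt)
      (fun x _ => by simp [norm_wave]) (mem_univ x) (mem_univ y)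
    rwa [Real.norm_eq_abs, abs_of_nonneg (sub_nonneg.2 hxy), mul_sub] at this
  refine V2.of_dominated (fun x => |ξ| * x) zero_le_two
    (fun x _ => by rw [norm_wave]; norm_num) (fun x _ y _ => hlip x y) fun x hx y hy hxy => ?_
  have h1 : y - x ≤ 1 / σ := by
    have : ((m : ℝ) + 1) / σ = m / σ + 1 / σ := add_div _ _ _
    linarith [hx.1, hy.2]
  have h2 : |ξ| * (y - x) ≤ 2 * σ * (1 / σ) :=
    mul_le_mul hξ h1 (sub_nonneg.2 hxy) (by linarith)
  rw [mul_assoc, mul_one_div_cancel hσ.ne', mul_one] at h2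
  linarith

/-- The cells `(m/σ, (m+1)/σ]` are the fibres of a monotone function. -/
theorem mem_cell_iff {σ : ℝ} (hσ : 0 < σ) (m : ℤ) (x : ℝ) :
    x ∈ Ioc ((m : ℝ) / σ) ((m + 1) / σ) ↔ ⌈σ * x⌉ - 1 = m := by
  rw [mem_Ioc, div_lt_iff₀ hσ, le_div_iff₀ hσ, sub_eq_iff_eq_add, Int.ceil_eq_iff, mul_comm x]
  push_cast
  rw [add_sub_cancel_right]

section Refine

variable {U : ℝ → ℂ} {ξ σ : ℝ}

/-- The values of the integrals over the `m`-th cell against normalized functions. -/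
def cellValues (U : ℝ → ℂ) (ξ σ : ℝ) (m : ℤ) : Set ℝ :=
  {r | ∃ (h : ℝ → ℂ) (I : ℂ), V2 h (Ioc (m / σ) ((m + 1) / σ)) 1 ∧
    HasStieltjes (fun x => wave ξ x * h x) U (m / σ) ((m + 1) / σ) I ∧ r = ‖I‖}

/-- The smallest constant for integrals over the `m`-th cell. -/
def cellConst (U : ℝ → ℂ) (ξ σ : ℝ) (m : ℤ) : ℝ := sSup (cellValues U ξ σ m)

theorem zero_mem_cellValues (U : ℝ → ℂ) (ξ σ : ℝ) (m : ℤ) : 0 ∈ cellValues U ξ σ m :=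
  ⟨fun _ => 0, 0, V2.zero _ zero_le_one,
    Tendsto.congr (fun P => by simp [stieltjesSum]) tendsto_const_nhds, by simp⟩

variable {A : ℤ → ℝ} (hσ : 1 ≤ σ) (hξ : |ξ| ≤ 2 * σ)
  (hU : ∀ k : ℤ, Controlled U k (k + 2) (A k))

theorem cell_subset {σ : ℝ} (hσ : 1 ≤ σ) (m : ℤ) :
    ((⌊(m : ℝ) / σ⌋ : ℤ) : ℝ) ≤ m / σ ∧ (m : ℝ) / σ ≤ (m + 1) / σ ∧
      ((m : ℝ) + 1) / σ ≤ (⌊(m : ℝ) / σ⌋ : ℤ) + 2 := by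
  have h0 : 0 < σ := by linarith
  have h1 : ((m : ℝ) + 1) / σ = m / σ + 1 / σ := add_div _ _ _
  have h2 : 1 / σ ≤ 1 := (div_le_one h0).2 hσ
  have h3 : 0 < 1 / σ := by positivity
  have h4 := Int.floor_le ((m : ℝ) / σ)
  have h5 := Int.lt_floor_add_one ((m : ℝ) / σ)
  refine ⟨h4, ?_, ?_⟩ <;> linarith

include hσ hξ hU in
theorem bddAbove_cellValues (m : ℤ) : BddAbove (cellValues U ξ σ m) := by
  refine ⟨4 * A ⌊(m : ℝ) / σ⌋, ?_⟩
  rintro r ⟨h, I, hh, hI, rfl⟩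
  obtain ⟨h1, h2, h3⟩ := cell_subset hσ m
  obtain ⟨J, hJ, hJb⟩ := (hU _).integral _ _ h1 h2 h3 _ _
    ((V2.wave (by linarith) hξ m).mul hh)
  rw [hI.unique hJ]
  linarith

-- The supremum refers to functions on the full cell. A function on a subinterval is extended by
-- zero, which costs the factor 3.
include hσ hξ hU in
theorem locallyBounded_cellConst :
    LocallyBounded U ξ σ (fun m => 3 * cellConst U ξ σ m) := by
  intro m a b ha hab hb h C hh
  have hσ0 : 0 < σ := by linarith
  obtain ⟨h1, h2, h3⟩ := cell_subset hσ m
  obtain ⟨I, hI, -⟩ := (hU _).integral a b (h1.trans ha) hab (hb.trans h3) _ _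
    (((V2.wave hσ0 hξ m).mono (Ioc_subset_Ioc ha hb) le_rfl).mul hh)
  refine ⟨I, hI, ?_⟩
  rcases hh.nonneg.eq_or_lt with h0 | h0
  · have hz : HasStieltjes (fun _ => 0) U a b 0 :=
      Tendsto.congr (fun P => by simp [stieltjesSum]) tendsto_const_nhds
    have : I = 0 := hI.unique <| hz.congr hab (fun x hx => by
      have := hh.bound x hx
      rw [← h0] at this
      rw [norm_le_zero_iff.1 this, mul_zero]) 0 fun _ _ => by simp
    rw [this, ← h0]; simp
  · have h3C : (0 : ℝ) < 3 * C := by linarith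
    set c : ℂ := ((3 * C : ℝ) : ℂ)⁻¹ with hc
    have hcn : ‖c‖ = (3 * C)⁻¹ := by
      rw [hc, norm_inv, Complex.norm_real, Real.norm_eq_abs, abs_of_pos h3C]
    have hV : V2 (fun x => c * (Ioc a b).indicator h x) (Ioc (m / σ) ((m + 1) / σ)) 1 := by
      refine ((hh.indicator.mono (subset_univ _) le_rfl).const_mul c).mono subset_rfl ?_
      rw [hcn, inv_mul_cancel₀ h3C.ne']
    have hS : HasStieltjes (fun x => wave ξ x * (c * (Ioc a b).indicator h x)) U (m / σ)
        ((m + 1) / σ) (c * I) := by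
      have := (hI.indicator ha hab hb).mul_left c
      refine this.congr h2 (fun x _ => ?_) 0 fun _ _ => by simp
      by_cases hx : x ∈ Ioc a b
      · rw [indicator_of_mem hx, indicator_of_mem hx]; ring
      · rw [indicator_of_notMem hx, indicator_of_notMem hx]; ring
    have hle : ‖c * I‖ ≤ cellConst U ξ σ m :=
      le_csSup (bddAbove_cellValues hσ hξ hU m) ⟨_, _, hV, hS, rfl⟩
    rw [norm_mul, hcn, inv_mul_le_iff₀ h3C] at hle
    linarith

-- Duality across cells. Choose on each small cell a function realising at least half of the
-- supremum. An $\ell^2$ normalised combination of these, with the wave included, has 2-variation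
-- constant 12 on $[k,k+2]$, so the values of the integrals have $\ell^2$ norm at most $12A_k$. The
-- half turns 12 into 24.
include hσ hξ hU in
theorem sum_sq_cellConst_le (k : ℤ) (S : Finset ℤ) (hS : ∀ m ∈ S, ⌊(m : ℝ) / σ⌋ = k) :
    ∑ m ∈ S, cellConst U ξ σ m ^ 2 ≤ (24 * A k) ^ 2 := by
  classical
  have hσ0 : 0 < σ := by linarith
  have hex : ∀ m : ℤ, ∃ (h : ℝ → ℂ) (I : ℂ), V2 h (Ioc (m / σ) ((m + 1) / σ)) 1 ∧
      HasStieltjes (fun x => wave ξ x * h x) U (m / σ) ((m + 1) / σ) I ∧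
      cellConst U ξ σ m ≤ 2 * ‖I‖ ∧ 0 ≤ cellConst U ξ σ m := by
    intro m
    have h0 : 0 ≤ cellConst U ξ σ m :=
      le_csSup (bddAbove_cellValues hσ hξ hU m) (zero_mem_cellValues U ξ σ m)
    rcases h0.eq_or_lt with h | h
    · obtain ⟨g, I, hg, hI, -⟩ := zero_mem_cellValues U ξ σ m
      exact ⟨g, I, hg, hI, by rw [← h]; positivity, h0⟩
    · obtain ⟨r, ⟨g, I, hg, hI, rfl⟩, hr⟩ := exists_lt_of_lt_csSup
        ⟨0, zero_mem_cellValues U ξ σ m⟩ (half_lt_self h)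
      change cellConst U ξ σ m / 2 < ‖I‖ at hr
      exact ⟨g, I, hg, hI, by linarith, h0⟩
  choose h I hh hI hle h0 using hex
  have hA : 0 ≤ 12 * A k ∧ ∑ m ∈ S, ‖I m‖ ^ 2 ≤ (12 * A k) ^ 2 := by
    have key : ∀ c : ℤ → ℂ, ∑ m ∈ S, ‖c m‖ ^ 2 ≤ 1 → ‖∑ m ∈ S, c m * I m‖ ≤ 12 * A k := by
      intro c hc
      set g : ℝ → ℂ := fun x => ∑ m ∈ S,
        c m * (Ioc ((m : ℝ) / σ) ((m + 1) / σ)).indicator (fun x => wave ξ x * h m x) x with hg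
      have hgI : HasStieltjes g U k (k + 2) (∑ m ∈ S, c m * I m) := by
        refine HasStieltjes.sum_left S fun m hm => HasStieltjes.mul_left ?_ (c m)
        obtain ⟨h1, h2, h3⟩ := cell_subset hσ m
        rw [hS m hm] at h1 h3
        exact (hI m).indicator h1 h2 h3
      have hκ : Monotone fun x : ℝ => ⌈σ * x⌉ - 1 := fun x y hxy =>
        sub_le_sub_right (Int.ceil_mono (mul_le_mul_of_nonneg_left hxy hσ0.le)) 1
      -- On one cell the product of wave and normalised function has constant $2\cdot2\cdot1=4$;
      -- joining the cells contributes 3.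
      have hgV : V2 g (Ioc k (k + 2)) (3 * 4) := by
        refine V2.of_fibres (hκ.monotoneOn _) (C := fun m => if m ∈ S then ‖c m‖ * 4 else 0)
          (by norm_num) (fun m => ?_) fun T => ?_
        · have hgm : ∀ x ∈ Ioc (k : ℝ) (k + 2) ∩ (fun x : ℝ => ⌈σ * x⌉ - 1) ⁻¹' {m}, g x =
              if m ∈ S then c m * (wave ξ x * h m x) else 0 := by
            rintro x ⟨-, hx⟩
            have hx : ⌈σ * x⌉ - 1 = m := hx
            rw [← Finset.sum_ite_eq S m fun m => c m * (wave ξ x * h m x)]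
            refine Finset.sum_congr rfl fun m' _ => ?_
            split_ifs with he
            · subst he
              rw [indicator_of_mem ((mem_cell_iff hσ0 _ x).2 hx)]
            · rw [indicator_of_notMem fun hmem => he (hx.symm.trans ((mem_cell_iff hσ0 _ x).1 hmem)),
                mul_zero]
          split_ifs with hm
          · have hsub : Ioc (k : ℝ) (k + 2) ∩ (fun x : ℝ => ⌈σ * x⌉ - 1) ⁻¹' {m} ⊆
                Ioc ((m : ℝ) / σ) ((m + 1) / σ) := fun x hx => (mem_cell_iff hσ0 m x).2 hx.2
            refine (((((V2.wave hσ0 hξ m).mul (hh m)).const_mul (c m)).mono hsub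
              (by norm_num)).congr fun x hx => ?_)
            rw [hgm x hx, if_pos hm]
          · exact (V2.zero _ le_rfl).congr fun x hx => by rw [hgm x hx, if_neg hm]
        · have e : ∀ m, (if m ∈ S then ‖c m‖ * 4 else 0) ^ 2 =
              if m ∈ S then 16 * ‖c m‖ ^ 2 else 0 := fun m => by
            split_ifs <;> ring
          simp only [e]
          rw [← Finset.sum_filter, ← Finset.mul_sum]
          have : ∑ m ∈ T.filter (· ∈ S), ‖c m‖ ^ 2 ≤ ∑ m ∈ S, ‖c m‖ ^ 2 :=
            Finset.sum_le_sum_of_subset_of_nonneg (fun m hm => (Finset.mem_filter.1 hm).2)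
              fun _ _ _ => by positivity
          linarith
      obtain ⟨J, hJ, hJb⟩ := (hU k).integral k (k + 2) le_rfl (by linarith) le_rfl g _ hgV
      rw [hgI.unique hJ]
      linarith
    refine ⟨(norm_nonneg _).trans (key (fun _ => 0) (by simp)), sum_sq_le_of_dual S I key⟩
  calc ∑ m ∈ S, cellConst U ξ σ m ^ 2 ≤ ∑ m ∈ S, 4 * ‖I m‖ ^ 2 := by
        refine Finset.sum_le_sum fun m _ => ?_
        have := pow_le_pow_left₀ (h0 m) (hle m) 2
        linarith
    _ ≤ (24 * A k) ^ 2 := by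
        rw [← Finset.mul_sum]
        linarith [hA.2]

include hσ hξ hU in
theorem l2Bound_cellConst {a : ℝ} (hA : L2Bound A a) :
    L2Bound (fun m => 3 * cellConst U ξ σ m) (3 * (24 * a)) := by
  refine L2Bound.const_mul ⟨mul_nonneg (by norm_num) hA.nonneg, fun m =>
    le_csSup (bddAbove_cellValues hσ hξ hU m) (zero_mem_cellValues U ξ σ m), fun T => ?_⟩
    (by norm_num)
  rw [← Finset.sum_fiberwise_of_maps_to (g := fun m : ℤ => ⌊(m : ℝ) / σ⌋)
    (t := T.image fun m : ℤ => ⌊(m : ℝ) / σ⌋) fun m hm => Finset.mem_image_of_mem _ hm]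
  refine (Finset.sum_le_sum fun k _ => sum_sq_cellConst_le hσ hξ hU k _ fun m hm =>
    (Finset.mem_filter.1 hm).2).trans ?_
  simp_rw [mul_pow]
  rw [← Finset.mul_sum]
  exact mul_le_mul_of_nonneg_left (hA.sum_le _) (by norm_num)

end Refine

/-- The constant `N` is uniform over the allowed frequencies and scales, which is the source of
uniformity in $z$. The factor is $72=3\cdot24$. -/
theorem exists_locallyBounded_of_unit_scale (χ : Cutoff) : ∃ N : ℝ, 0 ≤ N ∧ ∀ u : Distr,
    l2du2Norm χ 1 u ≠ ⊤ → (∃ U, IsPrimitive U u) ∧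
      ∀ ξ σ : ℝ, 1 ≤ σ → |ξ| ≤ 2 * σ → ∃ A, LocallyBounded (primitive u) ξ σ A ∧
        L2Bound A (N * (l2du2Norm χ 1 u).toReal) := by
  obtain ⟨N, hN, H⟩ := exists_controlled_primitive χ
  refine ⟨72 * N, by linarith, fun u hu => ?_⟩
  obtain ⟨W, A, hW, hC, hA⟩ := H 1 one_pos u hu
  obtain ⟨c, hc⟩ := hW.primitive_eq
  have hU : ∀ k : ℤ, Controlled (primitive u) k (k + 2) (A k) := fun k => by
    have := (hC k).congr c fun x _ => hc x
    simpa only [div_one] using this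
  refine ⟨⟨W, hW⟩, fun ξ σ hσ hξ => ⟨_, locallyBounded_cellConst hσ hξ hU, ?_⟩⟩
  have := l2Bound_cellConst hσ hξ hU hA
  rwa [show 3 * (24 * (N * (l2du2Norm χ 1 u).toReal)) = 72 * N * (l2du2Norm χ 1 u).toReal by ring]
    at this

/-! ### Joint bounds for $T_{2j}$ and $\tilde T_{2j}$, and the two claims -/

theorem T_zero (z : ℂ) (u v : Distr) : T z u v 0 = 1 := rfl

theorem Ttilde_eq_logCoeff (z : ℂ) (u v : Distr) (j : ℕ) :
    Ttilde z u v j = logCoeff (T z u v) j := rfl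

theorem one_add_sum_Icc {t : ℕ → ℂ} (h0 : t 0 = 1) (N : ℕ) :
    1 + ∑ j ∈ Finset.Icc 1 N, t j = ∑ j ∈ Finset.range (N + 1), t j := by
  rw [Finset.range_eq_Ico, Finset.sum_eq_sum_Ico_succ_bot (Nat.succ_pos N), h0]
  rfl

theorem norm_T_add_norm_Ttilde_le {z : ℂ} {u v : Distr} {q : ℝ} (hq : 0 ≤ q)
    (hT : ∀ j, ‖T z u v j‖ ≤ q ^ j) {j : ℕ} (hj : 1 ≤ j) :
    ‖T z u v j‖ + ‖Ttilde z u v j‖ ≤ (3 * q) ^ j := by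
  have h1 := norm_logCoeff_le (T_zero z u v) hq hT j
  rw [← Ttilde_eq_logCoeff] at h1
  have h2 : (1 : ℝ) + 2 ^ j ≤ 3 ^ j := by
    have := pow_add_pow_le (zero_le_one (α := ℝ)) (zero_le_two (α := ℝ)) (by omega : j ≠ 0)
    rw [one_pow] at this
    norm_num at this ⊢
    exact this
  calc ‖T z u v j‖ + ‖Ttilde z u v j‖ ≤ q ^ j + (2 * q) ^ j := add_le_add (hT j) h1
    _ = (1 + 2 ^ j) * q ^ j := by rw [mul_pow]; ring
    _ ≤ 3 ^ j * q ^ j := mul_le_mul_of_nonneg_right h2 (pow_nonneg hq j)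
    _ = (3 * q) ^ j := (mul_pow _ _ _).symm

end AKNS

end

theorem proposition5p11 (χ : AKNS.Cutoff) :
    (∃ c : ℝ, 0 < c ∧ ∀ (z : ℂ), 0 < z.im → ∀ (u v : AKNS.Distr),
      AKNS.l2du2Norm χ z.im (AKNS.modulate (2 * z.re) u) ≠ ⊤ →
      AKNS.l2du2Norm χ z.im (AKNS.modulate (2 * z.re) v) ≠ ⊤ →
      AKNS.IteratedIntegralsExist z u v ∧
      ∀ j : ℕ, 1 ≤ j →
        ‖AKNS.T z u v j‖ + ‖AKNS.Ttilde z u v j‖ ≤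
          (c * (AKNS.l2du2Norm χ z.im (AKNS.modulate (2 * z.re) u)).toReal) ^ j *
          (c * (AKNS.l2du2Norm χ z.im (AKNS.modulate (2 * z.re) v)).toReal) ^ j) ∧
    (∃ δ : ℝ, 0 < δ ∧ ∀ (u v : AKNS.Distr),
      AKNS.l2du2Norm χ 1 u ≤ ENNReal.ofReal δ →
      AKNS.l2du2Norm χ 1 v ≤ ENNReal.ofReal δ →
      (∀ z : ℂ, 1 + |z.re| ≤ z.im → AKNS.IteratedIntegralsExist z u v) ∧
      ∃ F G : ℂ → ℂ,
        TendstoUniformlyOn (fun (N : ℕ) z => 1 + ∑ j ∈ Finset.Icc 1 N, AKNS.T z u v j) F atTop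
          {z : ℂ | 1 + |z.re| ≤ z.im} ∧
        TendstoUniformlyOn (fun (N : ℕ) z => ∑ j ∈ Finset.Icc 1 N, AKNS.Ttilde z u v j) G atTop
          {z : ℂ | 1 + |z.re| ≤ z.im} ∧
        ∀ z : ℂ, 1 + |z.re| ≤ z.im → Complex.exp (G z) = F z) := by
  have hK := AKNS.kernelConst_nonneg
  constructor
  · obtain ⟨N, hN, H⟩ := AKNS.exists_locallyBounded χ
    set K := 3 * (AKNS.kernelConst * N ^ 2) with hKdef
    have hK0 : 0 ≤ K := by positivity
    -- Each of the two factors carries the constant, so $K\le(1+K)^2$ suffices; adding one also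
    -- makes it positive.
    refine ⟨1 + K, by linarith, fun z hz u v hu hv => ?_⟩
    obtain ⟨hUu, B, hB, hBl⟩ := H z.im hz (2 * z.re) u hu
    obtain ⟨hVv, A, hA, hAl⟩ := H z.im hz (2 * z.re) v hv
    have hb : AKNS.KernelBounds z (AKNS.primitive u) (AKNS.primitive v) A B _ _ :=
      ⟨hz, hA, hB, hAl, hBl⟩
    refine ⟨hb.iteratedIntegralsExist hUu hVv, fun j hj => ?_⟩
    set a := (AKNS.l2du2Norm χ z.im (AKNS.modulate (2 * z.re) u)).toReal
    set b := (AKNS.l2du2Norm χ z.im (AKNS.modulate (2 * z.re) v)).toReal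
    have ha0 : 0 ≤ a := ENNReal.toReal_nonneg
    have hb0 : 0 ≤ b := ENNReal.toReal_nonneg
    have hq : 0 ≤ AKNS.kernelConst * (N * b * (N * a)) := by positivity
    refine (AKNS.norm_T_add_norm_Ttilde_le hq hb.norm_T_le hj).trans ?_
    rw [← mul_pow]
    refine pow_le_pow_left₀ (by positivity) ?_ j
    have e1 : 3 * (AKNS.kernelConst * (N * b * (N * a))) = K * (a * b) := by rw [hKdef]; ring
    have e2 : (1 + K) * a * ((1 + K) * b) = (1 + K) ^ 2 * (a * b) := by ring
    rw [e1, e2]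
    exact mul_le_mul_of_nonneg_right (by nlinarith) (mul_nonneg ha0 hb0)
  · obtain ⟨N, hN, H⟩ := AKNS.exists_locallyBounded_of_unit_scale χ
    set K := AKNS.kernelConst * N ^ 2 with hKdef
    have hK0 : 0 ≤ K := by positivity
    -- Chosen so that $K\delta^2\le1/8$, the threshold for exponentiating the logarithmic series.
    set δ := 1 / (8 * (1 + K)) with hδ
    have hδ0 : 0 < δ := by positivity
    have hδ1 : δ ≤ 1 := by
      rw [hδ, div_le_one (by positivity)]
      linarith
    have hKδ : K * (δ * δ) ≤ 1 / 8 := by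
      have h1 : (1 + K) * δ = 1 / 8 := by rw [hδ]; field_simp
      nlinarith [mul_nonneg hK0 hδ0.le]
    refine ⟨δ, hδ0, fun u v hu hv => ?_⟩
    obtain ⟨hUu, HU⟩ := H u (ne_top_of_le_ne_top ENNReal.ofReal_ne_top hu)
    obtain ⟨hVv, HV⟩ := H v (ne_top_of_le_ne_top ENNReal.ofReal_ne_top hv)
    have hau : (AKNS.l2du2Norm χ 1 u).toReal ≤ δ := ENNReal.toReal_le_of_le_ofReal hδ0.le hu
    have hav : (AKNS.l2du2Norm χ 1 v).toReal ≤ δ := ENNReal.toReal_le_of_le_ofReal hδ0.le hv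
    have ha0 : 0 ≤ (AKNS.l2du2Norm χ 1 u).toReal := ENNReal.toReal_nonneg
    have hb0 : 0 ≤ (AKNS.l2du2Norm χ 1 v).toReal := ENNReal.toReal_nonneg
    set q := AKNS.kernelConst * (N * (AKNS.l2du2Norm χ 1 v).toReal *
      (N * (AKNS.l2du2Norm χ 1 u).toReal)) with hqdef
    have hq0 : 0 ≤ q := by positivity
    have hq8 : q ≤ 1 / 8 := by
      refine le_trans ?_ hKδ
      have e : q = K * ((AKNS.l2du2Norm χ 1 v).toReal * (AKNS.l2du2Norm χ 1 u).toReal) := by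
        rw [hqdef, hKdef]; ring
      rw [e]
      gcongr
    have hz : ∀ z : ℂ, 1 + |z.re| ≤ z.im → AKNS.IteratedIntegralsExist z u v ∧
        ∀ j, ‖AKNS.T z u v j‖ ≤ q ^ j := by
      intro z hz
      have h1 : 1 ≤ z.im := by linarith [abs_nonneg z.re]
      -- The cone enters only through this frequency bound and $\operatorname{Im}z\ge1$.
      have h2 : |2 * z.re| ≤ 2 * z.im := by
        rw [abs_mul, abs_two]; linarith
      obtain ⟨B, hB, hBl⟩ := HU (2 * z.re) z.im h1 h2
      obtain ⟨A, hA, hAl⟩ := HV (2 * z.re) z.im h1 h2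
      have hb : AKNS.KernelBounds z (AKNS.primitive u) (AKNS.primitive v) A B _ _ :=
        ⟨by linarith, hA, hB, hAl, hBl⟩
      exact ⟨hb.iteratedIntegralsExist hUu hVv, hb.norm_T_le⟩
    have hsq : Summable fun j : ℕ => q ^ j := summable_geometric_of_lt_one hq0 (by linarith)
    have hsq2 : Summable fun j : ℕ => (2 * q) ^ j :=
      summable_geometric_of_lt_one (by linarith) (by linarith)
    have hT := tendstoUniformlyOn_tsum_nat hsq (f := fun j z => AKNS.T z u v j)
      (s := {z : ℂ | 1 + |z.re| ≤ z.im}) fun j z hzm => (hz z hzm).2 j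
    have hTt := tendstoUniformlyOn_tsum_nat hsq2 (f := fun j z => AKNS.Ttilde z u v j)
      (s := {z : ℂ | 1 + |z.re| ≤ z.im}) fun j z hzm =>
        AKNS.norm_logCoeff_le (AKNS.T_zero z u v) hq0 (hz z hzm).2 j
    refine ⟨fun z hzm => (hz z hzm).1, fun z => ∑' j, AKNS.T z u v j,
      fun z => ∑' j, AKNS.Ttilde z u v j, ?_, ?_, fun z hzm => ?_⟩
    · intro s hs
      -- The partial sum up to index $n$ has $n+1$ terms counting $T_0=1$, hence the shift.
      refine ((tendsto_add_atTop_nat 1).eventually (hT s hs)).mono fun n hn z hzm => ?_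
      change (∑' j, AKNS.T z u v j, 1 + ∑ j ∈ Finset.Icc 1 n, AKNS.T z u v j) ∈ s
      rw [AKNS.one_add_sum_Icc (AKNS.T_zero z u v)]
      exact hn z hzm
    · intro s hs
      refine ((tendsto_add_atTop_nat 1).eventually (hTt s hs)).mono fun n hn z hzm => ?_
      have e : ∑ j ∈ Finset.Icc 1 n, AKNS.Ttilde z u v j =
          ∑ j ∈ Finset.range (n + 1), AKNS.Ttilde z u v j := by
        rw [Finset.range_eq_Ico, Finset.sum_eq_sum_Ico_succ_bot (Nat.succ_pos n),
          AKNS.Ttilde_eq_logCoeff, AKNS.logCoeff_zero (AKNS.T_zero z u v), zero_add]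
        rfl
      change (∑' j, AKNS.Ttilde z u v j, ∑ j ∈ Finset.Icc 1 n, AKNS.Ttilde z u v j) ∈ s
      rw [e]
      exact hn z hzm
    · exact AKNS.exp_tsum_logCoeff (AKNS.T_zero z u v) hq0 hq8 (hz z hzm).2
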